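/- \textbf{Theorem (Carleman estimate).} Let $n\ge 1$, $a\in(-1,1)$, $\Lambda>1$ and $K>0$. Write points of $\mathbb R^{n+1}$ as $X=(x,x_{n+1})$, let $\mathbb R^{n+1}_+=\{x_{n+1}>0\}$ and $\mathbb B_4^+=\{|X|<4\}\cap\mathbb R^{n+1}_+$, and let $\nabla$, $\operatorname{div}$ act in $X$. Let $A(x,t)=(a_{ij}(x,t))$, $(x,t)\in\mathbb R^n\times\mathbb R$, be symmetric real $(n+1)\times(n+1)$ matrices with $\Lambda^{-1}\mathbb I\le A\le\Lambda\mathbb I$, $A(0,0)=\mathbb I$, $a_{(n+1)i}=\delta_{(n+1)i}$ for all $i$, and $|A(x,t)-A(y,s)|\le K(|x-y|+|t-s|)$ (Frobenius norm), and put $$\widetilde{\mathcal H}w=x_{n+1}^a\,\partial_t w+\operatorname{div}\bigl(x_{n+1}^aA(x,t)\nabla w\bigr),\qquad G(X,t)=t^{-\frac{n+1+a}{2}}e^{-\frac{|X|^2}{4t}} .$$ For $\lambda>0$ let $\sigma$ be the solution on $0\le\lambda t<1$ of $$\frac{d}{dt}\log\Bigl(\frac{\sigma}{t\sigma'}\Bigr)=\frac{\theta(\lambda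 t)}{t},\quad \sigma(0)=0,\ \sigma'(0)=1,\qquad \theta(t)=t^{1/2}\Bigl(\log\frac1t\Bigr)^{3/2},$$ with $\sigma,\sigma'>0$ for $t>0$. There are constants $N,c'>0$ and $\delta_0\in(0,1)$, depending only on $n,a,\Lambda,K$, such that for every $\delta\in(0,\delta_0]$ there is $\alpha_0>0$, depending only on $n,a,\Lambda,K,\delta$, with the following property. Let $\alpha\ge\alpha_0$, $\lambda=\alpha/\delta^2$ and $0<c\le\frac1{5\lambda}$, let $A$ be as above, and let $w\in C_0^\infty\bigl(\overline{\mathbb B_4^+}\times[0,\frac1{3\lambda})\bigr)$ (extended by zero to a function smooth on $\overline{\mathbb R^{n+1}_+}\times[0,\infty)$) satisfy $\lim_{x_{n+1}\to0^+}x_{n+1}^a\partial_{n+1}w(x,x_{n+1},t)=0$ for all $x\in\mathbb R^n$ and $t\ge0$. Then $$\begin{aligned} &\alpha^2\int_{\mathbb R^{n+1}_+\times[c,\infty)}x_{n+1}^a\sigma^{-2\alpha}(t)\,w^2\,G\,dX\,dt+\alpha\int_{\mathbb R^{n+1}_+\times[c,\infty)}x_{n+1}^a\sigma^{1-2\alpha}(t)\,|\nabla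 w|^2\,G\,dX\,dt\\ &\quad\le N\int_{\mathbb R^{n+1}_+\times[c,\infty)}\sigma^{1-2\alpha}(t)\,x_{n+1}^{-a}\,|\widetilde{\mathcal H}w|^2\,G\,dX\,dt+N\alpha^{c'\alpha}\sup_{t\ge c}\int_{\mathbb R^{n+1}_+}x_{n+1}^a\bigl(w^2+t|\nabla w|^2\bigr)\,dX\\ &\qquad+\sigma^{-2\alpha}(c)\Bigl\{-\frac cN\int_{\mathbb R^{n+1}_+}x_{n+1}^a|\nabla w(X,c)|^2G(X,c)\,dX+N\alpha\int_{\mathbb R^{n+1}_+}x_{n+1}^a\,w(X,c)^2\,G(X,c)\,dX\Bigr\}. \end{aligned}$$ Every integral is that of a nonnegative function; the one containing $\widetilde{\mathcal H}w$ may be $+\infty$, in which case the estimate is trivial, and all the others are finite. -/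

import Mathlib

open MeasureTheory Set Filter Topology
open scoped ENNReal ContDiff

noncomputable section

namespace Carleman

/-- The ambient space `ℝ^{n+1}` of points `X = (x, x_{n+1})`, with its Euclidean norm. -/
abbrev Space (n : ℕ) : Type := EuclideanSpace ℝ (Fin (n + 1))

/-- The horizontal part `x ∈ ℝⁿ` of `X = (x, x_{n+1})`. -/
def horiz {n : ℕ} (X : Space n) : EuclideanSpace ℝ (Fin n) :=
  WithLp.toLp 2 (fun i : Fin n => X i.castSucc)

/-- The extension variable `x_{n+1}` of `X = (x, x_{n+1})`. -/
def vert {n : ℕ} (X : Space n) : ℝ := X (Fin.last n)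

/-- The point `(x, z)` of `ℝ^{n+1}`. -/
def mkPoint {n : ℕ} (x : EuclideanSpace ℝ (Fin n)) (z : ℝ) : Space n :=
  WithLp.toLp 2 (Fin.snoc (α := fun _ => ℝ) (fun i : Fin n => x i) z)

/-- The open half space `ℝ^{n+1}_+ = {x_{n+1} > 0}`. -/
def halfSpace (n : ℕ) : Set (Space n) := {X | 0 < vert X}

/-- The open half ball of radius `r` centred at `0`. -/
def halfBall (n : ℕ) (r : ℝ) : Set (Space n) := Metric.ball 0 r ∩ {X | 0 < vert X}

/-- The closed set `{x_{n+1} ≥ 0} × {t ≥ 0}` in space-time. -/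
def closedQuarter (n : ℕ) : Set (Space n × ℝ) := {p | 0 ≤ vert p.1 ∧ 0 ≤ p.2}

/-- The partial derivative `∂_i f` of a function on `ℝ^{n+1}`. -/
def pderiv {n : ℕ} (i : Fin (n + 1)) (f : Space n → ℝ) (X : Space n) : ℝ :=
  fderiv ℝ f X (EuclideanSpace.single i 1)

/-- The squared length `|∇ w(X,t)|²` of the gradient in the space variables. -/
def gradSq {n : ℕ} (w : Space n × ℝ → ℝ) (X : Space n) (t : ℝ) : ℝ :=
  ∑ i : Fin (n + 1), (pderiv i (fun Y => w (Y, t)) X) ^ 2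

/-- Functions in `C₀^∞ (closure 𝔹₄⁺ × [0, T))`, extended by zero: smooth up to `x_{n+1} = 0` and up
to `t = 0`, and vanishing outside a compact subset. Only the values on
`{x_{n+1} ≥ 0} × {t ≥ 0}` are of any concern. -/
structure IsTestFunction (n : ℕ) (T : ℝ) (w : Space n × ℝ → ℝ) : Prop where
  smooth : ContDiffOn ℝ ∞ w (closedQuarter n)
  compactSupport : ∃ S : Set (Space n × ℝ), IsCompact S ∧
    S ⊆ closure (halfBall n 4) ×ˢ Ico 0 T ∧ ∀ p ∈ closedQuarter n, p ∉ S → w p = 0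

/-- The weighted Neumann derivative `lim_{x_{n+1} → 0+} x_{n+1}^a ∂_{n+1} w` exists and vanishes at
every point of `{x_{n+1} = 0}`, at all times `t ≥ 0`. -/
def HasZeroWeightedNeumann {n : ℕ} (a : ℝ) (w : Space n × ℝ → ℝ) : Prop :=
  ∀ (x : EuclideanSpace ℝ (Fin n)) (t : ℝ), 0 ≤ t →
    Tendsto (fun z : ℝ => z ^ a * pderiv (Fin.last n) (fun Y => w (Y, t)) (mkPoint x z))
      (𝓝[>] 0) (𝓝 0)

/-- The assumptions on the coefficient matrix: symmetric and uniformly elliptic with constant `Λ`,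
`A(0,0) = I`, last row `e_{n+1}`, Lipschitz in `(x,t)` with constant `K`
(for the Frobenius norm on matrices). -/
structure IsAdmissible (n : ℕ) (Λ K : ℝ)
    (A : EuclideanSpace ℝ (Fin n) → ℝ → Matrix (Fin (n + 1)) (Fin (n + 1)) ℝ) : Prop where
  symm : ∀ x t, (A x t).IsSymm
  lower : ∀ x t (ξ : Fin (n + 1) → ℝ), Λ⁻¹ * (ξ ⬝ᵥ ξ) ≤ ξ ⬝ᵥ (A x t).mulVec ξ
  upper : ∀ x t (ξ : Fin (n + 1) → ℝ), ξ ⬝ᵥ (A x t).mulVec ξ ≤ Λ * (ξ ⬝ᵥ ξ)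
  normalized : A 0 0 = 1
  last_row : ∀ x t i, A x t (Fin.last n) i = if i = Fin.last n then 1 else 0
  lipschitz : ∀ x t y s,
    Real.sqrt (∑ i, ∑ j, (A x t i j - A y s i j) ^ 2) ≤ K * (‖x - y‖ + |t - s|)

/-- The backward operator `x_{n+1}^a ∂_t w + div (x_{n+1}^a A(x,t) ∇ w)`, evaluated at a point with
`x_{n+1} > 0` and `t > 0`. For Lipschitz `A` and smooth `w` the classical derivatives exist almost
everywhere. -/
def backwardOp {n : ℕ} (a : ℝ)
    (A : EuclideanSpace ℝ (Fin n) → ℝ → Matrix (Fin (n + 1)) (Fin (n + 1)) ℝ)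
    (w : Space n × ℝ → ℝ) (X : Space n) (t : ℝ) : ℝ :=
  vert X ^ a * deriv (fun s => w (X, s)) t +
    ∑ i : Fin (n + 1), pderiv i
      (fun Y => vert Y ^ a *
        ∑ j : Fin (n + 1), A (horiz Y) t i j * pderiv j (fun Z => w (Z, t)) Y) X

/-- `θ(t) = t^{1/2} (log (1/t))^{3/2}`. -/
def theta (t : ℝ) : ℝ := t ^ (1 / 2 : ℝ) * Real.log (1 / t) ^ (3 / 2 : ℝ)

/-- `σ` solves `d/dt log (σ / (t σ')) = θ(λt)/t` on `0 < λt < 1`, with `σ(0) = 0` and `σ'(0) = 1`;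
positivity of `σ` and `σ'` makes the logarithm meaningful. -/
structure IsCarlemanWeight (lam : ℝ) (σ : ℝ → ℝ) : Prop where
  zero : σ 0 = 0
  deriv_zero : HasDerivWithinAt σ 1 (Ici 0) 0
  differentiable : ∀ t ∈ Ioo 0 (1 / lam), DifferentiableAt ℝ σ t
  pos : ∀ t ∈ Ioo 0 (1 / lam), 0 < σ t
  deriv_pos : ∀ t ∈ Ioo 0 (1 / lam), 0 < deriv σ t
  ode : ∀ t ∈ Ioo 0 (1 / lam),
    HasDerivAt (fun s => Real.log (σ s / (s * deriv σ s))) (theta (lam * t) / t) t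

/-- `G(X,t) = t^{-(n+1+a)/2} e^{-|X|²/(4t)}`. -/
def gaussian {n : ℕ} (a : ℝ) (X : Space n) (t : ℝ) : ℝ :=
  1 / t ^ (((n : ℝ) + 1 + a) / 2) * Real.exp (-‖X‖ ^ 2 / (4 * t))

/-- The integral over `ℝ^{n+1}_+ × [c, ∞)` of a nonnegative function, with values in `[0, ∞]`. -/
def spaceTimeInt (n : ℕ) (c : ℝ) (f : Space n → ℝ → ℝ) : ℝ≥0∞ :=
  ∫⁻ p in halfSpace n ×ˢ Ici c, ENNReal.ofReal (f p.1 p.2)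

/-- The integral over `ℝ^{n+1}_+` of a nonnegative function, with values in `[0, ∞]`. -/
def spaceInt (n : ℕ) (f : Space n → ℝ) : ℝ≥0∞ :=
  ∫⁻ X in halfSpace n, ENNReal.ofReal (f X)

end Carleman

end

/-! Write `H` for the backward operator divided by x_{n+1}^a, and put ρ = σ^{-2α}, η = σ/σ', V =
AX/(2t), Z = ∂_t + V·∇. If A = I, the density x_{n+1}^a G is exactly invariant along Z. For general
A the failure is `defect`, whose leading part is F = X·(X - AX)/(4t²) (`mainDefect`). Since A is
Lipschitz and A(0,0) = I, every such error carries a factor |X| + t.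

In L²(x_{n+1}^a ρ G) the operator splits as H = Y + (H - Y), where Y = Zw + Fw/2 - αw/η (`antiPart`)
is antisymmetric up to lower order and H - Y is symmetric in space. Then 2ηY(H - Y) plus a
commutator is, after multiplication by the weight, an exact divergence (`carleman_identity`).
Integrating it leaves only the quadratic form of H - Y at the initial time t = c. The main part of
the commutator is -(η' - η/t) A∇w·∇w, and the differential equation for σ says precisely that η' -
η/t = θ(λt)η/t ≥ θ(λt). Together with 2Y(H - Y) ≤ H²/2 this controls the weighted integral of θ|∇w|²
(`commutator_le`, `carleman_integrand_le`).

Two further identities upgrade this to control of θM, where M = αw²/t + |X|²w²/t² + |∇w|²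
(`errSize`). Testing the equation with ρθw gains θαw²/t (`caccioppoli_identity`), and the Euler
identity for the field w²GX gains θ|X|²w²/t² (`integral_euler`). A fixed linear combination of the
three closes up to errors (|X| + t)M (`exists_interior_bound`). Because θ(λt) ≥ λt ≥ αt and σ ≤ t,
the quantity θM dominates both α²w² and ασ|∇w|², which are the integrands to be estimated.

The errors are split at |X| = εθ(λt). Inside, |X| + t ≤ 2εθ and they are absorbed. Outside,
|X|²/(4t) is at least 4α log(1/(λt)), so the Gaussian beats the singularity of σ^{-2α} at t = 0 and
leaves only a factor α^{c'α} in front of the unweighted energy (`gaussian_mul_rho_split`). The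
boundary terms at t = c are treated in the same way, with the Euler identity on the slice
(`slice_bound`).

All integrations by parts are made with difference quotients and dominated convergence, for
functions that are Lipschitz and almost everywhere differentiable. The weighted Neumann condition
removes the boundary term on x_{n+1} = 0. -/

namespace Carleman

/-! ### Integration by parts on a half space with a power weight. -/

/-- Bounded and Lipschitz on `K`. -/
def BddLip {E : Type*} [NormedAddCommGroup E] (K : Set E) (f : E → ℝ) : Prop :=
  ∃ C : ℝ, 0 ≤ C ∧ (∀ p ∈ K, |f p| ≤ C) ∧ ∀ p ∈ K, ∀ q ∈ K, |f p - f q| ≤ C * ‖p - q‖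

section ibp
variable {E : Type*} [NormedAddCommGroup E] [NormedSpace ℝ E] [FiniteDimensional ℝ E]
  [MeasurableSpace E] [BorelSpace E] {μ : Measure E} [μ.IsAddHaarMeasure]

set_option linter.unusedSectionVars false

/-- By translation invariance, the difference quotient of `f` along `v` integrates over `Ω` to minus
h⁻¹ times the integral of `f` over the layer of points that have no preimage in `Ω` under the shift.
Domination by `g` allows h → 0, and the limit of the layer integrals is the boundary term. -/
theorem integral_lineDeriv_eq_neg {Ω : Set E} (hΩ : MeasurableSet Ω) {v : E}
    (hshift : ∀ h : ℝ, 0 < h → ∀ p ∈ Ω, p + h • v ∈ Ω) {f f' g : E → ℝ}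
    (hf : IntegrableOn f Ω μ) (hg : IntegrableOn g Ω μ)
    (hdom : ∀ᶠ h : ℝ in 𝓝[>] 0, ∀ p ∈ Ω, |f (p + h • v) - f p| ≤ h * g p)
    (hd : ∀ᵐ p ∂μ.restrict Ω, HasLineDerivAt ℝ f (f' p) p v) {l : ℝ}
    (hl : Tendsto (fun h : ℝ => h⁻¹ * ∫ p in Ω ∩ {p | p - h • v ∉ Ω}, f p ∂μ) (𝓝[>] 0) (𝓝 l)) :
    IntegrableOn f' Ω μ ∧ ∫ p in Ω, f' p ∂μ = -l := by
  have hpos : ∀ᶠ h : ℝ in 𝓝[>] 0, 0 < h := self_mem_nhdsWithin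
  have hmp : ∀ h : ℝ, MeasurePreserving (fun p : E => p - h • v) μ μ := fun h =>
    measurePreserving_sub_right μ (h • v)
  have hsm : ∀ h : ℝ, MeasurableSet {p : E | p - h • v ∈ Ω} := fun h =>
    (hmp h).measurable hΩ
  have hind : ∀ h : ℝ, 0 < h → Integrable (({p : E | p - h • v ∈ Ω}).indicator f) μ := by
    intro h hh
    rw [integrable_indicator_iff (hsm h)]
    refine hf.mono_set fun p hp => ?_
    have := hshift h hh _ hp
    simpa using this
  have hcomp : ∀ h : ℝ, ∀ p : E, Ω.indicator (fun p => f (p + h • v)) p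
      = ({p : E | p - h • v ∈ Ω}).indicator f (p + h • v) := by
    intro h p
    by_cases hp : p ∈ Ω <;> simp [indicator, hp]
  have hshI : ∀ h : ℝ, 0 < h → IntegrableOn (fun p => f (p + h • v)) Ω μ := by
    intro h hh
    rw [← integrable_indicator_iff hΩ]
    have := (hind h hh).comp_add_right (h • v)
    refine this.congr (Eventually.of_forall fun p => ?_)
    simp [hcomp h p]
  have hval : ∀ h : ℝ, 0 < h → ∫ p in Ω, h⁻¹ * (f (p + h • v) - f p) ∂μ
      = -(h⁻¹ * ∫ p in Ω ∩ {p | p - h • v ∉ Ω}, f p ∂μ) := by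
    intro h hh
    rw [integral_const_mul, integral_sub (hshI h hh) hf]
    have e1 : ∫ p in Ω, f (p + h • v) ∂μ = ∫ p in {p : E | p - h • v ∈ Ω}, f p ∂μ := by
      rw [← integral_indicator hΩ, ← integral_indicator (hsm h)]
      simp_rw [hcomp h]
      exact integral_add_right_eq_self _ (h • v)
    have e2 : ∫ p in Ω, f p ∂μ = ∫ p in {p : E | p - h • v ∈ Ω}, f p ∂μ
        + ∫ p in Ω ∩ {p | p - h • v ∉ Ω}, f p ∂μ := by
      rw [← setIntegral_union]
      · congr 2
        ext p
        simp only [mem_union, mem_ofPred_eq, mem_inter_iff]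
        constructor
        · intro hp
          by_cases h1 : p - h • v ∈ Ω <;> simp [h1, hp]
        · rintro (hp | hp)
          · simpa using hshift h hh _ hp
          · exact hp.1
      · rw [disjoint_left]
        intro p hp hq
        exact hq.2 hp
      · exact hΩ.inter (hsm h).compl
      · exact hf.mono_set fun p hp => by simpa using hshift h hh _ hp
      · exact hf.mono_set inter_subset_left
    rw [e1, e2]
    ring
  have hmeas : ∀ h : ℝ, 0 < h →
      AEStronglyMeasurable (fun p => h⁻¹ * (f (p + h • v) - f p)) (μ.restrict Ω) := fun h hh =>
    (((hshI h hh).sub hf).const_mul _).aestronglyMeasurable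
  have hb : ∀ᶠ h : ℝ in 𝓝[>] 0, ∀ᵐ p ∂μ.restrict Ω, ‖h⁻¹ * (f (p + h • v) - f p)‖ ≤ g p := by
    filter_upwards [hpos, hdom] with h hh hd
    rw [ae_restrict_iff' hΩ]
    refine Eventually.of_forall fun p hp => ?_
    rw [norm_mul, norm_inv, Real.norm_eq_abs, Real.norm_eq_abs, abs_of_pos hh, inv_mul_le_iff₀ hh]
    exact hd p hp
  have hlim : ∀ᵐ p ∂μ.restrict Ω,
      Tendsto (fun h : ℝ => h⁻¹ * (f (p + h • v) - f p)) (𝓝[>] 0) (𝓝 (f' p)) := by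
    filter_upwards [hd] with p hp
    simpa using hp.tendsto_slope_zero_right
  -- Measurability of `f'` and the bound by `g` almost everywhere both need a countable family of
  -- increments, hence a sequence.
  obtain ⟨u, hu⟩ := exists_seq_tendsto (𝓝[>] (0 : ℝ))
  have hupos : ∀ᶠ k in atTop, 0 < u k := hu.eventually hpos
  have hf'm : AEStronglyMeasurable f' (μ.restrict Ω) := by
    obtain ⟨k0, hk0⟩ := eventually_atTop.1 hupos
    refine aestronglyMeasurable_of_tendsto_ae atTop
      (f := fun k p => (u (k + k0))⁻¹ * (f (p + u (k + k0) • v) - f p))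
      (fun k => hmeas _ (hk0 _ (by omega))) ?_
    filter_upwards [hlim] with p hp
    exact (hp.comp hu).comp (tendsto_add_atTop_nat k0)
  have hT := tendsto_integral_filter_of_dominated_convergence g
    (hpos.mono fun h hh => hmeas h hh) hb hg hlim
  refine ⟨?_, ?_⟩
  · refine Integrable.mono' hg hf'm ?_
    have hbs : ∀ᶠ k in atTop, ∀ᵐ p ∂μ.restrict Ω, ‖(u k)⁻¹ * (f (p + u k • v) - f p)‖ ≤ g p :=
      hu.eventually hb
    obtain ⟨k0, hk0⟩ := eventually_atTop.1 hbs
    have : ∀ᵐ p ∂μ.restrict Ω, ∀ k, ‖(u (k + k0))⁻¹ * (f (p + u (k + k0) • v) - f p)‖ ≤ g p :=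
      ae_all_iff.2 fun k => hk0 _ (by omega)
    filter_upwards [this, hlim] with p h1 h2
    exact le_of_tendsto (((h2.comp hu).comp (tendsto_add_atTop_nat k0)).norm)
      (Eventually.of_forall h1)
  · refine tendsto_nhds_unique hT ?_
    refine hl.neg.congr' ?_
    filter_upwards [hpos] with h hh
    exact (hval h hh).symm

theorem abs_rpow_add_sub_rpow_le {a x h : ℝ} (ha : a < 1) (hx : 0 < x) (hh : 0 ≤ h) :
    |(x + h) ^ a - x ^ a| ≤ |a| * h * x ^ (a - 1) := by
  have key := (convex_Icc x (x + h)).norm_image_sub_le_of_norm_hasDerivWithin_le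
    (f := fun y : ℝ => y ^ a) (f' := fun y => a * y ^ (a - 1)) (C := |a| * x ^ (a - 1))
    (x := x) (y := x + h)
    (fun y hy => (Real.hasDerivAt_rpow_const (Or.inl (by linarith [hy.1]))).hasDerivWithinAt)
    (fun y hy => by
      rw [norm_mul, Real.norm_eq_abs, Real.norm_eq_abs,
        abs_of_nonneg (Real.rpow_nonneg (by linarith [hy.1]) _)]
      exact mul_le_mul_of_nonneg_left
        (Real.rpow_le_rpow_of_nonpos hx hy.1 (by linarith)) (abs_nonneg a))
    ⟨le_rfl, by linarith⟩ ⟨by linarith, le_rfl⟩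
  rw [Real.norm_eq_abs, Real.norm_eq_abs, add_sub_cancel_left, abs_of_nonneg hh] at key
  linarith [key]

/-- The geometry used for integration by parts on a domain in a half space `{ζ > 0}`: functions
supported in `K'` are controlled on the slightly larger `K`. -/
structure HalfDomain (μ : Measure E) (ζ : E →L[ℝ] ℝ) (Ω K K' : Set E) : Prop where
  measΩ : MeasurableSet Ω
  measK : MeasurableSet K
  measK' : MeasurableSet K'
  convΩ : Convex ℝ Ω
  convK' : Convex ℝ K'
  subK : K ⊆ Ω
  subK' : K' ⊆ K
  pos : ∀ p ∈ Ω, 0 < ζ p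
  le : ∀ p ∈ K, ζ p ≤ 5
  integ : ∀ s : ℝ, -1 < s → IntegrableOn (fun p => ζ p ^ s) K μ

/-- A direction that is admissible for integration by parts in space. -/
structure HalfDomain.Direction (ζ : E →L[ℝ] ℝ) (Ω K K' : Set E) (v : E) : Prop where
  nonneg : 0 ≤ ζ v
  shift : ∀ h : ℝ, 0 < h → ∀ p ∈ Ω, p + h • v ∈ Ω
  exit : ∀ h : ℝ, 0 < h → ∀ p ∈ Ω, p - h • v ∉ Ω → ζ p ≤ h * ζ v
  near : ∀ᶠ h : ℝ in 𝓝[>] 0, ∀ p ∈ Ω, (p ∈ K' → p + h • v ∈ K) ∧ (p + h • v ∈ K' → p ∈ K)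

/-- Lipschitz on `K` and almost everywhere differentiable on `K'`. -/
structure Good (μ : Measure E) (K K' : Set E) (f : E → ℝ) : Prop where
  lip : BddLip K f
  diff : ∀ᵐ p ∂μ.restrict K', DifferentiableAt ℝ f p

/-- Convex sets have null frontier, so almost every point of `Ω` is interior to `Ω` and either lies
in `K'`, where the product rule applies, or lies outside the closure of `K'`, where the function
vanishes nearby. -/
theorem HalfDomain.ae_hasLineDerivAt {ζ : E →L[ℝ] ℝ} {Ω K K' : Set E}
    (D : HalfDomain μ ζ Ω K K') {v : E} (a : ℝ) {ψ : E → ℝ}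
    (hψ : ∀ᵐ p ∂μ.restrict K', DifferentiableAt ℝ ψ p) (h0 : ∀ p ∈ Ω, p ∉ K' → ψ p = 0) :
    ∀ᵐ p ∂μ.restrict Ω, HasLineDerivAt ℝ (fun p => ζ p ^ a * ψ p)
      (K'.indicator (fun p => ζ p ^ a * (fderiv ℝ ψ p v + a * ζ v / ζ p * ψ p)) p) p v := by
  rw [ae_restrict_iff' D.measK'] at hψ
  rw [ae_restrict_iff' D.measΩ]
  have f1 : ∀ᵐ p ∂μ, p ∉ frontier Ω := compl_mem_ae_iff.2 (D.convΩ.addHaar_frontier μ)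
  have f2 : ∀ᵐ p ∂μ, p ∉ frontier K' := compl_mem_ae_iff.2 (D.convK'.addHaar_frontier μ)
  filter_upwards [hψ, f1, f2] with p hp hp1 hp2 hpΩ
  have hΩi : Ω ∈ 𝓝 p := by
    rw [mem_interior_iff_mem_nhds.symm]
    by_contra hc
    exact hp1 ⟨subset_closure hpΩ, hc⟩
  by_cases hk : p ∈ K'
  · rw [indicator_of_mem hk]
    have hz := D.pos p hpΩ
    have d1 : HasFDerivAt (fun p => ζ p ^ a) ((a * ζ p ^ (a - 1)) • ζ) p :=
      ζ.hasFDerivAt.rpow_const (Or.inl hz.ne')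
    have d2 := (d1.fun_mul (hp hk).hasFDerivAt).hasLineDerivAt v
    convert d2 using 1
    simp only [add_apply, smul_apply, smul_eq_mul]
    rw [Real.rpow_sub_one hz.ne']
    field_simp
  · rw [indicator_of_notMem hk]
    have hc : p ∉ closure K' := fun hcl =>
      hp2 ⟨hcl, fun hi => hk (interior_subset hi)⟩
    have : (fun p => ζ p ^ a * ψ p) =ᶠ[𝓝 p] fun _ => (0 : ℝ) := by
      filter_upwards [hΩi, isClosed_closure.isOpen_compl.mem_nhds hc] with q hq hq'
      rw [h0 q hq fun h => hq' (subset_closure h), mul_zero]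
    refine HasLineDerivAt.congr_of_eventuallyEq ?_ this
    simpa using (hasFDerivAt_const (0 : ℝ) p).hasLineDerivAt v

theorem HalfDomain.integrableOn_rpow_mul {ζ : E →L[ℝ] ℝ} {Ω K K' : Set E}
    (D : HalfDomain μ ζ Ω K K') {a : ℝ} (ha : -1 < a) {ψ : E → ℝ} (hψ : BddLip K ψ) :
    IntegrableOn (fun p => ζ p ^ a * ψ p) K μ := by
  obtain ⟨C, hC, hb, hL⟩ := hψ
  have hcont : ContinuousOn ψ K := by
    have : LipschitzOnWith C.toNNReal ψ K := LipschitzOnWith.of_dist_le_mul fun x hx y hy => by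
      rw [Real.dist_eq, dist_eq_norm, Real.coe_toNNReal _ hC]
      exact hL x hx y hy
    exact this.continuousOn
  refine (D.integ a ha).mul_bdd (c := C) (hcont.aestronglyMeasurable D.measK) ?_
  rw [ae_restrict_iff' D.measK]
  exact Eventually.of_forall fun p hp => hb p hp

/-- There is no boundary term. If `v` is tangential, the layer is empty up to points with ζ ≤ 0.
Otherwise the decay |ψ| ≤ C ζ^{b-a} bounds both the increments of ζ^a ψ and the layer density by
multiples of ζ^{b-1}, which is integrable as b > 0. -/
theorem HalfDomain.integral_space {ζ : E →L[ℝ] ℝ} {Ω K K' : Set E}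
    (D : HalfDomain μ ζ Ω K K') {v : E} (hv : HalfDomain.Direction ζ Ω K K' v)
    {a b : ℝ} (ha : -1 < a) (ha1 : a < 1) (hb : 0 < b) {ψ : E → ℝ} (hψ : Good μ K K' ψ)
    (h0 : ∀ p ∈ Ω, p ∉ K' → ψ p = 0)
    (hvert : ζ v = 0 ∨ ∃ C, ∀ p ∈ K', |ψ p| ≤ C * ζ p ^ (b - a)) :
    IntegrableOn (fun p => ζ p ^ a * (fderiv ℝ ψ p v + a * ζ v / ζ p * ψ p)) K' μ ∧
      ∫ p in K', ζ p ^ a * (fderiv ℝ ψ p v + a * ζ v / ζ p * ψ p) ∂μ = 0 := by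
  obtain ⟨⟨C, hC, hCb, hCL⟩, hdiff⟩ := hψ
  obtain ⟨C', hC', hvert'⟩ : ∃ C', 0 ≤ C' ∧ ∀ p ∈ K', ζ v * |ψ p| ≤ C' * ζ p ^ (b - a) := by
    rcases hvert with h | ⟨C1, h1⟩
    · exact ⟨0, le_rfl, fun p _ => by simp [h]⟩
    · refine ⟨ζ v * |C1|, mul_nonneg hv.nonneg (abs_nonneg _), fun p hp => ?_⟩
      rw [mul_assoc]
      refine mul_le_mul_of_nonneg_left ((h1 p hp).trans ?_) hv.nonneg
      exact mul_le_mul_of_nonneg_right (le_abs_self _)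
        (Real.rpow_nonneg (D.pos p (D.subK (D.subK' hp))).le _)
  have hzf : ∀ p ∈ Ω, p ∉ K' → ζ p ^ a * ψ p = 0 := fun p h1 h2 => by rw [h0 p h1 h2, mul_zero]
  have hK0 : ∀ p ∈ K, ζ v * |ψ p| ≤ C' * ζ p ^ (b - a) := by
    intro p hp
    by_cases hk : p ∈ K'
    · exact hvert' p hk
    · rw [h0 p (D.subK hp) hk]
      simpa using mul_nonneg hC' (Real.rpow_nonneg (D.pos p (D.subK hp)).le _)
  -- The first summand dominates the increments of ψ; the constant 5^a serves the case a ≥ 0, as ζ ≤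
  -- 5 on `K`. The second dominates the increments of ζ^a through the decay of ψ.
  set g : E → ℝ := K.indicator fun p =>
    C * ‖v‖ * (ζ p ^ a + 5 ^ a) + |a| * C' * ζ p ^ (b - 1) with hgdef
  have hgint : IntegrableOn g Ω μ := by
    have : IntegrableOn (fun p => C * ‖v‖ * (ζ p ^ a + 5 ^ a) + |a| * C' * ζ p ^ (b - 1)) K μ := by
      have h5 : IntegrableOn (fun _ : E => (5 : ℝ) ^ a) K μ := by
        have := (D.integ 0 (by norm_num)).mul_const ((5 : ℝ) ^ a)
        simp only [Real.rpow_zero, one_mul] at this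
        exact this
      exact (((D.integ a ha).add h5).const_mul _).add ((D.integ (b - 1) (by linarith)).const_mul _)
    exact ((integrable_indicator_iff D.measK).2 this).integrableOn
  have hfint : IntegrableOn (fun p => ζ p ^ a * ψ p) Ω μ := by
    have h1 := D.integrableOn_rpow_mul ha (ψ := ψ) ⟨C, hC, hCb, hCL⟩
    rw [← integrable_indicator_iff D.measΩ]
    rw [← integrable_indicator_iff D.measK] at h1
    refine h1.congr (Eventually.of_forall fun p => ?_)
    by_cases hk : p ∈ K
    · simp [hk, D.subK hk]
    · by_cases hp : p ∈ Ω
      · simp [hk, hp, h0 p hp fun h => hk (D.subK' h)]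
      · simp [hk, hp]
  have hdom : ∀ᶠ h : ℝ in 𝓝[>] 0, ∀ p ∈ Ω,
      |ζ (p + h • v) ^ a * ψ (p + h • v) - ζ p ^ a * ψ p| ≤ h * g p := by
    have hpos : ∀ᶠ h : ℝ in 𝓝[>] 0, 0 < h := self_mem_nhdsWithin
    filter_upwards [hpos, hv.near] with h hh hnear p hp
    have hp' := hv.shift h hh p hp
    by_cases hcase : p ∈ K' ∨ p + h • v ∈ K'
    · have hk : p ∈ K := hcase.elim (fun h => D.subK' h) (hnear p hp).2
      have hk' : p + h • v ∈ K := hcase.elim (hnear p hp).1 (fun h => D.subK' h)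
      have hz := D.pos p hp
      rw [hgdef, indicator_of_mem hk]
      have e1 : ζ (p + h • v) = ζ p + h * ζ v := by simp
      have hz' : 0 < ζ p + h * ζ v := by rw [← e1]; exact D.pos _ hp'
      have hz5 : ζ p + h * ζ v ≤ 5 := by rw [← e1]; exact D.le _ hk'
      have hle : ζ p ≤ ζ p + h * ζ v := le_add_of_nonneg_right (mul_nonneg hh.le hv.nonneg)
      rw [e1]
      have b1 : (ζ p + h * ζ v) ^ a ≤ ζ p ^ a + 5 ^ a := by
        rcases le_total 0 a with h0 | h0
        · have := Real.rpow_le_rpow hz'.le hz5 h0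
          linarith [Real.rpow_nonneg hz.le a]
        · have := Real.rpow_le_rpow_of_nonpos hz hle h0
          linarith [Real.rpow_nonneg (show (0 : ℝ) ≤ 5 by norm_num) a]
      have b2 : |ψ (p + h • v) - ψ p| ≤ C * (h * ‖v‖) := by
        have := hCL _ hk' _ hk
        rwa [add_sub_cancel_left, norm_smul, Real.norm_eq_abs, abs_of_pos hh] at this
      have b3 := abs_rpow_add_sub_rpow_le ha1 hz (mul_nonneg hh.le hv.nonneg)
      have b4 : |(ζ p + h * ζ v) ^ a - ζ p ^ a| * |ψ p| ≤ h * (|a| * C' * ζ p ^ (b - 1)) := by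
        calc |(ζ p + h * ζ v) ^ a - ζ p ^ a| * |ψ p|
            ≤ (|a| * (h * ζ v) * ζ p ^ (a - 1)) * |ψ p| :=
              mul_le_mul_of_nonneg_right b3 (abs_nonneg _)
          _ = |a| * h * ζ p ^ (a - 1) * (ζ v * |ψ p|) := by ring
          _ ≤ |a| * h * ζ p ^ (a - 1) * (C' * ζ p ^ (b - a)) := by
              refine mul_le_mul_of_nonneg_left (hK0 p hk) ?_
              have := Real.rpow_nonneg hz.le (a - 1)
              positivity
          _ = h * (|a| * C' * (ζ p ^ (a - 1) * ζ p ^ (b - a))) := by ring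
          _ = _ := by rw [← Real.rpow_add hz]; ring_nf
      have b5 : (ζ p + h * ζ v) ^ a * |ψ (p + h • v) - ψ p|
          ≤ h * (C * ‖v‖ * (ζ p ^ a + 5 ^ a)) := by
        calc _ ≤ (ζ p ^ a + 5 ^ a) * (C * (h * ‖v‖)) :=
              mul_le_mul b1 b2 (abs_nonneg _) ((Real.rpow_nonneg hz'.le a).trans b1)
          _ = _ := by ring
      calc |(ζ p + h * ζ v) ^ a * ψ (p + h • v) - ζ p ^ a * ψ p|
          = |(ζ p + h * ζ v) ^ a * (ψ (p + h • v) - ψ p)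
              + ((ζ p + h * ζ v) ^ a - ζ p ^ a) * ψ p| := by congr 1; ring
        _ ≤ _ := abs_add_le _ _
        _ = (ζ p + h * ζ v) ^ a * |ψ (p + h • v) - ψ p|
              + |(ζ p + h * ζ v) ^ a - ζ p ^ a| * |ψ p| := by
            rw [abs_mul, abs_mul, abs_of_nonneg (Real.rpow_nonneg hz'.le a)]
        _ ≤ _ := by linarith
    · push Not at hcase
      rw [h0 p hp hcase.1, h0 _ hp' hcase.2]
      simp only [mul_zero, sub_zero, abs_zero]
      refine mul_nonneg hh.le (indicator_nonneg (fun q hq => ?_) p)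
      have hz := (D.pos q (D.subK hq)).le
      have := Real.rpow_nonneg hz a
      have := Real.rpow_nonneg hz (b - 1)
      positivity
  have hlim : Tendsto (fun h : ℝ => h⁻¹ * ∫ p in Ω ∩ {p | p - h • v ∉ Ω}, ζ p ^ a * ψ p ∂μ)
      (𝓝[>] 0) (𝓝 0) := by
    have hpos : ∀ᶠ h : ℝ in 𝓝[>] 0, 0 < h := self_mem_nhdsWithin
    have hG : IntegrableOn (fun p => C' * ζ p ^ (b - 1)) K μ :=
      (D.integ (b - 1) (by linarith)).const_mul _
    -- The layer lies in {ζ ≤ hζ(v)}, which shrinks to the empty set; the integral of the fixed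
    -- integrable function ζ^{b-1} over it tends to 0.
    have hT : Tendsto (fun h : ℝ => ∫ p in K, ({p | ζ p ≤ h * ζ v} : Set E).indicator
        (fun p => C' * ζ p ^ (b - 1)) p ∂μ) (𝓝[>] 0) (𝓝 (∫ p in K, (0 : ℝ) ∂μ)) := by
      refine tendsto_integral_filter_of_dominated_convergence (fun p => C' * ζ p ^ (b - 1))
        (Eventually.of_forall fun h => ?_) (Eventually.of_forall fun h => ?_) hG ?_
      · exact hG.aestronglyMeasurable.indicator
          (measurableSet_le ζ.continuous.measurable measurable_const)
      · rw [ae_restrict_iff' D.measK]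
        refine Eventually.of_forall fun p hp => ?_
        refine (norm_indicator_le_norm_self _ _).trans ?_
        rw [Real.norm_eq_abs, abs_of_nonneg]
        exact mul_nonneg hC' (Real.rpow_nonneg (D.pos p (D.subK hp)).le _)
      · rw [ae_restrict_iff' D.measK]
        refine Eventually.of_forall fun p hp => ?_
        have hz := D.pos p (D.subK hp)
        have : ∀ᶠ h : ℝ in 𝓝[>] 0, h * ζ v < ζ p := by
          have : Tendsto (fun h : ℝ => h * ζ v) (𝓝[>] 0) (𝓝 (0 * ζ v)) :=
            ((continuous_id.mul continuous_const).tendsto 0).mono_left nhdsWithin_le_nhds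
          rw [zero_mul] at this
          exact this.eventually (gt_mem_nhds hz)
        refine tendsto_const_nhds.congr' ?_
        filter_upwards [this] with h hh
        rw [indicator_of_notMem]
        simpa using hh
    rw [integral_zero] at hT
    refine squeeze_zero_norm' ?_ hT
    filter_upwards [hpos] with h hh
    rw [norm_mul, norm_inv, Real.norm_eq_abs h, abs_of_pos hh, inv_mul_le_iff₀ hh]
    have hsm : MeasurableSet (Ω ∩ {p | p - h • v ∉ Ω}) :=
      D.measΩ.inter (((measurable_id.sub_const (h • v)) D.measΩ).compl)
    refine (norm_integral_le_integral_norm _).trans ?_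
    rw [← integral_indicator hsm, ← integral_indicator D.measK, ← integral_const_mul]
    refine integral_mono_of_nonneg (Eventually.of_forall fun p => ?_) ?_
      (Eventually.of_forall fun p => ?_)
    · exact indicator_nonneg (fun _ _ => norm_nonneg _) _
    · refine Integrable.const_mul ?_ _
      rw [integrable_indicator_iff D.measK]
      exact hG.indicator (measurableSet_le ζ.continuous.measurable measurable_const)
    · simp only
      have hR : 0 ≤ h * K.indicator (({p | ζ p ≤ h * ζ v} : Set E).indicator
          fun p => C' * ζ p ^ (b - 1)) p := by
        refine mul_nonneg hh.le (indicator_nonneg (fun q hq => indicator_nonneg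
          (fun _ _ => mul_nonneg hC' (Real.rpow_nonneg (D.pos q (D.subK hq)).le _)) _) _)
      by_cases hp : p ∈ Ω ∩ {p | p - h • v ∉ Ω}
      · rw [indicator_of_mem hp]
        by_cases hk : p ∈ K'
        · have hz := D.pos p hp.1
          have hex := hv.exit h hh p hp.1 hp.2
          rw [indicator_of_mem (D.subK' hk), indicator_of_mem (show p ∈ {p | ζ p ≤ h * ζ v} from hex),
            norm_mul, Real.norm_eq_abs, Real.norm_eq_abs, abs_of_nonneg (Real.rpow_nonneg hz.le a)]
          have h1 := hvert' p hk
          have e : ζ p ^ (b - 1) = ζ p ^ (a - 1) * ζ p ^ (b - a) := by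
            rw [← Real.rpow_add hz]; ring_nf
          calc ζ p ^ a * |ψ p| = ζ p ^ (a - 1) * (ζ p * |ψ p|) := by
                rw [Real.rpow_sub_one hz.ne']; field_simp
            _ ≤ ζ p ^ (a - 1) * (h * ζ v * |ψ p|) := by
                refine mul_le_mul_of_nonneg_left ?_ (Real.rpow_nonneg hz.le _)
                exact mul_le_mul_of_nonneg_right hex (abs_nonneg _)
            _ = ζ p ^ (a - 1) * h * (ζ v * |ψ p|) := by ring
            _ ≤ ζ p ^ (a - 1) * h * (C' * ζ p ^ (b - a)) :=
                mul_le_mul_of_nonneg_left h1 (mul_nonneg (Real.rpow_nonneg hz.le _) hh.le)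
            _ = _ := by rw [e]; ring
        · rw [hzf p hp.1 hk, norm_zero]
          exact hR
      · rw [indicator_of_notMem hp]
        exact hR
  have hfin := integral_lineDeriv_eq_neg D.measΩ hv.shift hfint hgint hdom
    (D.ae_hasLineDerivAt a hdiff h0) hlim
  have hsub : K' ⊆ Ω := D.subK'.trans D.subK
  obtain ⟨hi, hint⟩ := hfin
  rw [neg_zero, setIntegral_indicator D.measK', inter_eq_right.2 hsub] at hint
  refine ⟨?_, hint⟩
  have := hi.mono_set hsub
  rwa [IntegrableOn, integrable_indicator_iff D.measK', IntegrableOn,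
    Measure.restrict_restrict D.measK', inter_self] at this

end ibp
end Carleman

/-! ### Calculus of bounded Lipschitz, almost everywhere differentiable functions. -/

namespace Carleman

section bddlip
variable {E : Type*} [NormedAddCommGroup E] {K : Set E} {f g : E → ℝ}

theorem BddLip.const (c : ℝ) : BddLip K fun _ => c :=
  ⟨|c|, abs_nonneg c, fun _ _ => le_rfl, fun p _ q _ => by simp; positivity⟩

theorem BddLip.add (hf : BddLip K f) (hg : BddLip K g) : BddLip K fun p => f p + g p := by
  obtain ⟨C, hC, h1, h2⟩ := hf
  obtain ⟨C', hC', h1', h2'⟩ := hg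
  refine ⟨C + C', add_nonneg hC hC', fun p hp => ?_, fun p hp q hq => ?_⟩
  · exact (abs_add_le _ _).trans (add_le_add (h1 p hp) (h1' p hp))
  · rw [show f p + g p - (f q + g q) = (f p - f q) + (g p - g q) by ring, add_mul]
    exact (abs_add_le _ _).trans (add_le_add (h2 p hp q hq) (h2' p hp q hq))

theorem BddLip.mul (hf : BddLip K f) (hg : BddLip K g) : BddLip K fun p => f p * g p := by
  obtain ⟨C, hC, h1, h2⟩ := hf
  obtain ⟨C', hC', h1', h2'⟩ := hg
  refine ⟨C * C' + (C * C' + C * C'), by positivity, fun p hp => ?_, fun p hp q hq => ?_⟩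
  · rw [abs_mul]
    have := mul_le_mul (h1 p hp) (h1' p hp) (abs_nonneg _) hC
    nlinarith [mul_nonneg hC hC']
  · rw [show f p * g p - f q * g q = f p * (g p - g q) + (f p - f q) * g q by ring]
    refine (abs_add_le _ _).trans ?_
    rw [abs_mul, abs_mul]
    have a1 := mul_le_mul (h1 p hp) (h2' p hp q hq) (abs_nonneg _) hC
    have a2 := mul_le_mul (h2 p hp q hq) (h1' q hq) (abs_nonneg _) (by positivity)
    have := mul_nonneg (mul_nonneg hC hC') (norm_nonneg (p - q))
    nlinarith

theorem BddLip.const_mul (c : ℝ) (hf : BddLip K f) : BddLip K fun p => c * f p :=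
  (BddLip.const c).mul hf

theorem BddLip.sub (hf : BddLip K f) (hg : BddLip K g) : BddLip K fun p => f p - g p := by
  have := hf.add (hg.const_mul (-1))
  simpa [sub_eq_add_neg] using this

theorem BddLip.sum {ι : Type*} (s : Finset ι) {F : ι → E → ℝ} (h : ∀ i, BddLip K (F i)) :
    BddLip K fun p => ∑ i ∈ s, F i p := by
  classical
  induction s using Finset.induction_on with
  | empty => simpa using BddLip.const (K := K) 0
  | insert i s hi ih =>
    simp only [Finset.sum_insert hi]
    exact (h i).add ih

theorem BddLip.mono {L : Set E} (hf : BddLip K f) (h : L ⊆ K) : BddLip L f := by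
  obtain ⟨C, hC, h1, h2⟩ := hf
  exact ⟨C, hC, fun p hp => h1 p (h hp), fun p hp q hq => h2 p (h hp) q (h hq)⟩

theorem BddLip.comp {F : Type*} [NormedAddCommGroup F] {L : Set F} {φ : E → F} {f : F → ℝ}
    (hf : BddLip L f) (hφ : ∀ p ∈ K, φ p ∈ L) (hl : ∀ p q, ‖φ p - φ q‖ ≤ ‖p - q‖) :
    BddLip K fun p => f (φ p) := by
  obtain ⟨C, hC, h1, h2⟩ := hf
  exact ⟨C, hC, fun p hp => h1 _ (hφ p hp), fun p hp q hq =>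
    (h2 _ (hφ p hp) _ (hφ q hq)).trans (mul_le_mul_of_nonneg_left (hl p q) hC)⟩

theorem BddLip.continuousOn (hf : BddLip K f) : ContinuousOn f K := by
  obtain ⟨C, hC, hb, hL⟩ := hf
  have : LipschitzOnWith C.toNNReal f K := LipschitzOnWith.of_dist_le_mul fun x hx y hy => by
    rw [Real.dist_eq, dist_eq_norm, Real.coe_toNNReal _ hC]
    exact hL x hx y hy
  exact this.continuousOn

variable [NormedSpace ℝ E]

/-- A function that has a bounded derivative within a convex set is Lipschitz there. -/
theorem BddLip.of_hasFDerivWithinAt (hK : Convex ℝ K) {f' : E → E →L[ℝ] ℝ} {C C' : ℝ}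
    (hf : ∀ p ∈ K, HasFDerivWithinAt f (f' p) K p) (hC' : ∀ p ∈ K, |f p| ≤ C')
    (hC : ∀ p ∈ K, ‖f' p‖ ≤ C) : BddLip K f := by
  refine ⟨|C| + |C'|, by positivity, fun p hp => ?_, fun p hp q hq => ?_⟩
  · exact (hC' p hp).trans ((le_abs_self _).trans (le_add_of_nonneg_left (abs_nonneg _)))
  · have := hK.norm_image_sub_le_of_norm_hasFDerivWithin_le hf hC hq hp
    rw [Real.norm_eq_abs] at this
    refine this.trans (mul_le_mul_of_nonneg_right ?_ (norm_nonneg _))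
    exact (le_abs_self _).trans (le_add_of_nonneg_right (abs_nonneg _))

theorem BddLip.of_contDiffAt (hc : IsCompact K) (hK : Convex ℝ K)
    (hf : ∀ p ∈ K, ContDiffAt ℝ 1 f p) : BddLip K f := by
  have h1 : ContinuousOn f K := fun p hp => (hf p hp).continuousAt.continuousWithinAt
  have h2 : ContinuousOn (fderiv ℝ f) K := fun p hp =>
    ((hf p hp).fderiv_right (m := 0) (by norm_num)).continuousAt.continuousWithinAt
  obtain ⟨C', hC'⟩ := hc.exists_bound_of_continuousOn h1
  obtain ⟨C, hC⟩ := hc.exists_bound_of_continuousOn h2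
  exact BddLip.of_hasFDerivWithinAt hK
    (fun p hp => ((hf p hp).differentiableAt one_ne_zero).hasFDerivAt.hasFDerivWithinAt) hC' hC

end bddlip

theorem BddLip.of_hasDerivAt {α β : ℝ} {f f' : ℝ → ℝ} (hf : ∀ t ∈ Icc α β, HasDerivAt f (f' t) t)
    (hf' : ContinuousOn f' (Icc α β)) : BddLip (Icc α β) f := by
  have h1 : ContinuousOn f (Icc α β) := fun t ht => (hf t ht).continuousAt.continuousWithinAt
  obtain ⟨C', hC'⟩ := isCompact_Icc.exists_bound_of_continuousOn h1
  obtain ⟨C, hC⟩ := isCompact_Icc.exists_bound_of_continuousOn hf'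
  refine BddLip.of_hasFDerivWithinAt (C := C) (convex_Icc α β)
    (fun t ht => (hf t ht).hasFDerivAt.hasFDerivWithinAt) hC' fun t ht => ?_
  refine le_trans (le_of_eq ?_) (hC t ht)
  simp

section good
variable {E : Type*} [NormedAddCommGroup E] [NormedSpace ℝ E] [MeasurableSpace E]
  {μ : Measure E} {K K' : Set E} {f g : E → ℝ}

theorem Good.const (c : ℝ) : Good μ K K' fun _ => c :=
  ⟨BddLip.const c, Eventually.of_forall fun _ => differentiableAt_const c⟩

theorem Good.add (hf : Good μ K K' f) (hg : Good μ K K' g) : Good μ K K' fun p => f p + g p :=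
  ⟨hf.lip.add hg.lip, by filter_upwards [hf.diff, hg.diff] with p h1 h2 using h1.fun_add h2⟩

theorem Good.sub (hf : Good μ K K' f) (hg : Good μ K K' g) : Good μ K K' fun p => f p - g p :=
  ⟨hf.lip.sub hg.lip, by filter_upwards [hf.diff, hg.diff] with p h1 h2 using h1.fun_sub h2⟩

theorem Good.mul (hf : Good μ K K' f) (hg : Good μ K K' g) : Good μ K K' fun p => f p * g p :=
  ⟨hf.lip.mul hg.lip, by filter_upwards [hf.diff, hg.diff] with p h1 h2 using h1.fun_mul h2⟩

theorem Good.const_mul (c : ℝ) (hf : Good μ K K' f) : Good μ K K' fun p => c * f p :=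
  (Good.const c).mul hf

theorem Good.pow_two (hf : Good μ K K' f) : Good μ K K' fun p => f p ^ 2 := by
  simpa only [sq] using hf.mul hf

theorem Good.sum {ι : Type*} [Fintype ι] {F : ι → E → ℝ} (h : ∀ i, Good μ K K' (F i)) :
    Good μ K K' fun p => ∑ i, F i p := by
  refine ⟨BddLip.sum _ fun i => (h i).lip, ?_⟩
  filter_upwards [ae_all_iff.2 fun i => (h i).diff] with p hp
  exact DifferentiableAt.fun_sum fun i _ => hp i

end good

/-! ### Half balls, space-time boxes and coordinate directions. -/

section space
variable {n : ℕ}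

/-- The vertical coordinate as a continuous linear functional. -/
noncomputable def vertL (n : ℕ) : Space n →L[ℝ] ℝ := EuclideanSpace.proj (Fin.last n)

@[simp] theorem vertL_apply (X : Space n) : vertL n X = vert X := rfl

/-- The part of the half ball of radius `R` used as spatial domain. -/
def ballPart (n : ℕ) (R : ℝ) : Set (Space n) := {X | 0 < vert X ∧ ‖X‖ ≤ R}

theorem measurable_vert : Measurable (vert (n := n)) := (vertL n).continuous.measurable

theorem measurableSet_halfSpace : MeasurableSet (halfSpace n) :=
  measurableSet_lt measurable_const measurable_vert

theorem measurableSet_ballPart (R : ℝ) : MeasurableSet (ballPart n R) :=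
  (measurableSet_lt measurable_const measurable_vert).inter
    (measurableSet_le measurable_norm measurable_const)

theorem convex_halfSpace : Convex ℝ (halfSpace n) :=
  convex_halfSpace_gt (vertL n).toLinearMap.isLinear 0

theorem convex_ballPart (R : ℝ) : Convex ℝ (ballPart n R) := by
  have h : ballPart n R = halfSpace n ∩ Metric.closedBall 0 R := by
    ext X; simp [ballPart, halfSpace]
  rw [h]
  exact convex_halfSpace.inter (convex_closedBall 0 R)

theorem abs_vert_le (X : Space n) : |vert X| ≤ ‖X‖ := by
  simpa using EuclideanSpace.norm_eq X ▸ (PiLp.norm_apply_le X (Fin.last n))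

/-- The half ball lies in a box, on which the function is a product of integrable functions of one
variable each. -/
theorem integrableOn_vert_rpow {s : ℝ} (hs : -1 < s) (R : ℝ) :
    IntegrableOn (fun X : Space n => vert X ^ s) (ballPart n R) := by
  have h1 : ∀ i : Fin (n + 1), Integrable (fun x : ℝ =>
      if i = Fin.last n then (Ioc 0 |R|).indicator (fun x => x ^ s) x
      else (Icc (-|R|) |R|).indicator (fun _ => (1 : ℝ)) x) := by
    intro i
    by_cases hi : i = Fin.last n
    · simp only [hi, if_true]
      rw [integrable_indicator_iff measurableSet_Ioc]
      have := intervalIntegral.intervalIntegrable_rpow' hs (a := 0) (b := |R|)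
      rwa [intervalIntegrable_iff_integrableOn_Ioc_of_le (abs_nonneg R)] at this
    · simp only [hi, if_false]
      rw [integrable_indicator_iff measurableSet_Icc]
      exact integrableOn_const (by simp)
  have h2 := Integrable.fintype_prod (ι := Fin (n + 1)) (μ := fun _ => (volume : Measure ℝ)) h1
  have h3 := ((EuclideanSpace.volume_preserving_symm_measurableEquiv_toLp
    (Fin (n + 1))).integrable_comp_emb (MeasurableEquiv.measurableEmbedding _)).2 h2
  rw [← integrable_indicator_iff (measurableSet_ballPart R)]
  refine h3.mono' ?_ (Eventually.of_forall fun X => ?_)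
  · exact ((measurable_vert.pow_const s).indicator
      (measurableSet_ballPart R)).aestronglyMeasurable
  · by_cases hX : X ∈ ballPart n R
    · rw [indicator_of_mem hX, Real.norm_eq_abs, abs_of_nonneg (Real.rpow_nonneg hX.1.le s)]
      have hR : ∀ i, |X i| ≤ |R| := fun i =>
        (PiLp.norm_apply_le X i).trans (hX.2.trans (le_abs_self R))
      refine le_of_eq ?_
      simp only [Function.comp]
      rw [Finset.prod_eq_single (Fin.last n)]
      · simp only [if_true]
        rw [indicator_of_mem]
        · rfl
        · exact ⟨hX.1, (le_abs_self _).trans (hR _)⟩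
      · intro i _ hi
        simp only [hi, if_false]
        rw [indicator_of_mem]
        exact abs_le.1 (hR i)
      · simp
    · rw [indicator_of_notMem hX, norm_zero]
      refine Finset.prod_nonneg fun i _ => ?_
      by_cases hi : i = Fin.last n
      · simp only [hi, if_true]
        exact indicator_nonneg (fun x hx => Real.rpow_nonneg hx.1.le s) _
      · simp only [hi, if_false]
        exact indicator_nonneg (fun _ _ => zero_le_one) _

theorem halfDomain_space {R R' : ℝ} (h : R' ≤ R) (hR : R ≤ 5) :
    HalfDomain volume (vertL n) (halfSpace n) (ballPart n R) (ballPart n R') where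
  measΩ := measurableSet_halfSpace
  measK := measurableSet_ballPart R
  measK' := measurableSet_ballPart R'
  convΩ := convex_halfSpace
  convK' := convex_ballPart R'
  subK := fun _ hX => hX.1
  subK' := fun _ hX => ⟨hX.1, hX.2.trans h⟩
  pos := fun _ hX => hX
  le := fun X hX => (le_abs_self _).trans ((abs_vert_le X).trans (hX.2.trans hR))
  integ := fun _ hs => integrableOn_vert_rpow hs R

/-- The coordinate directions of `ℝ^{n+1}`. -/
noncomputable def dir (i : Fin (n + 1)) : Space n := EuclideanSpace.single i 1

theorem vert_dir (i : Fin (n + 1)) : vert (dir i) = if i = Fin.last n then 1 else 0 := by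
  simp [vert, dir, eq_comm]

theorem norm_dir (i : Fin (n + 1)) : ‖dir i‖ = 1 := by simp [dir]

theorem vert_add_smul (X : Space n) (h : ℝ) (v : Space n) :
    vert (X + h • v) = vert X + h * vert v := rfl

theorem vert_sub_smul (X : Space n) (h : ℝ) (v : Space n) :
    vert (X - h • v) = vert X - h * vert v := rfl

theorem vert_dir_nonneg (i : Fin (n + 1)) : 0 ≤ vert (dir i) := by
  rw [vert_dir]; split_ifs <;> norm_num

theorem norm_add_dir_le (X : Space n) {h : ℝ} (hh : 0 < h) (i : Fin (n + 1)) :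
    ‖X + h • dir i‖ ≤ ‖X‖ + h ∧ ‖X‖ ≤ ‖X + h • dir i‖ + h := by
  have e : ‖h • dir (n := n) i‖ = h := by rw [norm_smul, norm_dir, mul_one, Real.norm_of_nonneg hh.le]
  constructor
  · exact (norm_add_le _ _).trans (by rw [e])
  · have := norm_sub_le (X + h • dir i) (h • dir i)
    rwa [add_sub_cancel_right, e] at this

theorem direction_space {R R' : ℝ} (h : R' < R) (i : Fin (n + 1)) :
    HalfDomain.Direction (vertL n) (halfSpace n) (ballPart n R) (ballPart n R') (dir i) where
  nonneg := vert_dir_nonneg i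
  shift := fun t ht X hX => by
    have : 0 < vert X := hX
    show 0 < vert _
    rw [vert_add_smul]
    have := mul_nonneg ht.le (vert_dir_nonneg i)
    linarith
  exit := fun t ht X hX hX' => by
    have : ¬ 0 < vert _ := hX'
    rw [vert_sub_smul] at this
    simp only [vertL_apply]
    linarith
  near := by
    have h1 : ∀ᶠ t : ℝ in 𝓝[>] 0, t < R - R' :=
      (gt_mem_nhds (sub_pos.2 h)).filter_mono nhdsWithin_le_nhds
    have h2 : ∀ᶠ t : ℝ in 𝓝[>] 0, 0 < t := self_mem_nhdsWithin
    filter_upwards [h1, h2] with t ht ht0 X hX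
    have hn := norm_add_dir_le X ht0 i
    have hX0 : 0 < vert X := hX
    refine ⟨fun hk => ⟨?_, ?_⟩, fun hk => ⟨hX0, ?_⟩⟩
    · rw [vert_add_smul]
      have := mul_nonneg ht0.le (vert_dir_nonneg i)
      linarith
    · linarith [hk.2]
    · linarith [hk.2]

/-- The vertical coordinate on space-time. -/
noncomputable def vertST (n : ℕ) : Space n × ℝ →L[ℝ] ℝ :=
  (vertL n).comp (ContinuousLinearMap.fst ℝ (Space n) ℝ)

@[simp] theorem vertST_apply (p : Space n × ℝ) : vertST n p = vert p.1 := rfl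

theorem halfDomain_spaceTime {R R' c T T' : ℝ} (h : R' ≤ R) (hR : R ≤ 5) (hT : T' ≤ T) :
    HalfDomain volume (vertST n) (halfSpace n ×ˢ Ici c) (ballPart n R ×ˢ Icc c T)
      (ballPart n R' ×ˢ Icc c T') where
  measΩ := measurableSet_halfSpace.prod measurableSet_Ici
  measK := (measurableSet_ballPart R).prod measurableSet_Icc
  measK' := (measurableSet_ballPart R').prod measurableSet_Icc
  convΩ := convex_halfSpace.prod (convex_Ici c)
  convK' := (convex_ballPart R').prod (convex_Icc c T')
  subK := fun p hp => ⟨hp.1.1, hp.2.1⟩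
  subK' := fun p hp => ⟨⟨hp.1.1, hp.1.2.trans h⟩, hp.2.1, hp.2.2.trans hT⟩
  pos := fun p hp => hp.1
  le := fun p hp => (le_abs_self _).trans ((abs_vert_le p.1).trans (hp.1.2.trans hR))
  integ := fun s hs => by
    have h1 := (integrableOn_vert_rpow (n := n) hs R)
    have h2 : IntegrableOn (fun _ : ℝ => (1 : ℝ)) (Icc c T) := integrableOn_const (by simp)
    have h3 := Integrable.mul_prod h1 h2
    rw [Measure.prod_restrict] at h3
    simp only [mul_one] at h3
    rw [IntegrableOn, Measure.volume_eq_prod]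
    exact h3

theorem direction_spaceTime {R R' c T T' : ℝ} (h : R' < R) (hT : T' ≤ T) (i : Fin (n + 1)) :
    HalfDomain.Direction (vertST n) (halfSpace n ×ˢ Ici c) (ballPart n R ×ˢ Icc c T)
      (ballPart n R' ×ˢ Icc c T') (dir i, 0) where
  nonneg := vert_dir_nonneg i
  shift := fun t ht p hp => by
    refine ⟨(direction_space h i).shift t ht p.1 hp.1, ?_⟩
    simpa using hp.2
  exit := fun t ht p hp hp' => by
    refine (direction_space h i).exit t ht p.1 hp.1 fun hc => hp' ⟨hc, ?_⟩
    simpa using hp.2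
  near := by
    filter_upwards [(direction_space h i).near] with t ht p hp
    have := ht p.1 hp.1
    refine ⟨fun hk => ⟨this.1 hk.1, ?_⟩, fun hk => ⟨this.2 hk.1, ?_⟩⟩
    · simpa using ⟨hk.2.1, hk.2.2.trans hT⟩
    · have := hk.2
      simp only [Prod.snd_add, Prod.smul_snd, smul_zero, add_zero] at this
      exact ⟨this.1, this.2.trans hT⟩

end space
end Carleman

/-! ### Integration by parts in time, with its initial term. -/

namespace Carleman

variable {n : ℕ}

instance isAddHaarMeasure_spaceTime : (volume : Measure (Space n × ℝ)).IsAddHaarMeasure :=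
  inferInstanceAs ((volume : Measure (Space n)).prod (volume : Measure ℝ)).IsAddHaarMeasure

/-- Here the layer is c ≤ t < c + s. On it ψ differs from its value at t = c by O(s), so the layer
integral divided by s converges to the slice integral at t = c. The weight does not depend on t, so
integrability of x_{n+1}^a is enough. -/
theorem integral_time {R R' c T T' : ℝ} (h : R' < R) (hR : R ≤ 5) (hc : c < T') (hT : T' < T)
    {a : ℝ} (ha : -1 < a) {ψ : Space n × ℝ → ℝ}
    (hψ : Good volume (ballPart n R ×ˢ Icc c T) (ballPart n R' ×ˢ Icc c T') ψ)
    (h0 : ∀ p ∈ halfSpace n ×ˢ Ici c, p ∉ ballPart n R' ×ˢ Icc c T' → ψ p = 0) :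
    IntegrableOn (fun p : Space n × ℝ => vert p.1 ^ a * fderiv ℝ ψ p (0, 1))
      (ballPart n R' ×ˢ Icc c T') ∧
    ∫ p in ballPart n R' ×ˢ Icc c T', vert p.1 ^ a * fderiv ℝ ψ p (0, 1)
      = -∫ X in ballPart n R', vert X ^ a * ψ (X, c) := by
  have D := halfDomain_spaceTime (n := n) (c := c) h.le hR hT.le
  set Ω : Set (Space n × ℝ) := halfSpace n ×ˢ Ici c with hΩ
  set K : Set (Space n × ℝ) := ballPart n R ×ˢ Icc c T with hK
  set K' : Set (Space n × ℝ) := ballPart n R' ×ˢ Icc c T' with hK'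
  obtain ⟨⟨C, hC, hCb, hCL⟩, hdiff⟩ := hψ
  have hfint : IntegrableOn (fun p : Space n × ℝ => vert p.1 ^ a * ψ p) Ω := by
    have h1 := D.integrableOn_rpow_mul ha (ψ := ψ) ⟨C, hC, hCb, hCL⟩
    rw [← integrable_indicator_iff D.measΩ]
    rw [← integrable_indicator_iff D.measK] at h1
    refine h1.congr (Eventually.of_forall fun p => ?_)
    by_cases hk : p ∈ K
    · simp [hk, D.subK hk]
    · by_cases hp : p ∈ Ω
      · simp [hk, hp, h0 p hp fun h => hk (D.subK' h)]
      · simp [hk, hp]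
  have hshift : ∀ s : ℝ, 0 < s → ∀ p ∈ Ω, p + s • ((0, 1) : Space n × ℝ) ∈ Ω := by
    intro s hs p hp
    refine ⟨by simpa using hp.1, ?_⟩
    have : c ≤ p.2 := hp.2
    simp only [Prod.snd_add, Prod.smul_snd, smul_eq_mul, mul_one, mem_Ici]
    linarith
  set g : Space n × ℝ → ℝ := K.indicator fun p => C * vert p.1 ^ a with hg
  have hgint : IntegrableOn g Ω :=
    ((integrable_indicator_iff D.measK).2 ((D.integ a ha).const_mul C)).integrableOn
  have hpos : ∀ᶠ s : ℝ in 𝓝[>] 0, 0 < s := self_mem_nhdsWithin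
  have hsm : ∀ᶠ s : ℝ in 𝓝[>] 0, s < T - T' :=
    (gt_mem_nhds (sub_pos.2 hT)).filter_mono nhdsWithin_le_nhds
  have hdom : ∀ᶠ s : ℝ in 𝓝[>] 0, ∀ p ∈ Ω,
      |vert (p + s • ((0, 1) : Space n × ℝ)).1 ^ a * ψ (p + s • ((0, 1) : Space n × ℝ))
        - vert p.1 ^ a * ψ p| ≤ s * g p := by
    filter_upwards [hpos, hsm] with s hs hsT p hp
    have e1 : (p + s • ((0, 1) : Space n × ℝ)).1 = p.1 := by simp
    have e2 : (p + s • ((0, 1) : Space n × ℝ)).2 = p.2 + s := by simp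
    have hp2 : c ≤ p.2 := hp.2
    rw [e1]
    by_cases hcase : p ∈ K' ∨ p + s • ((0, 1) : Space n × ℝ) ∈ K'
    · have hball : p.1 ∈ ballPart n R' ∧ p.2 ≤ T' := by
        rcases hcase with h1 | h1
        · exact ⟨h1.1, h1.2.2⟩
        · have h2 := h1.2.2
          rw [e2] at h2
          exact ⟨e1 ▸ h1.1, by linarith⟩
      have hbR : p.1 ∈ ballPart n R := ⟨hball.1.1, hball.1.2.trans h.le⟩
      have hk : p ∈ K := ⟨hbR, hp2, hball.2.trans hT.le⟩
      have hk' : p + s • ((0, 1) : Space n × ℝ) ∈ K := by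
        refine ⟨e1.symm ▸ hbR, ?_⟩
        rw [e2]
        exact ⟨by linarith, by linarith [hball.2]⟩
      have hz : 0 ≤ vert p.1 ^ a := Real.rpow_nonneg (D.pos p hp).le a
      rw [hg, indicator_of_mem hk, ← mul_sub, abs_mul, abs_of_nonneg hz]
      have := hCL _ hk' _ hk
      have e3 : ‖s • ((0, 1) : Space n × ℝ)‖ = s := by
        rw [norm_smul, Real.norm_of_nonneg hs.le]; simp [Prod.norm_def]
      rw [add_sub_cancel_left, e3] at this
      calc _ ≤ vert p.1 ^ a * (C * s) := mul_le_mul_of_nonneg_left this hz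
        _ = _ := by ring
    · push Not at hcase
      rw [h0 p hp hcase.1, h0 _ (hshift s hs p hp) hcase.2]
      simp only [mul_zero, sub_zero, abs_zero]
      refine mul_nonneg hs.le (indicator_nonneg (fun q hq => ?_) p)
      exact mul_nonneg hC (Real.rpow_nonneg (D.pos q (D.subK hq)).le a)
  have hlim : Tendsto (fun s : ℝ => s⁻¹ * ∫ p in Ω ∩ {p | p - s • ((0, 1) : Space n × ℝ) ∉ Ω},
      vert p.1 ^ a * ψ p) (𝓝[>] 0) (𝓝 (∫ X in ballPart n R', vert X ^ a * ψ (X, c))) := by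
    have hI : IntegrableOn (fun X : Space n => vert X ^ a) (ballPart n R') :=
      integrableOn_vert_rpow ha R'
    rw [tendsto_iff_norm_sub_tendsto_zero]
    have hz : Tendsto (fun s : ℝ => s * (C * ∫ X in ballPart n R', vert X ^ a)) (𝓝[>] 0) (𝓝 0) := by
      have : Tendsto (fun s : ℝ => s * (C * ∫ X in ballPart n R', vert X ^ a)) (𝓝 0)
          (𝓝 (0 * (C * ∫ X in ballPart n R', vert X ^ a))) :=
        (continuous_id.mul continuous_const).tendsto 0
      rw [zero_mul] at this
      exact this.mono_left nhdsWithin_le_nhds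
    refine squeeze_zero' (Eventually.of_forall fun _ => norm_nonneg _) ?_ hz
    have hsm' : ∀ᶠ s : ℝ in 𝓝[>] 0, s < T' - c :=
      (gt_mem_nhds (sub_pos.2 hc)).filter_mono nhdsWithin_le_nhds
    filter_upwards [hpos, hsm'] with s hs hsT
    set L : Set (Space n × ℝ) := ballPart n R' ×ˢ Ico c (c + s) with hL
    have hLm : MeasurableSet L := (measurableSet_ballPart R').prod measurableSet_Ico
    have hLK : L ⊆ K := fun p hp => ⟨⟨hp.1.1, hp.1.2.trans h.le⟩, hp.2.1, by linarith [hp.2.2]⟩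
    have hset : Ω ∩ {p | p - s • ((0, 1) : Space n × ℝ) ∉ Ω} = halfSpace n ×ˢ Ico c (c + s) := by
      ext p
      simp only [hΩ, mem_inter_iff, mem_prod, mem_Ici, mem_ofPred_eq, Prod.fst_sub, Prod.smul_fst,
        smul_zero, sub_zero, Prod.snd_sub, Prod.smul_snd, smul_eq_mul, mul_one, mem_Ico]
      constructor
      · rintro ⟨⟨h1, h2⟩, h3⟩
        refine ⟨h1, h2, ?_⟩
        by_contra hcon
        exact h3 ⟨h1, by linarith⟩
      · rintro ⟨h1, h2, h3⟩
        exact ⟨⟨h1, h2⟩, fun h4 => by linarith [h4.2]⟩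
    have e1 : ∫ p in Ω ∩ {p | p - s • ((0, 1) : Space n × ℝ) ∉ Ω}, vert p.1 ^ a * ψ p
        = ∫ p in L, vert p.1 ^ a * ψ p := by
      rw [hset]
      refine setIntegral_eq_of_subset_of_forall_sdiff_eq_zero
        (measurableSet_halfSpace.prod measurableSet_Ico) ?_ ?_
      · exact fun p hp => ⟨hp.1.1, hp.2⟩
      · intro p hp
        rw [h0 p ⟨hp.1.1, hp.1.2.1⟩ fun hk => hp.2 ⟨hk.1, hp.1.2⟩, mul_zero]
    have e2 : ∫ p in L, vert p.1 ^ a * ψ (p.1, c)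
        = s * ∫ X in ballPart n R', vert X ^ a * ψ (X, c) := by
      have := setIntegral_prod_mul (μ := (volume : Measure (Space n))) (ν := (volume : Measure ℝ))
        (fun X => vert X ^ a * ψ (X, c)) (fun _ => (1 : ℝ)) (ballPart n R') (Ico c (c + s))
      simp only [mul_one] at this
      rw [hL, Measure.volume_eq_prod, this]
      simp [hs.le, mul_comm]
    have e3 : ∫ p in L, C * s * vert p.1 ^ a = C * s * (s * ∫ X in ballPart n R', vert X ^ a) := by
      have := setIntegral_prod_mul (μ := (volume : Measure (Space n))) (ν := (volume : Measure ℝ))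
        (fun X => vert X ^ a) (fun _ => (1 : ℝ)) (ballPart n R') (Ico c (c + s))
      simp only [mul_one] at this
      rw [integral_const_mul, hL, Measure.volume_eq_prod, this]
      simp [hs.le, mul_comm]
    have hcK : ∀ p ∈ L, (p.1, c) ∈ K := fun p hp => ⟨(hLK hp).1, le_rfl, by linarith⟩
    have i1 : IntegrableOn (fun p : Space n × ℝ => vert p.1 ^ a * ψ p) L :=
      (D.integrableOn_rpow_mul ha (ψ := ψ) ⟨C, hC, hCb, hCL⟩).mono_set hLK
    have hbl : BddLip K fun p : Space n × ℝ => ψ (p.1, c) :=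
      BddLip.comp (L := K) (φ := fun p : Space n × ℝ => (p.1, c)) (f := ψ) ⟨C, hC, hCb, hCL⟩
        (fun p hp => ⟨hp.1, le_rfl, by linarith⟩) fun p q => by
          simp [Prod.norm_def]
    have i2 : IntegrableOn (fun p : Space n × ℝ => vert p.1 ^ a * ψ (p.1, c)) L :=
      (D.integrableOn_rpow_mul ha hbl).mono_set hLK
    have i3 : IntegrableOn (fun p : Space n × ℝ => C * s * vert p.1 ^ a) L :=
      ((D.integ a ha).mono_set hLK).const_mul _
    have key : ‖∫ p in L, (vert p.1 ^ a * ψ p - vert p.1 ^ a * ψ (p.1, c))‖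
        ≤ ∫ p in L, C * s * vert p.1 ^ a := by
      refine norm_integral_le_of_norm_le i3 ?_
      rw [ae_restrict_iff' hLm]
      refine Eventually.of_forall fun p hp => ?_
      have hzp : 0 ≤ vert p.1 ^ a := Real.rpow_nonneg hp.1.1.le a
      rw [← mul_sub, norm_mul, Real.norm_eq_abs, Real.norm_eq_abs, abs_of_nonneg hzp]
      have h1 := hCL p (hLK hp) _ (hcK p hp)
      have h2 : ‖p - (p.1, c)‖ ≤ s := by
        simp only [Prod.norm_def, Prod.fst_sub, sub_self, norm_zero, Prod.snd_sub, Real.norm_eq_abs]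
        refine max_le hs.le (abs_le.2 ⟨by linarith [hp.2.1], by linarith [hp.2.2]⟩)
      have h3 := mul_le_mul_of_nonneg_left h2 hC
      calc vert p.1 ^ a * |ψ p - ψ (p.1, c)| ≤ vert p.1 ^ a * (C * s) :=
            mul_le_mul_of_nonneg_left (h1.trans h3) hzp
        _ = _ := by ring
    rw [integral_sub i1 i2, e2, e3] at key
    rw [e1]
    have : s⁻¹ * ∫ p in L, vert p.1 ^ a * ψ p
        = s⁻¹ * ((∫ p in L, vert p.1 ^ a * ψ p) - s * ∫ X in ballPart n R', vert X ^ a * ψ (X, c))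
          + ∫ X in ballPart n R', vert X ^ a * ψ (X, c) := by
      field_simp
      ring
    rw [this, add_sub_cancel_right, norm_mul, norm_inv, Real.norm_of_nonneg hs.le,
      inv_mul_le_iff₀ hs]
    linarith
  have hd := D.ae_hasLineDerivAt (v := (0, 1)) a hdiff h0
  obtain ⟨hi, hint⟩ := integral_lineDeriv_eq_neg D.measΩ hshift hfint hgint hdom hd hlim
  have hsub : K' ⊆ Ω := D.subK'.trans D.subK
  have ev : vertST n (0, 1) = 0 := by simp [vert]
  simp only [ev, mul_zero, zero_div, zero_mul, add_zero, vertST_apply] at hi hint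
  rw [setIntegral_indicator D.measK', inter_eq_right.2 hsub] at hint
  refine ⟨?_, hint⟩
  have := hi.mono_set hsub
  rwa [IntegrableOn, integrable_indicator_iff D.measK', IntegrableOn,
    Measure.restrict_restrict D.measK', inter_self] at this

end Carleman

/-! ### The functions θ and σ, and the quotient η = σ/σ'. -/

namespace Carleman

theorem theta_nonneg {s : ℝ} (h0 : 0 < s) (h1 : s ≤ 1) : 0 ≤ theta s := by
  have : 0 ≤ Real.log (1 / s) := Real.log_nonneg (by rw [le_div_iff₀ h0]; linarith)
  exact mul_nonneg (Real.rpow_nonneg h0.le _) (Real.rpow_nonneg this _)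

/-- From log(1/s) ≤ 6 s^{-1/6}, raised to the power 3/2. The point is that θ(λt)/t is then bounded
by a function with the explicit primitive 4·6^{3/2}(λt)^{1/4}. -/
theorem theta_le {s : ℝ} (h0 : 0 < s) (h1 : s ≤ 1) :
    theta s ≤ 6 ^ (3 / 2 : ℝ) * s ^ (1 / 4 : ℝ) := by
  have hl : 0 ≤ Real.log (1 / s) := Real.log_nonneg (by rw [le_div_iff₀ h0]; linarith)
  have hle : Real.log (1 / s) ≤ 6 * (s ^ (-(1 / 6) : ℝ)) := by
    have := Real.log_le_rpow_div (x := 1 / s) (by positivity) (show (0 : ℝ) < 1 / 6 by norm_num)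
    rw [one_div s, Real.inv_rpow h0.le, ← Real.rpow_neg h0.le] at this
    rw [one_div s]
    linarith
  have h2 := Real.rpow_le_rpow hl hle (show (0 : ℝ) ≤ 3 / 2 by norm_num)
  rw [Real.mul_rpow (by norm_num) (Real.rpow_nonneg h0.le _), ← Real.rpow_mul h0.le] at h2
  calc theta s ≤ s ^ (1 / 2 : ℝ) * (6 ^ (3 / 2 : ℝ) * s ^ (-(1 / 6) * (3 / 2) : ℝ)) :=
        mul_le_mul_of_nonneg_left h2 (Real.rpow_nonneg h0.le _)
    _ = 6 ^ (3 / 2 : ℝ) * (s ^ (1 / 2 : ℝ) * s ^ (-(1 / 6) * (3 / 2) : ℝ)) := by ring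
    _ = _ := by rw [← Real.rpow_add h0]; norm_num

/-- Because e < 3. This is where the time interval [0, 1/(3λ)) is used. -/
theorem one_le_log_inv {s : ℝ} (h0 : 0 < s) (h1 : s ≤ 1 / 3) : 1 ≤ Real.log (1 / s) := by
  rw [Real.le_log_iff_exp_le (by positivity), le_div_iff₀ h0]
  have := Real.exp_one_lt_d9
  nlinarith

theorem le_theta {s : ℝ} (h0 : 0 < s) (h1 : s ≤ 1 / 3) : s ≤ theta s := by
  have h2 : (1 : ℝ) ≤ Real.log (1 / s) ^ (3 / 2 : ℝ) :=
    Real.one_le_rpow (one_le_log_inv h0 h1) (by norm_num)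
  have h3 : s ≤ s ^ (1 / 2 : ℝ) := by
    have := Real.rpow_le_rpow_of_exponent_ge h0 (by linarith) (show (1 / 2 : ℝ) ≤ 1 by norm_num)
    rwa [Real.rpow_one] at this
  calc s ≤ s ^ (1 / 2 : ℝ) * 1 := by linarith
    _ ≤ _ := mul_le_mul_of_nonneg_left h2 (Real.rpow_nonneg h0.le _)

theorem theta_sq {s : ℝ} (h0 : 0 < s) (h1 : s ≤ 1) : theta s ^ 2 = s * Real.log (1 / s) ^ 3 := by
  have hl : 0 ≤ Real.log (1 / s) := Real.log_nonneg (by rw [le_div_iff₀ h0]; linarith)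
  rw [theta, mul_pow, ← Real.rpow_natCast, ← Real.rpow_mul h0.le, ← Real.rpow_natCast (_ ^ _),
    ← Real.rpow_mul hl, ← Real.rpow_natCast _ 3]
  norm_num

/-- The derivative of `theta`. -/
noncomputable def theta' (s : ℝ) : ℝ :=
  1 / 2 * s ^ (1 / 2 - 1 : ℝ) * Real.log (1 / s) ^ (3 / 2 : ℝ)
    + s ^ (1 / 2 : ℝ) * (-s⁻¹ * (3 / 2) * Real.log (1 / s) ^ (3 / 2 - 1 : ℝ))

theorem hasDerivAt_theta {s : ℝ} (h0 : 0 < s) (h1 : s < 1) : HasDerivAt theta (theta' s) s := by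
  have hl : 0 < Real.log (1 / s) := Real.log_pos (by rw [lt_div_iff₀ h0]; linarith)
  have e : (fun s : ℝ => Real.log (1 / s)) = fun s => -Real.log s := by
    funext x; rw [one_div, Real.log_inv]
  have d1 : HasDerivAt (fun s : ℝ => Real.log (1 / s)) (-s⁻¹) s := by
    rw [e]; exact (Real.hasDerivAt_log h0.ne').neg
  exact (Real.hasDerivAt_rpow_const (Or.inl h0.ne')).mul (d1.rpow_const (Or.inl hl.ne'))

theorem theta'_le {s : ℝ} (h0 : 0 < s) (h1 : s < 1) : theta' s ≤ theta s / s := by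
  have hl : 0 < Real.log (1 / s) := Real.log_pos (by rw [lt_div_iff₀ h0]; linarith)
  have h2 : 0 ≤ Real.log (1 / s) ^ (3 / 2 : ℝ) := Real.rpow_nonneg hl.le _
  have h3 : 0 ≤ Real.log (1 / s) ^ (3 / 2 - 1 : ℝ) := Real.rpow_nonneg hl.le _
  have h4 : 0 ≤ s ^ (1 / 2 : ℝ) := Real.rpow_nonneg h0.le _
  rw [theta', theta, Real.rpow_sub_one h0.ne', le_div_iff₀ h0]
  field_simp
  have := mul_nonneg h4 h3
  have := mul_nonneg h4 h2
  nlinarith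

theorem continuousOn_theta' : ContinuousOn theta' (Ioo 0 1) := by
  have hs : ∀ s ∈ Ioo (0 : ℝ) 1, s ≠ 0 := fun s hs => hs.1.ne'
  have hl : ∀ s ∈ Ioo (0 : ℝ) 1, Real.log (1 / s) ≠ 0 := fun s hs =>
    (Real.log_pos (by rw [lt_div_iff₀ hs.1]; linarith [hs.2])).ne'
  have c1 : ContinuousOn (fun s : ℝ => Real.log (1 / s)) (Ioo 0 1) :=
    (continuousOn_const.div continuousOn_id hs).log fun s h => (one_div_pos.2 h.1).ne'
  unfold theta'
  refine ContinuousOn.add (ContinuousOn.mul (continuousOn_const.mul ?_) ?_) (ContinuousOn.mul ?_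
    (ContinuousOn.mul (ContinuousOn.mul ?_ continuousOn_const) ?_))
  · exact continuousOn_id.rpow_const fun s h => Or.inl (hs s h)
  · exact c1.rpow_const fun s h => Or.inl (hl s h)
  · exact continuousOn_id.rpow_const fun s h => Or.inl (hs s h)
  · exact (continuousOn_id.inv₀ hs).neg
  · exact c1.rpow_const fun s h => Or.inl (hl s h)

theorem nonpos_of_deriv_nonpos {b : ℝ} {f f' : ℝ → ℝ} (hf : ∀ t ∈ Ioo 0 b, HasDerivAt f (f' t) t)
    (hf' : ∀ t ∈ Ioo 0 b, f' t ≤ 0) (h0 : Tendsto f (𝓝[>] 0) (𝓝 0)) :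
    ∀ t ∈ Ioo 0 b, f t ≤ 0 := by
  have hanti : AntitoneOn f (Ioo 0 b) := by
    refine antitoneOn_of_deriv_nonpos (convex_Ioo 0 b)
      (fun t ht => (hf t ht).continuousAt.continuousWithinAt) (fun t ht => ?_) fun t ht => ?_
    · rw [interior_Ioo] at ht
      exact (hf t ht).differentiableAt.differentiableWithinAt
    · rw [interior_Ioo] at ht
      rw [(hf t ht).deriv]
      exact hf' t ht
  intro t ht
  refine ge_of_tendsto h0 ?_
  filter_upwards [Ioo_mem_nhdsGT ht.1] with s hs
  exact hanti ⟨hs.1, hs.2.trans ht.2⟩ ht hs.2.le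

section weight
variable {lam : ℝ} {σ : ℝ → ℝ}

/-- The function `log (σ / (t σ'))`. -/
noncomputable def ell (σ : ℝ → ℝ) (t : ℝ) : ℝ := Real.log (σ t / (t * deriv σ t))

/-- The function `σ / σ'`. -/
noncomputable def eta (σ : ℝ → ℝ) (t : ℝ) : ℝ := t * Real.exp (ell σ t)

theorem eta_eq (hσ : IsCarlemanWeight lam σ) {t : ℝ} (ht : t ∈ Ioo 0 (1 / lam)) :
    eta σ t = σ t / deriv σ t := by
  have h1 := hσ.pos t ht
  have h2 := hσ.deriv_pos t ht
  have h3 := ht.1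
  rw [eta, ell, Real.exp_log (by positivity)]
  field_simp

theorem eta_pos {t : ℝ} (ht : 0 < t) : 0 < eta σ t := mul_pos ht (Real.exp_pos _)

theorem hasDerivAt_ell (hσ : IsCarlemanWeight lam σ) {t : ℝ} (ht : t ∈ Ioo 0 (1 / lam)) :
    HasDerivAt (ell σ) (theta (lam * t) / t) t := hσ.ode t ht

theorem hasDerivAt_eta (hσ : IsCarlemanWeight lam σ) {t : ℝ} (ht : t ∈ Ioo 0 (1 / lam)) :
    HasDerivAt (eta σ) (eta σ t / t * (1 + theta (lam * t))) t := by
  have := (hasDerivAt_id t).fun_mul (hasDerivAt_ell hσ ht).exp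
  refine this.congr_deriv ?_
  have := ht.1
  simp only [eta, id]
  field_simp

theorem hasDerivAt_sigma_rpow (hσ : IsCarlemanWeight lam σ) (α : ℝ) {t : ℝ}
    (ht : t ∈ Ioo 0 (1 / lam)) :
    HasDerivAt (fun t => σ t ^ (-2 * α)) (-2 * α * σ t ^ (-2 * α) / eta σ t) t := by
  have h1 := hσ.pos t ht
  have h2 := hσ.deriv_pos t ht
  have := (hσ.differentiable t ht).hasDerivAt.rpow_const (p := -2 * α) (Or.inl h1.ne')
  convert this using 1
  rw [eta_eq hσ ht, Real.rpow_sub_one h1.ne']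
  field_simp

theorem lam_mul_mem (hlam : 0 < lam) {t : ℝ} (ht : t ∈ Ioo 0 (1 / lam)) : lam * t ∈ Ioo 0 1 := by
  refine ⟨mul_pos hlam ht.1, ?_⟩
  have := (lt_div_iff₀ hlam).1 ht.2
  linarith

theorem hasDerivAt_quarter (hlam : 0 < lam) {t : ℝ} (ht : 0 < t) :
    HasDerivAt (fun t => 4 * (lam * t) ^ (1 / 4 : ℝ)) ((lam * t) ^ (1 / 4 : ℝ) / t) t := by
  have h1 : HasDerivAt (fun t => lam * t) lam t := by simpa using (hasDerivAt_id t).const_mul lam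
  have := (h1.rpow_const (p := 1 / 4) (Or.inl (by positivity))).const_mul 4
  refine this.congr_deriv ?_
  rw [Real.rpow_sub_one (by positivity)]
  field_simp

theorem tendsto_quarter (C : ℝ) :
    Tendsto (fun t => C * (4 * (lam * t) ^ (1 / 4 : ℝ))) (𝓝[>] 0) (𝓝 0) := by
  have : ContinuousAt (fun t : ℝ => C * (4 * (lam * t) ^ (1 / 4 : ℝ))) 0 := by
    refine continuousAt_const.mul (continuousAt_const.mul ?_)
    exact (continuousAt_const.mul continuousAt_id).rpow_const (Or.inr (by norm_num))
  have h := this.tendsto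
  simp only [mul_zero] at h
  rw [Real.zero_rpow (by norm_num), mul_zero, mul_zero] at h
  exact h.mono_left nhdsWithin_le_nhds

theorem tendsto_sigma_div (hσ : IsCarlemanWeight lam σ) :
    Tendsto (fun t => σ t / t) (𝓝[>] 0) (𝓝 1) := by
  have := (hasDerivWithinAt_iff_tendsto_slope' (by simp)).1 (hσ.deriv_zero.Ioi_of_Ici)
  refine this.congr fun t => ?_
  simp [slope_def_field, hσ.zero]

/-- The function is increasing since θ ≥ 0, and subtracting the explicit primitive makes it
decreasing, so it is bounded below and has a limit L at 0. Then σ' = (σ/t)e^{-ell} tends to e^{-L}.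
A limit of the derivative is the one-sided derivative, which is 1, so L = 0. -/
theorem tendsto_ell (hlam : 0 < lam) (hσ : IsCarlemanWeight lam σ) :
    Tendsto (ell σ) (𝓝[>] 0) (𝓝 0) := by
  set b := 1 / lam with hb
  have hb0 : 0 < b := by positivity
  have hmono : MonotoneOn (ell σ) (Ioo 0 b) := by
    refine monotoneOn_of_deriv_nonneg (convex_Ioo 0 b)
      (fun t ht => (hasDerivAt_ell hσ ht).continuousAt.continuousWithinAt) (fun t ht => ?_)
      fun t ht => ?_
    · rw [interior_Ioo] at ht
      exact (hasDerivAt_ell hσ ht).differentiableAt.differentiableWithinAt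
    · rw [interior_Ioo] at ht
      rw [(hasDerivAt_ell hσ ht).deriv]
      have h1 := lam_mul_mem hlam ht
      exact div_nonneg (theta_nonneg h1.1 h1.2.le) ht.1.le
  set C : ℝ := 6 ^ (3 / 2 : ℝ) with hC
  have hanti : AntitoneOn (fun t => ell σ t - C * (4 * (lam * t) ^ (1 / 4 : ℝ))) (Ioo 0 b) := by
    have hd : ∀ t ∈ Ioo 0 b, HasDerivAt (fun t => ell σ t - C * (4 * (lam * t) ^ (1 / 4 : ℝ)))
        (theta (lam * t) / t - C * ((lam * t) ^ (1 / 4 : ℝ) / t)) t := fun t ht =>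
      (hasDerivAt_ell hσ ht).sub ((hasDerivAt_quarter hlam ht.1).const_mul C)
    refine antitoneOn_of_deriv_nonpos (convex_Ioo 0 b)
      (fun t ht => (hd t ht).continuousAt.continuousWithinAt) (fun t ht => ?_) fun t ht => ?_
    · rw [interior_Ioo] at ht
      exact (hd t ht).differentiableAt.differentiableWithinAt
    · rw [interior_Ioo] at ht
      rw [(hd t ht).deriv, ← mul_div_assoc, ← sub_div]
      have h1 := lam_mul_mem hlam ht
      exact div_nonpos_of_nonpos_of_nonneg (by linarith [theta_le h1.1 h1.2.le]) ht.1.le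
  have hbdd : BddBelow (ell σ '' Ioo 0 b) := by
    have hm : b / 2 ∈ Ioo 0 b := ⟨by positivity, by linarith⟩
    refine ⟨ell σ (b / 2) - C * (4 * (lam * (b / 2)) ^ (1 / 4 : ℝ)), ?_⟩
    rintro _ ⟨t, ht, rfl⟩
    have q1 : 0 ≤ C * (4 * (lam * (b / 2)) ^ (1 / 4 : ℝ)) := by positivity
    have q2 : 0 ≤ C * (4 * (lam * t) ^ (1 / 4 : ℝ)) := by
      have := ht.1; positivity
    rcases le_total t (b / 2) with h | h
    · have := hanti ht hm h
      simp only at this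
      linarith
    · have := hmono hm ht h
      linarith
  have hlim := hmono.tendsto_nhdsWithin_Ioo_right ⟨b / 2, by positivity, by linarith⟩ hbdd
  set L := sInf (ell σ '' Ioo 0 b) with hL
  have hderiv : Tendsto (fun t => deriv σ t) (𝓝[>] 0) (𝓝 (Real.exp (-L))) := by
    have h1 := (tendsto_sigma_div hσ).mul (Real.continuous_exp.tendsto _ |>.comp hlim.neg)
    rw [one_mul] at h1
    refine h1.congr' ?_
    filter_upwards [Ioo_mem_nhdsGT hb0] with t ht
    have e := eta_eq hσ ht
    have h2 := hσ.pos t ht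
    have h3 := hσ.deriv_pos t ht
    have h4 := ht.1
    simp only [Function.comp, Real.exp_neg]
    rw [eta, eq_div_iff h3.ne'] at e
    have := Real.exp_pos (ell σ t)
    field_simp
    linarith
  have hd := hasDerivWithinAt_Ici_of_tendsto_deriv (s := Ioo 0 b) (a := 0)
    (fun t ht => (hσ.differentiable t ht).differentiableWithinAt)
    (hσ.deriv_zero.continuousWithinAt.mono fun t ht => ht.1.le) (Ioo_mem_nhdsGT hb0) hderiv
  have := (uniqueDiffWithinAt_Ici (0 : ℝ)).eq_deriv _ hd hσ.deriv_zero
  have hL0 : L = 0 := by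
    rw [Real.exp_eq_one_iff] at this
    linarith
  rwa [hL0] at hlim

theorem ell_bounds (hlam : 0 < lam) (hσ : IsCarlemanWeight lam σ) {t : ℝ}
    (ht : t ∈ Ioo 0 (1 / lam)) :
    0 ≤ ell σ t ∧ ell σ t ≤ 6 ^ (3 / 2 : ℝ) * (4 * (lam * t) ^ (1 / 4 : ℝ)) := by
  have hl := tendsto_ell hlam hσ
  constructor
  · have := nonpos_of_deriv_nonpos (f := fun t => -ell σ t)
      (fun t ht => (hasDerivAt_ell hσ ht).neg) (fun t ht => by
        have h1 := lam_mul_mem hlam ht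
        exact neg_nonpos.2 (div_nonneg (theta_nonneg h1.1 h1.2.le) ht.1.le))
      (by simpa using hl.neg) t ht
    linarith
  · have := nonpos_of_deriv_nonpos
      (f := fun t => ell σ t - 6 ^ (3 / 2 : ℝ) * (4 * (lam * t) ^ (1 / 4 : ℝ)))
      (fun t ht => (hasDerivAt_ell hσ ht).sub ((hasDerivAt_quarter hlam ht.1).const_mul _))
      (fun t ht => by
        have h1 := lam_mul_mem hlam ht
        rw [← mul_div_assoc, ← sub_div]
        exact div_nonpos_of_nonpos_of_nonneg (by linarith [theta_le h1.1 h1.2.le]) ht.1.le)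
      (by simpa using hl.sub (tendsto_quarter _)) t ht
    linarith

/-- The derivative of log(σ/t) is (e^{-ell} - 1)/t, which lies between -ell/t and 0. Integrating the
bound for `ell` a second time gives the constant 16 = 4·4. -/
theorem sigma_bounds (hlam : 0 < lam) (hσ : IsCarlemanWeight lam σ) {t : ℝ}
    (ht : t ∈ Ioo 0 (1 / lam)) :
    Real.exp (-(16 * 6 ^ (3 / 2 : ℝ))) * t ≤ σ t ∧ σ t ≤ t := by
  have hlog : Tendsto (fun t => Real.log (σ t / t)) (𝓝[>] 0) (𝓝 0) := by
    have := (Real.continuousAt_log one_ne_zero).tendsto.comp (tendsto_sigma_div hσ)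
    simpa [Function.comp_def] using this
  have hd : ∀ t ∈ Ioo 0 (1 / lam), HasDerivAt (fun t => Real.log (σ t / t))
      ((Real.exp (-ell σ t) - 1) / t) t := by
    intro t ht
    have h1 := hσ.pos t ht
    have h2 := hσ.deriv_pos t ht
    have h3 := ht.1
    have := ((hσ.differentiable t ht).hasDerivAt.fun_div (hasDerivAt_id t) h3.ne').log
      (div_pos h1 h3).ne'
    refine this.congr_deriv ?_
    have e := eta_eq hσ ht
    rw [eta, eq_div_iff h2.ne'] at e
    have := Real.exp_pos (ell σ t)
    rw [Real.exp_neg]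
    simp only [id]
    rw [← e]
    field_simp
  have up := nonpos_of_deriv_nonpos hd (fun t ht => by
    refine div_nonpos_of_nonpos_of_nonneg ?_ ht.1.le
    have := Real.exp_le_one_iff.2 (neg_nonpos.2 (ell_bounds hlam hσ ht).1)
    linarith) hlog t ht
  have lo := nonpos_of_deriv_nonpos
    (f := fun t => -Real.log (σ t / t) - (4 * 6 ^ (3 / 2 : ℝ)) * (4 * (lam * t) ^ (1 / 4 : ℝ)))
    (fun t ht => (hd t ht).neg.sub ((hasDerivAt_quarter hlam ht.1).const_mul _)) (fun t ht => by
      rw [← neg_div, ← mul_div_assoc, ← sub_div]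
      refine div_nonpos_of_nonpos_of_nonneg ?_ ht.1.le
      have h1 := (ell_bounds hlam hσ ht).2
      have h2 := Real.add_one_le_exp (-ell σ t)
      linarith) (by simpa using hlog.neg.sub (tendsto_quarter _)) t ht
  have h0 := ht.1
  have hp : 0 < σ t / t := div_pos (hσ.pos t ht) h0
  have hq : (lam * t) ^ (1 / 4 : ℝ) ≤ 1 :=
    Real.rpow_le_one (by positivity) (lam_mul_mem hlam ht).2.le (by norm_num)
  constructor
  · have : -(16 * 6 ^ (3 / 2 : ℝ)) ≤ Real.log (σ t / t) := by
      have : (4 * 6 ^ (3 / 2 : ℝ)) * (4 * (lam * t) ^ (1 / 4 : ℝ)) ≤ 16 * 6 ^ (3 / 2 : ℝ) := by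
        have : (0 : ℝ) < 6 ^ (3 / 2 : ℝ) := by positivity
        nlinarith
      linarith
    rw [Real.le_log_iff_exp_le hp, le_div_iff₀ h0] at this
    exact this
  · have := (Real.log_nonpos_iff hp.le).1 up
    rwa [div_le_one h0] at this

theorem eta_bounds (hlam : 0 < lam) (hσ : IsCarlemanWeight lam σ) {t : ℝ}
    (ht : t ∈ Ioo 0 (1 / lam)) :
    t ≤ eta σ t ∧ eta σ t ≤ Real.exp (4 * 6 ^ (3 / 2 : ℝ)) * t := by
  have h := ell_bounds hlam hσ ht
  have hq : (lam * t) ^ (1 / 4 : ℝ) ≤ 1 :=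
    Real.rpow_le_one (mul_pos hlam ht.1).le (lam_mul_mem hlam ht).2.le (by norm_num)
  have hC : (0 : ℝ) < 6 ^ (3 / 2 : ℝ) := by positivity
  have h0 := ht.1
  constructor
  · have := Real.one_le_exp h.1
    rw [eta]; nlinarith
  · rw [eta, mul_comm]
    refine mul_le_mul_of_nonneg_right (Real.exp_le_exp.2 (h.2.trans ?_)) h0.le
    nlinarith

end weight
end Carleman

/-! ### Test functions and their derivatives up to the boundary. -/

namespace Carleman

variable {n : ℕ} {T : ℝ} {w : Space n × ℝ → ℝ}

theorem convex_closedQuarter : Convex ℝ (closedQuarter n) := by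
  have h1 : Convex ℝ {X : Space n | 0 ≤ vert X} :=
    convex_halfSpace_ge (vertL n).toLinearMap.isLinear 0
  exact h1.prod (convex_Ici (0 : ℝ))

theorem isClosed_closedQuarter : IsClosed (closedQuarter n) :=
  (isClosed_le continuous_const ((vertL n).continuous.comp continuous_fst)).inter
    (isClosed_le continuous_const continuous_snd)

theorem closedQuarter_mem_nhds {p : Space n × ℝ} (h1 : 0 < vert p.1) (h2 : 0 < p.2) :
    closedQuarter n ∈ 𝓝 p := by
  have o : IsOpen {q : Space n × ℝ | 0 < vert q.1 ∧ 0 < q.2} :=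
    (isOpen_lt continuous_const ((vertL n).continuous.comp continuous_fst)).inter
      (isOpen_lt continuous_const continuous_snd)
  exact mem_of_superset (o.mem_nhds ⟨h1, h2⟩) fun q hq => ⟨hq.1.le, hq.2.le⟩

theorem uniqueDiffOn_closedQuarter : UniqueDiffOn ℝ (closedQuarter n) := by
  refine uniqueDiffOn_convex convex_closedQuarter ⟨(dir (Fin.last n), 1), ?_⟩
  rw [mem_interior_iff_mem_nhds]
  exact closedQuarter_mem_nhds (by simp [vert_dir]) one_pos

/-- The derivative in direction `v` of a function on the closed quarter space, up to the boundary. -/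
noncomputable def dW (w : Space n × ℝ → ℝ) (v : Space n × ℝ) (p : Space n × ℝ) : ℝ :=
  fderivWithin ℝ w (closedQuarter n) p v

theorem IsTestFunction.fderivWithin_eq_zero {S : Set (Space n × ℝ)} (hS : IsClosed S)
    (h : ∀ p ∈ closedQuarter n, p ∉ S → w p = 0) {p : Space n × ℝ} (hp : p ∈ closedQuarter n)
    (hpS : p ∉ S) : fderivWithin ℝ w (closedQuarter n) p = 0 := by
  have : w =ᶠ[𝓝[closedQuarter n] p] fun _ => 0 := by
    filter_upwards [self_mem_nhdsWithin, mem_nhdsWithin_of_mem_nhds (hS.isOpen_compl.mem_nhds hpS)]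
      with q h1 h2 using h q h1 h2
  rw [this.fderivWithin_eq (h p hp hpS)]
  simp

theorem IsTestFunction.dW (hw : IsTestFunction n T w) (v : Space n × ℝ) :
    IsTestFunction n T (dW w v) where
  smooth := (hw.smooth.fderivWithin uniqueDiffOn_closedQuarter (m := ∞) (by simp)).clm_apply
    contDiffOn_const
  compactSupport := by
    obtain ⟨S, hS, hsub, h0⟩ := hw.compactSupport
    refine ⟨S, hS, hsub, fun p hp hpS => ?_⟩
    rw [Carleman.dW, IsTestFunction.fderivWithin_eq_zero hS.isClosed h0 hp hpS]
    simp

theorem IsTestFunction.support (hw : IsTestFunction n T w) {p : Space n × ℝ}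
    (hp : p ∈ closedQuarter n) (h : w p ≠ 0) : ‖p.1‖ ≤ 4 ∧ p.2 < T := by
  obtain ⟨S, hS, hsub, h0⟩ := hw.compactSupport
  have hpS : p ∈ S := by
    by_contra hc
    exact h (h0 p hp hc)
  refine ⟨?_, (hsub hpS).2.2⟩
  have : closure (halfBall n 4) ⊆ Metric.closedBall 0 4 :=
    closure_minimal (inter_subset_left.trans Metric.ball_subset_closedBall) Metric.isClosed_closedBall
  simpa using this (hsub hpS).1

theorem IsTestFunction.eq_zero (hw : IsTestFunction n T w) {c : ℝ} (hc : 0 < c) :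
    ∀ p ∈ halfSpace n ×ˢ Ici c, p ∉ ballPart n 4 ×ˢ Icc c T → w p = 0 := by
  intro p hp hp'
  by_contra h
  have hp1 : 0 < vert p.1 := hp.1
  have hp2 : c ≤ p.2 := hp.2
  have := hw.support (p := p) ⟨hp1.le, hc.le.trans hp2⟩ h
  exact hp' ⟨⟨hp1, this.1⟩, hp2, this.2.le⟩

theorem IsTestFunction.contDiffAt (hw : IsTestFunction n T w) {p : Space n × ℝ}
    (h1 : 0 < vert p.1) (h2 : 0 < p.2) : ContDiffAt ℝ ∞ w p :=
  hw.smooth.contDiffAt (closedQuarter_mem_nhds h1 h2)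

theorem IsTestFunction.differentiableAt (hw : IsTestFunction n T w) {p : Space n × ℝ}
    (h1 : 0 < vert p.1) (h2 : 0 < p.2) : DifferentiableAt ℝ w p :=
  (hw.contDiffAt h1 h2).differentiableAt (by simp)

theorem dW_eq_fderiv {p : Space n × ℝ} (h1 : 0 < vert p.1) (h2 : 0 < p.2) (v : Space n × ℝ) :
    dW w v p = fderiv ℝ w p v := by
  rw [dW, fderivWithin_of_mem_nhds (closedQuarter_mem_nhds h1 h2)]

/-- The derivative within the convex closed quarter is continuous and vanishes off a compact set. -/
theorem IsTestFunction.bddLip (hw : IsTestFunction n T w) : BddLip (closedQuarter n) w := by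
  obtain ⟨S, hS, hsub, h0⟩ := hw.compactSupport
  have hc : IsCompact (S ∩ closedQuarter n) := hS.inter_right isClosed_closedQuarter
  obtain ⟨C', hC'⟩ := hc.exists_bound_of_continuousOn (hw.smooth.continuousOn.mono inter_subset_right)
  have hd : ContinuousOn (fderivWithin ℝ w (closedQuarter n)) (closedQuarter n) :=
    hw.smooth.continuousOn_fderivWithin uniqueDiffOn_closedQuarter (by simp)
  obtain ⟨C, hC⟩ := hc.exists_bound_of_continuousOn (hd.mono inter_subset_right)
  refine BddLip.of_hasFDerivWithinAt (C := |C|) (C' := |C'|) convex_closedQuarter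
    (fun p hp => (hw.smooth.differentiableOn (by simp) p hp).hasFDerivWithinAt)
    (fun p hp => ?_) fun p hp => ?_
  · by_cases hpS : p ∈ S
    · exact (hC' p ⟨hpS, hp⟩).trans (le_abs_self _)
    · rw [h0 p hp hpS]; simp
  · by_cases hpS : p ∈ S
    · exact (hC p ⟨hpS, hp⟩).trans (le_abs_self _)
    · rw [IsTestFunction.fderivWithin_eq_zero hS.isClosed h0 hp hpS]; simp

theorem IsTestFunction.fderiv_dW_comm (hw : IsTestFunction n T w) {p : Space n × ℝ}
    (h1 : 0 < vert p.1) (h2 : 0 < p.2) (u v : Space n × ℝ) :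
    fderiv ℝ (Carleman.dW w v) p u = fderiv ℝ (Carleman.dW w u) p v := by
  have o : IsOpen {q : Space n × ℝ | 0 < vert q.1 ∧ 0 < q.2} :=
    (isOpen_lt continuous_const ((vertL n).continuous.comp continuous_fst)).inter
      (isOpen_lt continuous_const continuous_snd)
  have key : ∀ u v : Space n × ℝ, fderiv ℝ (Carleman.dW w v) p u = fderiv ℝ (fderiv ℝ w) p u v := by
    intro u v
    have : Carleman.dW w v =ᶠ[𝓝 p] fun q => fderiv ℝ w q v := by
      filter_upwards [o.mem_nhds ⟨h1, h2⟩] with q hq using dW_eq_fderiv hq.1 hq.2 v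
    rw [this.fderiv_eq]
    have hd : DifferentiableAt ℝ (fderiv ℝ w) p :=
      ((hw.contDiffAt h1 h2).fderiv_right (m := 1) (by norm_cast)).differentiableAt (by simp)
    rw [fderiv_clm_apply hd (differentiableAt_const v)]
    simp
  rw [key, key]
  exact ((hw.contDiffAt h1 h2).isSymmSndFDerivAt (by simp; norm_cast)) u v

theorem fderiv_slice_space {f : Space n × ℝ → ℝ} {X : Space n} {t : ℝ}
    (hf : DifferentiableAt ℝ f (X, t)) (i : Fin (n + 1)) :
    pderiv i (fun Y => f (Y, t)) X = fderiv ℝ f (X, t) (dir i, 0) := by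
  have h2 : HasFDerivAt (fun Y : Space n => (Y, t)) (ContinuousLinearMap.inl ℝ (Space n) ℝ) X :=
    hasFDerivAt_prodMk_left X t
  have h3 : HasFDerivAt (fun Y => f (Y, t)) _ X :=
    HasFDerivAt.comp (g := f) X hf.hasFDerivAt h2
  rw [pderiv, h3.fderiv]
  simp [dir]

theorem deriv_slice_time {f : Space n × ℝ → ℝ} {X : Space n} {t : ℝ}
    (hf : DifferentiableAt ℝ f (X, t)) :
    deriv (fun s => f (X, s)) t = fderiv ℝ f (X, t) (0, 1) := by
  have h2 : HasFDerivAt (fun s : ℝ => (X, s)) (ContinuousLinearMap.inr ℝ (Space n) ℝ) t :=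
    hasFDerivAt_prodMk_right X t
  have h3 : HasFDerivAt (fun s => f (X, s)) _ t :=
    HasFDerivAt.comp (g := f) t hf.hasFDerivAt h2
  rw [← fderiv_apply_one_eq_deriv, h3.fderiv]
  simp

theorem IsTestFunction.gradSq_eq (hw : IsTestFunction n T w) {X : Space n} {t : ℝ}
    (h1 : 0 < vert X) (h2 : 0 < t) :
    gradSq w X t = ∑ i, Carleman.dW w (dir i, 0) (X, t) ^ 2 := by
  unfold gradSq
  refine Finset.sum_congr rfl fun i _ => ?_
  rw [fderiv_slice_space (hw.differentiableAt h1 h2), dW_eq_fderiv h1 h2]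

/-- The exponent with which `x_{n+1}^a ∂_{n+1} w` vanishes at `x_{n+1} = 0`. -/
noncomputable def vanishExp (a : ℝ) : ℝ := if 0 < a then a else 1 + a

theorem vanishExp_pos {a : ℝ} (ha : -1 < a) : 0 < vanishExp a := by
  unfold vanishExp; split_ifs <;> linarith

/-- For a > 0 the exponent on the right is 0 and boundedness suffices: the weight itself vanishes.
For a ≤ 0 the Neumann condition forces ∂_{n+1}w = 0 on x_{n+1} = 0, and the Lipschitz bound gives
linear decay. -/
theorem IsTestFunction.vert_deriv_bound (hw : IsTestFunction n T w) {a : ℝ}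
    (hN : HasZeroWeightedNeumann a w) :
    ∃ C, 0 ≤ C ∧ ∀ p : Space n × ℝ, 0 < vert p.1 → 0 < p.2 →
      |Carleman.dW w (dir (Fin.last n), 0) p| ≤ C * vert p.1 ^ (vanishExp a - a) := by
  obtain ⟨C, hC, hb, hL⟩ := (hw.dW (dir (Fin.last n), 0)).bddLip
  refine ⟨C, hC, fun p hp1 hp2 => ?_⟩
  have hpQ : p ∈ closedQuarter n := ⟨hp1.le, hp2.le⟩
  unfold vanishExp
  split_ifs with ha
  · simpa using hb p hpQ
  · push Not at ha
    set g := Carleman.dW w (dir (Fin.last n), 0) with hg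
    set x : EuclideanSpace ℝ (Fin n) := horiz p.1 with hx
    have hmk : ∀ z, mkPoint x z = mkPoint x 0 + z • dir (Fin.last n) := by
      intro z
      ext i
      refine Fin.lastCases ?_ (fun j => ?_) i
      · simp [mkPoint, dir]
      · simp [mkPoint, dir, (Fin.castSucc_lt_last j).ne]
    have hv : ∀ z, vert (mkPoint x z) = z := by intro z; simp [vert, mkPoint]
    have hp : mkPoint x (vert p.1) = p.1 := by
      ext i
      refine Fin.lastCases ?_ (fun j => ?_) i
      · simp [mkPoint, vert]
      · simp only [mkPoint, Fin.snoc_castSucc]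
        rfl
    have hcont : Tendsto (fun z : ℝ => g (mkPoint x z, p.2)) (𝓝[>] 0) (𝓝 (g (mkPoint x 0, p.2))) := by
      have h1 : ContinuousWithinAt g (closedQuarter n) (mkPoint x 0, p.2) :=
        (hw.dW (dir (Fin.last n), 0)).smooth.continuousOn _ ⟨by simp [hv], hp2.le⟩
      refine h1.tendsto.comp (tendsto_nhdsWithin_iff.2 ⟨?_, ?_⟩)
      · have : Continuous fun z : ℝ => (mkPoint x z, p.2) := by
          rw [show (fun z : ℝ => (mkPoint x z, p.2))
            = fun z => (mkPoint x 0 + z • dir (Fin.last n), p.2) from funext fun z => by rw [hmk z]]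
          fun_prop
        exact this.continuousAt.mono_left nhdsWithin_le_nhds
      · filter_upwards [self_mem_nhdsWithin] with z hz
        exact ⟨by simpa [hv] using (mem_Ioi.1 hz).le, hp2.le⟩
    -- As a ≤ 0, the weight z^a is at least 1 for z < 1, so the weighted limit controls the
    -- unweighted one.
    have hzero : Tendsto (fun z : ℝ => g (mkPoint x z, p.2)) (𝓝[>] 0) (𝓝 0) := by
      have h1 := (hN x p.2 hp2.le).abs
      rw [abs_zero] at h1
      refine squeeze_zero_norm' ?_ h1
      filter_upwards [Ioo_mem_nhdsGT one_pos] with z hz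
      have h2 : (1 : ℝ) ≤ z ^ a := Real.one_le_rpow_of_pos_of_le_one_of_nonpos hz.1 hz.2.le ha
      have h3 : 0 < vert (mkPoint x z) := by rw [hv]; exact hz.1
      rw [abs_mul, abs_of_nonneg (zero_le_one.trans h2),
        fderiv_slice_space (hw.differentiableAt (p := (mkPoint x z, p.2)) h3 hp2), hg, dW_eq_fderiv (p := (mkPoint x z, p.2)) h3 hp2, Real.norm_eq_abs]
      exact le_mul_of_one_le_left (abs_nonneg _) h2
    have h0 : g (mkPoint x 0, p.2) = 0 := tendsto_nhds_unique hcont hzero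
    have hl := hL p hpQ (mkPoint x 0, p.2) ⟨by simp [hv], hp2.le⟩
    rw [h0, sub_zero] at hl
    refine hl.trans (mul_le_mul_of_nonneg_left (le_of_eq ?_) hC)
    have e1 : p - (mkPoint x 0, p.2) = (vert p.1 • dir (Fin.last n), 0) := by
      ext1
      · have h5 := hmk (vert p.1)
        rw [hp] at h5
        simp only [Prod.fst_sub]
        exact sub_eq_of_eq_add' h5
      · simp
    rw [e1, show 1 + a - a = (1 : ℝ) by ring, Real.rpow_one]
    simp [Prod.norm_def, norm_smul, norm_dir, hp1.le, abs_of_pos hp1]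

end Carleman

/-! ### Divergence theorem on the box; the Gaussian and the coefficients as functions on space-time.
-/

namespace Carleman

variable {n : ℕ}

/-- The space-time box on which functions are controlled; test functions live in the box with
`R = 4`. -/
abbrev box (n : ℕ) (R c T : ℝ) : Set (Space n × ℝ) := ballPart n R ×ˢ Icc c T

/-- Lipschitz on the larger box and almost everywhere differentiable on the smaller one. -/
abbrev GoodST (n : ℕ) (c T T₂ : ℝ) (f : Space n × ℝ → ℝ) : Prop :=
  Good volume (box n 5 c T₂) (box n 4 c T) f

variable {c T T₂ : ℝ}

theorem measurableSet_box {R : ℝ} : MeasurableSet (box n R c T) :=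
  (measurableSet_ballPart R).prod measurableSet_Icc

/-- The space directions contribute no boundary term and the time direction contributes the slice at
t = c. The term with a/x_{n+1} is the logarithmic derivative of the weight, which only the vertical
component sees. -/
theorem integral_divergence (hc : c < T) (hT : T < T₂) {a : ℝ} (ha : a ∈ Ioo (-1 : ℝ) 1)
    {ψ : Fin (n + 1) → Space n × ℝ → ℝ} {φ : Space n × ℝ → ℝ}
    (hψ : ∀ i, GoodST n c T T₂ (ψ i)) (hφ : GoodST n c T T₂ φ)
    (hψ0 : ∀ i, ∀ p ∈ halfSpace n ×ˢ Ici c, p ∉ box n 4 c T → ψ i p = 0)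
    (hφ0 : ∀ p ∈ halfSpace n ×ˢ Ici c, p ∉ box n 4 c T → φ p = 0)
    (hvert : ∃ C, ∀ p ∈ box n 4 c T,
      |ψ (Fin.last n) p| ≤ C * vert p.1 ^ (vanishExp a - a)) :
    IntegrableOn (fun p : Space n × ℝ => vert p.1 ^ a * (∑ i, fderiv ℝ (ψ i) p (dir i, 0)
      + a / vert p.1 * ψ (Fin.last n) p + fderiv ℝ φ p (0, 1))) (box n 4 c T) ∧
    ∫ p in box n 4 c T, vert p.1 ^ a * (∑ i, fderiv ℝ (ψ i) p (dir i, 0)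
      + a / vert p.1 * ψ (Fin.last n) p + fderiv ℝ φ p (0, 1))
      = -∫ X in ballPart n 4, vert X ^ a * φ (X, c) := by
  have D := halfDomain_spaceTime (n := n) (R := 5) (R' := 4) (c := c) (by norm_num) le_rfl hT.le
  have hs : ∀ i, _ := fun i => D.integral_space
    (direction_spaceTime (n := n) (R := 5) (R' := 4) (c := c) (by norm_num) hT.le i)
    ha.1 ha.2 (vanishExp_pos ha.1) (hψ i) (hψ0 i) (by
      by_cases hi : i = Fin.last n
      · subst hi; exact Or.inr hvert
      · left; simp [vert_dir, hi])
  obtain ⟨ht1, ht2⟩ := integral_time (n := n) (R := 5) (R' := 4) (by norm_num) le_rfl hc hT ha.1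
    hφ hφ0
  have hsum : ∀ p : Space n × ℝ, vert p.1 ^ a * (∑ i, fderiv ℝ (ψ i) p (dir i, 0)
      + a / vert p.1 * ψ (Fin.last n) p + fderiv ℝ φ p (0, 1))
      = ∑ i, vertST n p ^ a * (fderiv ℝ (ψ i) p (dir i, 0)
        + a * vertST n (dir i, 0) / vertST n p * ψ i p) + vert p.1 ^ a * fderiv ℝ φ p (0, 1) := by
    intro p
    simp only [vertST_apply, vert_dir]
    rw [← Finset.mul_sum, Finset.sum_add_distrib, ← mul_add]
    congr 3
    simp [ite_div, ite_mul, Finset.sum_ite_eq']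
  simp_rw [hsum]
  have hI : IntegrableOn (fun p : Space n × ℝ => ∑ i, vertST n p ^ a * (fderiv ℝ (ψ i) p (dir i, 0)
        + a * vertST n (dir i, 0) / vertST n p * ψ i p)) (box n 4 c T) :=
    integrable_finsetSum _ fun i _ => (hs i).1
  refine ⟨hI.add ht1, ?_⟩
  rw [integral_add hI ht1, integral_finsetSum _ fun i _ => (hs i).1, ht2]
  rw [Finset.sum_eq_zero fun i _ => (hs i).2, zero_add]

theorem GoodST.of_contDiffAt {f : Space n × ℝ → ℝ}
    (hT : T ≤ T₂) (hf : ∀ p : Space n × ℝ, c ≤ p.2 → p.2 ≤ T₂ → ContDiffAt ℝ 1 f p) :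
    GoodST n c T T₂ f := by
  have hcc : IsCompact (Metric.closedBall (0 : Space n) 5 ×ˢ Icc c T₂) :=
    (isCompact_closedBall 0 5).prod isCompact_Icc
  have hcv : Convex ℝ (Metric.closedBall (0 : Space n) 5 ×ˢ Icc c T₂) :=
    (convex_closedBall 0 5).prod (convex_Icc c T₂)
  refine ⟨(BddLip.of_contDiffAt hcc hcv fun p hp => hf p hp.2.1 hp.2.2).mono
    fun p hp => ⟨by simpa using hp.1.2, hp.2⟩, ?_⟩
  rw [ae_restrict_iff' measurableSet_box]
  exact Eventually.of_forall fun p hp =>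
    (hf p hp.2.1 (hp.2.2.trans hT)).differentiableAt one_ne_zero

theorem GoodST.time {f f' : ℝ → ℝ} (hT : T ≤ T₂) (hf : ∀ t ∈ Icc c T₂, HasDerivAt f (f' t) t)
    (hf' : ContinuousOn f' (Icc c T₂)) : GoodST n c T T₂ fun p => f p.2 := by
  refine ⟨(BddLip.of_hasDerivAt hf hf').comp (φ := Prod.snd) (fun p hp => hp.2) fun p q => ?_, ?_⟩
  · exact norm_snd_le (p - q)
  · rw [ae_restrict_iff' measurableSet_box]
    exact Eventually.of_forall fun p hp =>
      ((hf p.2 ⟨hp.2.1, hp.2.2.trans hT⟩).differentiableAt).fun_comp' p differentiableAt_snd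

theorem IsTestFunction.good {w : Space n × ℝ → ℝ} {T₁ : ℝ} (hw : IsTestFunction n T₁ w)
    (hc : 0 < c) : GoodST n c T T₂ w := by
  refine ⟨hw.bddLip.mono fun p hp => ⟨hp.1.1.le, hc.le.trans hp.2.1⟩, ?_⟩
  rw [ae_restrict_iff' measurableSet_box]
  exact Eventually.of_forall fun p hp => hw.differentiableAt hp.1.1 (hc.trans_le hp.2.1)

theorem GoodST.coord (hT : T ≤ T₂) (i : Fin (n + 1)) : GoodST n c T T₂ fun p => p.1 i :=
  GoodST.of_contDiffAt hT fun _ _ _ => by fun_prop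

theorem GoodST.inv_time (hT : T ≤ T₂) (hc : 0 < c) : GoodST n c T T₂ fun p => p.2⁻¹ :=
  GoodST.of_contDiffAt hT fun _ hp _ => contDiffAt_snd.inv (hc.trans_le hp).ne'

theorem contDiffAt_gaussian (a : ℝ) {p : Space n × ℝ} (hp : 0 < p.2) :
    ContDiffAt ℝ 1 (fun p : Space n × ℝ => gaussian a p.1 p.2) p := by
  unfold gaussian
  have h1 : ContDiffAt ℝ 1 (fun p : Space n × ℝ => p.2 ^ (((n : ℝ) + 1 + a) / 2)) p :=
    contDiffAt_snd.rpow_const_of_ne hp.ne'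
  have h2 : ContDiffAt ℝ 1 (fun p : Space n × ℝ => ‖p.1‖ ^ 2) p := contDiffAt_fst.norm_sq ℝ
  have h3 : ContDiffAt ℝ 1 (fun p : Space n × ℝ => 4 * p.2) p := by fun_prop
  exact (contDiffAt_const.div h1 (Real.rpow_pos_of_pos hp _).ne').mul
    ((h2.neg.div h3 (by positivity)).exp)

theorem GoodST.gaussian (a : ℝ) (hT : T ≤ T₂) (hc : 0 < c) :
    GoodST n c T T₂ fun p => gaussian a p.1 p.2 :=
  GoodST.of_contDiffAt hT fun _ hp _ => contDiffAt_gaussian a (hc.trans_le hp)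

theorem norm_sq_add_smul_dir (X : Space n) (s : ℝ) (i : Fin (n + 1)) :
    ‖X + s • dir i‖ ^ 2 = ‖X‖ ^ 2 + 2 * s * X i + s ^ 2 := by
  rw [norm_add_sq_real, inner_smul_right, norm_smul, norm_dir]
  have : inner ℝ X (dir i) = X i := by
    rw [dir, EuclideanSpace.inner_single_right]; simp
  rw [this]
  simp
  ring

theorem fderiv_gaussian_space (a : ℝ) {p : Space n × ℝ} (hp : 0 < p.2) (i : Fin (n + 1)) :
    fderiv ℝ (fun p : Space n × ℝ => gaussian a p.1 p.2) p (dir i, 0)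
      = -(p.1 i / (2 * p.2)) * gaussian a p.1 p.2 := by
  have h1 := ((contDiffAt_gaussian a hp).differentiableAt one_ne_zero).hasFDerivAt.hasLineDerivAt
    (dir i, 0)
  refine h1.unique ?_
  have h2 : HasDerivAt (fun s : ℝ => 1 / p.2 ^ (((n : ℝ) + 1 + a) / 2)
      * Real.exp (-(‖p.1‖ ^ 2 + 2 * s * p.1 i + s ^ 2) / (4 * p.2)))
      (1 / p.2 ^ (((n : ℝ) + 1 + a) / 2) * (Real.exp (-(‖p.1‖ ^ 2 + 2 * 0 * p.1 i + 0 ^ 2) / (4 * p.2))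
        * (-(0 + 2 * 1 * p.1 i + 2 * 0) / (4 * p.2)))) 0 := by
    refine HasDerivAt.const_mul _ (HasDerivAt.exp (HasDerivAt.div_const (HasDerivAt.fun_neg
      (HasDerivAt.fun_add (HasDerivAt.fun_add (hasDerivAt_const _ _) ?_) ?_)) _))
    · exact ((hasDerivAt_id (0 : ℝ)).const_mul 2).mul_const _
    · simpa using hasDerivAt_pow 2 (0 : ℝ)
  unfold HasLineDerivAt
  simp only [gaussian, Prod.fst_add, Prod.smul_fst, Prod.snd_add, Prod.smul_snd, smul_zero,
    add_zero, norm_sq_add_smul_dir]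
  refine h2.congr_deriv ?_
  simp only [mul_zero, zero_mul, add_zero, zero_add, ne_eq, OfNat.ofNat_ne_zero, not_false_eq_true,
    zero_pow]
  field_simp
  ring

theorem fderiv_gaussian_time (a : ℝ) {p : Space n × ℝ} (hp : 0 < p.2) :
    fderiv ℝ (fun p : Space n × ℝ => gaussian a p.1 p.2) p (0, 1)
      = (‖p.1‖ ^ 2 / (4 * p.2 ^ 2) - ((n : ℝ) + 1 + a) / 2 / p.2) * gaussian a p.1 p.2 := by
  have h0 := deriv_slice_time (f := fun p : Space n × ℝ => gaussian a p.1 p.2) (X := p.1) (t := p.2)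
    ((contDiffAt_gaussian a hp).differentiableAt one_ne_zero)
  rw [Prod.mk.eta] at h0
  rw [← h0]
  set m := ((n : ℝ) + 1 + a) / 2 with hm
  have e : (fun s => gaussian a p.1 s) =ᶠ[𝓝 p.2] fun s => s ^ (-m) * Real.exp (-‖p.1‖ ^ 2 / 4 * s⁻¹) := by
    filter_upwards [lt_mem_nhds hp] with s hs
    rw [gaussian, Real.rpow_neg hs.le, one_div]
    congr 2
    field_simp
  have h1 : HasDerivAt (fun s : ℝ => s ^ (-m) * Real.exp (-‖p.1‖ ^ 2 / 4 * s⁻¹)) _ p.2 :=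
    (Real.hasDerivAt_rpow_const (p := -m) (Or.inl hp.ne')).mul
      (((hasDerivAt_inv hp.ne').const_mul (-‖p.1‖ ^ 2 / 4)).exp)
  have e2 := e.self_of_nhds
  simp only at e2
  rw [e.deriv_eq, h1.deriv, e2, Real.rpow_sub_one hp.ne']
  field_simp
  ring

section coeff
variable {Λ K : ℝ} {A : EuclideanSpace ℝ (Fin n) → ℝ → Matrix (Fin (n + 1)) (Fin (n + 1)) ℝ}

/-- The coefficients as functions on space-time. -/
def coef (A : EuclideanSpace ℝ (Fin n) → ℝ → Matrix (Fin (n + 1)) (Fin (n + 1)) ℝ)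
    (i j : Fin (n + 1)) (p : Space n × ℝ) : ℝ := A (horiz p.1) p.2 i j

theorem norm_horiz_le (X : Space n) : ‖horiz X‖ ≤ ‖X‖ := by
  rw [EuclideanSpace.norm_eq, EuclideanSpace.norm_eq]
  refine Real.sqrt_le_sqrt ?_
  rw [Fin.sum_univ_castSucc]
  have : 0 ≤ ‖X (Fin.last n)‖ ^ 2 := by positivity
  simpa [horiz] using this

theorem horiz_sub (X Y : Space n) : horiz X - horiz Y = horiz (X - Y) := by
  ext i; simp [horiz]

theorem abs_entry_le_sqrt (M : Matrix (Fin (n + 1)) (Fin (n + 1)) ℝ) (i j : Fin (n + 1)) :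
    |M i j| ≤ Real.sqrt (∑ i, ∑ j, M i j ^ 2) := by
  rw [← Real.sqrt_sq_eq_abs]
  refine Real.sqrt_le_sqrt ?_
  calc M i j ^ 2 ≤ ∑ j, M i j ^ 2 :=
        Finset.single_le_sum (f := fun j => M i j ^ 2) (fun _ _ => sq_nonneg _) (Finset.mem_univ j)
    _ ≤ _ := Finset.single_le_sum (f := fun i => ∑ j, M i j ^ 2)
        (fun _ _ => Finset.sum_nonneg fun _ _ => sq_nonneg _) (Finset.mem_univ i)

theorem IsAdmissible.abs_coef_sub_le (hA : IsAdmissible n Λ K A) (i j : Fin (n + 1))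
    (p q : Space n × ℝ) :
    |coef A i j p - coef A i j q| ≤ K * (‖p.1 - q.1‖ + |p.2 - q.2|) := by
  have h1 := hA.lipschitz (horiz p.1) p.2 (horiz q.1) q.2
  have h2 := abs_entry_le_sqrt (A (horiz p.1) p.2 - A (horiz q.1) q.2) i j
  simp only [Matrix.sub_apply] at h2
  have h3 := (norm_horiz_le (p.1 - q.1))
  rw [← horiz_sub] at h3
  refine (h2.trans h1).trans ?_
  have hK : 0 ≤ K := by
    have := hA.lipschitz 0 1 0 0
    simp only [sub_self, norm_zero, sub_zero, abs_one, zero_add, mul_one] at this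
    exact (Real.sqrt_nonneg _).trans this
  gcongr

/-- The factor 2 comes from comparing the sum of the two norms with the maximum norm on the product.
-/
theorem IsAdmissible.lipschitzWith_coef (hA : IsAdmissible n Λ K A) (hK : 0 ≤ K)
    (i j : Fin (n + 1)) : LipschitzWith (2 * K).toNNReal (coef A i j) := by
  refine LipschitzWith.of_dist_le_mul fun p q => ?_
  rw [Real.dist_eq, dist_eq_norm, Real.coe_toNNReal _ (by positivity)]
  have h1 := hA.abs_coef_sub_le i j p q
  have h2 : ‖p.1 - q.1‖ ≤ ‖p - q‖ := norm_fst_le (p - q)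
  have h3 : |p.2 - q.2| ≤ ‖p - q‖ := norm_snd_le (p - q)
  have := mul_le_mul_of_nonneg_left (add_le_add h2 h3) hK
  linarith

theorem IsAdmissible.ae_differentiableAt (hA : IsAdmissible n Λ K A) (hK : 0 ≤ K) :
    ∀ᵐ p : Space n × ℝ, ∀ i j, DifferentiableAt ℝ (coef A i j) p :=
  ae_all_iff.2 fun i => ae_all_iff.2 fun j => (hA.lipschitzWith_coef hK i j).ae_differentiableAt

theorem IsAdmissible.abs_fderiv_coef_le (hA : IsAdmissible n Λ K A) (hK : 0 ≤ K)
    (i j : Fin (n + 1)) (p v : Space n × ℝ) : |fderiv ℝ (coef A i j) p v| ≤ 2 * K * ‖v‖ := by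
  have h := norm_fderiv_le_of_lipschitz ℝ (hA.lipschitzWith_coef hK i j) (x₀ := p)
  rw [Real.coe_toNNReal _ (by positivity)] at h
  exact (ContinuousLinearMap.le_opNorm _ v).trans (mul_le_mul_of_nonneg_right h (norm_nonneg v))

theorem IsAdmissible.abs_coef_sub_one_le (hA : IsAdmissible n Λ K A) (i j : Fin (n + 1))
    {p : Space n × ℝ} (hp : 0 ≤ p.2) :
    |coef A i j p - (1 : Matrix (Fin (n + 1)) (Fin (n + 1)) ℝ) i j| ≤ K * (‖p.1‖ + p.2) := by
  have h := hA.abs_coef_sub_le i j p 0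
  have e : coef A i j 0 = (1 : Matrix (Fin (n + 1)) (Fin (n + 1)) ℝ) i j := by
    have : horiz (0 : Space n) = 0 := by ext; simp [horiz]
    simp [coef, this, hA.normalized]
  rw [e] at h
  simpa [abs_of_nonneg hp] using h

theorem IsAdmissible.coef_symm (hA : IsAdmissible n Λ K A) (i j : Fin (n + 1))
    (p : Space n × ℝ) : coef A i j p = coef A j i p :=
  (hA.symm (horiz p.1) p.2).apply j i

theorem IsAdmissible.good (hA : IsAdmissible n Λ K A) (hK : 0 ≤ K) (hc : 0 < c)
    (i j : Fin (n + 1)) : GoodST n c T T₂ (coef A i j) := by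
  refine ⟨⟨2 * K + (1 + K * (5 + |T₂|)), by positivity, fun p hp => ?_, fun p hp q hq => ?_⟩, ?_⟩
  · have h := hA.abs_coef_sub_one_le i j (p := p) (hc.le.trans hp.2.1)
    have h1 : |(1 : Matrix (Fin (n + 1)) (Fin (n + 1)) ℝ) i j| ≤ 1 := by
      rw [Matrix.one_apply]; split_ifs <;> simp
    have h2 : K * (‖p.1‖ + p.2) ≤ K * (5 + |T₂|) :=
      mul_le_mul_of_nonneg_left (add_le_add hp.1.2 (hp.2.2.trans (le_abs_self _))) hK
    have h3 := abs_sub_abs_le_abs_sub (coef A i j p) ((1 : Matrix (Fin (n + 1)) (Fin (n + 1)) ℝ) i j)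
    linarith
  · have := (hA.lipschitzWith_coef hK i j).dist_le_mul p q
    rw [Real.dist_eq, dist_eq_norm, Real.coe_toNNReal _ (by positivity)] at this
    refine this.trans (mul_le_mul_of_nonneg_right ?_ (norm_nonneg _))
    have : 0 ≤ 1 + K * (5 + |T₂|) := by positivity
    linarith
  · exact ae_restrict_of_ae ((hA.lipschitzWith_coef hK i j).ae_differentiableAt)

end coeff
end Carleman

/-! ### Transport along the drift and the weighted divergence of Gaussian fields. -/

namespace Carleman

section rules
variable {E : Type*} [NormedAddCommGroup E] [NormedSpace ℝ E] {f g : E → ℝ} {p : E}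

theorem fd_add (hf : DifferentiableAt ℝ f p) (hg : DifferentiableAt ℝ g p) (v : E) :
    fderiv ℝ (fun q => f q + g q) p v = fderiv ℝ f p v + fderiv ℝ g p v := by
  rw [fderiv_fun_add hf hg]; rfl

theorem fd_sub (hf : DifferentiableAt ℝ f p) (hg : DifferentiableAt ℝ g p) (v : E) :
    fderiv ℝ (fun q => f q - g q) p v = fderiv ℝ f p v - fderiv ℝ g p v := by
  rw [fderiv_fun_sub hf hg]; rfl

theorem fd_mul (hf : DifferentiableAt ℝ f p) (hg : DifferentiableAt ℝ g p) (v : E) :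
    fderiv ℝ (fun q => f q * g q) p v = f p * fderiv ℝ g p v + g p * fderiv ℝ f p v := by
  rw [fderiv_fun_mul hf hg]; rfl

theorem fd_const_mul (c : ℝ) (hf : DifferentiableAt ℝ f p) (v : E) :
    fderiv ℝ (fun q => c * f q) p v = c * fderiv ℝ f p v := by
  rw [fderiv_const_mul hf]; rfl

theorem fd_sq (hf : DifferentiableAt ℝ f p) (v : E) :
    fderiv ℝ (fun q => f q ^ 2) p v = 2 * f p * fderiv ℝ f p v := by
  simp only [sq]; rw [fd_mul hf hf]; ring

theorem fd_sum {ι : Type*} [Fintype ι] {F : ι → E → ℝ} (h : ∀ i, DifferentiableAt ℝ (F i) p) (v : E) :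
    fderiv ℝ (fun q => ∑ i, F i q) p v = ∑ i, fderiv ℝ (F i) p v := by
  rw [fderiv_fun_sum fun i _ => h i, sum_apply]

end rules

variable {n : ℕ}

theorem fd_time {f : ℝ → ℝ} {f' : ℝ} {p : Space n × ℝ} (hf : HasDerivAt f f' p.2)
    (v : Space n × ℝ) : fderiv ℝ (fun q : Space n × ℝ => f q.2) p v = v.2 * f' := by
  have h2 : HasFDerivAt (fun q : Space n × ℝ => f q.2) _ p :=
    HasFDerivAt.comp (g := f) p hf.hasFDerivAt hasFDerivAt_snd
  rw [h2.fderiv]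
  simp

theorem diff_time {f : ℝ → ℝ} {f' : ℝ} {p : Space n × ℝ} (hf : HasDerivAt f f' p.2) :
    DifferentiableAt ℝ (fun q : Space n × ℝ => f q.2) p :=
  hf.differentiableAt.fun_comp' p differentiableAt_snd

theorem fd_coord (i : Fin (n + 1)) (p v : Space n × ℝ) :
    fderiv ℝ (fun q : Space n × ℝ => q.1 i) p v = v.1 i := by
  have : HasFDerivAt (fun q : Space n × ℝ => q.1 i)
      ((EuclideanSpace.proj i : Space n →L[ℝ] ℝ).comp (ContinuousLinearMap.fst ℝ (Space n) ℝ)) p :=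
    ((EuclideanSpace.proj i : Space n →L[ℝ] ℝ).comp
      (ContinuousLinearMap.fst ℝ (Space n) ℝ)).hasFDerivAt
  rw [this.fderiv]
  rfl

variable (A : EuclideanSpace ℝ (Fin n) → ℝ → Matrix (Fin (n + 1)) (Fin (n + 1)) ℝ)
  (w : Space n × ℝ → ℝ)

/-- The spatial derivative `∂_i w`. -/
noncomputable abbrev dX (i : Fin (n + 1)) : Space n × ℝ → ℝ := dW w (dir i, 0)

/-- The flux `(A ∇w)_k`. -/
noncomputable def flux (k : Fin (n + 1)) (p : Space n × ℝ) : ℝ := ∑ j, coef A k j p * dX w j p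

/-- The drift field `(A X)_k / (2t)`. -/
noncomputable def drift (k : Fin (n + 1)) (p : Space n × ℝ) : ℝ :=
  (∑ l, coef A k l p * p.1 l) * (2⁻¹ * p.2⁻¹)

/-- Differentiation along the drift: `∂_t + V · ∇`. -/
noncomputable def transport (f : Space n × ℝ → ℝ) (p : Space n × ℝ) : ℝ :=
  fderiv ℝ f p (0, 1) + ∑ k, drift A k p * fderiv ℝ f p (dir k, 0)

/-- The logarithmic defect of the Gaussian along the drift. -/
noncomputable def defect (a : ℝ) (p : Space n × ℝ) : ℝ :=
  ∑ k, fderiv ℝ (drift A k) p (dir k, 0) + a / (2 * p.2) - (∑ k, p.1 k * drift A k p) / (2 * p.2)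
    + ‖p.1‖ ^ 2 / (4 * p.2 ^ 2) - ((n : ℝ) + 1 + a) / 2 / p.2

/-- The backward operator divided by the weight `x_{n+1}^a`. -/
noncomputable def heatOp (a : ℝ) (p : Space n × ℝ) : ℝ :=
  dW w (0, 1) p + ∑ k, fderiv ℝ (flux A w k) p (dir k, 0) + a / vert p.1 * dX w (Fin.last n) p

/-- The Lipschitz part `-X · (A - I) X / (4t²)` of the defect. -/
noncomputable def mainDefect (p : Space n × ℝ) : ℝ :=
  (∑ k, p.1 k * (p.1 k - ∑ l, coef A k l p * p.1 l)) * (4⁻¹ * (p.2⁻¹ * p.2⁻¹))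

/-- The energy density `A ∇w · ∇w`. -/
noncomputable def energy (p : Space n × ℝ) : ℝ := ∑ k, flux A w k p * dX w k p

variable {A w} {p : Space n × ℝ}

theorem transport_mul {f g : Space n × ℝ → ℝ} (hf : DifferentiableAt ℝ f p)
    (hg : DifferentiableAt ℝ g p) :
    transport A (fun q => f q * g q) p = f p * transport A g p + g p * transport A f p := by
  simp only [transport, fd_mul hf hg, mul_add, Finset.mul_sum, Finset.sum_add_distrib]
  have e1 : ∀ k, drift A k p * (f p * fderiv ℝ g p (dir k, 0))
      = f p * (drift A k p * fderiv ℝ g p (dir k, 0)) := fun k => by ring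
  have e2 : ∀ k, drift A k p * (g p * fderiv ℝ f p (dir k, 0))
      = g p * (drift A k p * fderiv ℝ f p (dir k, 0)) := fun k => by ring
  simp only [e1, e2]
  ring

theorem transport_sub {f g : Space n × ℝ → ℝ} (hf : DifferentiableAt ℝ f p)
    (hg : DifferentiableAt ℝ g p) :
    transport A (fun q => f q - g q) p = transport A f p - transport A g p := by
  simp only [transport, fd_sub hf hg, mul_sub, Finset.sum_sub_distrib]
  ring

theorem transport_const_mul (c : ℝ) {f : Space n × ℝ → ℝ} (hf : DifferentiableAt ℝ f p) :
    transport A (fun q => c * f q) p = c * transport A f p := by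
  rw [transport_mul (differentiableAt_const c) hf]
  simp [transport]

theorem transport_sq {f : Space n × ℝ → ℝ} (hf : DifferentiableAt ℝ f p) :
    transport A (fun q => f q ^ 2) p = 2 * f p * transport A f p := by
  simp only [sq]
  rw [transport_mul hf hf]
  ring

theorem transport_time {f : ℝ → ℝ} {f' : ℝ} (hf : HasDerivAt f f' p.2) :
    transport A (fun q => f q.2) p = f' := by
  simp [transport, fd_time hf]

theorem transport_sum {ι : Type*} [Fintype ι] {F : ι → Space n × ℝ → ℝ}
    (h : ∀ i, DifferentiableAt ℝ (F i) p) :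
    transport A (fun q => ∑ i, F i q) p = ∑ i, transport A (F i) p := by
  simp only [transport, fd_sum h, Finset.mul_sum, Finset.sum_add_distrib]
  rw [Finset.sum_comm]

/-- The pointwise regularity at `p` that holds almost everywhere for Lipschitz coefficients and a
test function. -/
structure RegularAt (A : EuclideanSpace ℝ (Fin n) → ℝ → Matrix (Fin (n + 1)) (Fin (n + 1)) ℝ)
    (w : Space n × ℝ → ℝ) (p : Space n × ℝ) : Prop where
  time_pos : 0 < p.2
  vert_pos : 0 < vert p.1
  coef : ∀ i j, DifferentiableAt ℝ (coef A i j) p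
  symm : ∀ i j, Carleman.coef A i j p = Carleman.coef A j i p
  last : ∀ i, Carleman.coef A (Fin.last n) i p = if i = Fin.last n then 1 else 0
  diff : DifferentiableAt ℝ w p
  diffX : ∀ i, DifferentiableAt ℝ (dX w i) p
  diffT : DifferentiableAt ℝ (dW w (0, 1)) p
  eq_fderiv : ∀ v, fderiv ℝ w p v = dW w v p
  commX : ∀ i j, fderiv ℝ (dX w i) p (dir j, 0) = fderiv ℝ (dX w j) p (dir i, 0)
  commT : ∀ i, fderiv ℝ (dW w (0, 1)) p (dir i, 0) = fderiv ℝ (dX w i) p (0, 1)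

theorem differentiableAt_coord (i : Fin (n + 1)) :
    DifferentiableAt ℝ (fun q : Space n × ℝ => q.1 i) p := by fun_prop

namespace RegularAt
variable (h : RegularAt A w p)
include h

theorem flux (k : Fin (n + 1)) : DifferentiableAt ℝ (Carleman.flux A w k) p :=
  DifferentiableAt.fun_sum fun j _ => (h.coef k j).fun_mul (h.diffX j)

theorem inv_time : DifferentiableAt ℝ (fun q : Space n × ℝ => q.2⁻¹) p :=
  diff_time (hasDerivAt_inv h.time_pos.ne')

theorem drift (k : Fin (n + 1)) : DifferentiableAt ℝ (Carleman.drift A k) p :=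
  (DifferentiableAt.fun_sum fun l _ => (h.coef k l).fun_mul (differentiableAt_coord l)).fun_mul
    (h.inv_time.const_mul _)

theorem mainDefect : DifferentiableAt ℝ (Carleman.mainDefect A) p :=
  (DifferentiableAt.fun_sum fun k _ => (differentiableAt_coord k).fun_mul
    ((differentiableAt_coord k).fun_sub (DifferentiableAt.fun_sum fun l _ =>
      (h.coef k l).fun_mul (differentiableAt_coord l)))).fun_mul
    ((h.inv_time.fun_mul h.inv_time).const_mul _)

theorem energy : DifferentiableAt ℝ (Carleman.energy A w) p :=
  DifferentiableAt.fun_sum fun k _ => (h.flux k).fun_mul (h.diffX k)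

/-- By symmetry of A, the two terms in which Z falls on a gradient coincide, whence the factor 2. -/
theorem transport_energy : transport A (Carleman.energy A w) p
    = ∑ i, ∑ j, transport A (Carleman.coef A i j) p * dX w i p * dX w j p
      + 2 * ∑ i, Carleman.flux A w i p * transport A (dX w i) p := by
  have e1 : transport A (Carleman.energy A w) p
      = ∑ i, (Carleman.flux A w i p * transport A (dX w i) p
        + dX w i p * transport A (Carleman.flux A w i) p) := by
    unfold Carleman.energy
    rw [transport_sum fun i => (h.flux i).fun_mul (h.diffX i)]
    exact Finset.sum_congr rfl fun i _ => transport_mul (h.flux i) (h.diffX i)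
  have e2 : ∀ i, transport A (Carleman.flux A w i) p
      = ∑ j, (Carleman.coef A i j p * transport A (dX w j) p
        + dX w j p * transport A (Carleman.coef A i j) p) := by
    intro i
    unfold Carleman.flux
    rw [transport_sum fun j => (h.coef i j).fun_mul (h.diffX j)]
    exact Finset.sum_congr rfl fun j _ => transport_mul (h.coef i j) (h.diffX j)
  rw [e1, Finset.sum_add_distrib]
  simp only [e2, Finset.sum_add_distrib, mul_add, Finset.mul_sum]
  have e3 : ∑ i, ∑ j, dX w i p * (Carleman.coef A i j p * transport A (dX w j) p)
      = ∑ i, Carleman.flux A w i p * transport A (dX w i) p := by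
    rw [Finset.sum_comm]
    refine Finset.sum_congr rfl fun j _ => ?_
    rw [Carleman.flux, Finset.sum_mul]
    refine Finset.sum_congr rfl fun i _ => ?_
    rw [h.symm j i]
    ring
  have e4 : ∑ i, ∑ j, dX w i p * (dX w j p * transport A (Carleman.coef A i j) p)
      = ∑ i, ∑ j, transport A (Carleman.coef A i j) p * dX w i p * dX w j p :=
    Finset.sum_congr rfl fun i _ => Finset.sum_congr rfl fun j _ => by ring
  rw [e3, e4, ← Finset.mul_sum]
  ring

/-- X·A∇w = AX·∇w. This is the reason for the choice V = AX/(2t): differentiating G along the flux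
A∇w reproduces the drift derivative of w. -/
theorem sum_coord_flux : (∑ k, p.1 k * Carleman.flux A w k p) / (2 * p.2)
    = ∑ k, Carleman.drift A k p * dX w k p := by
  simp only [Carleman.flux, Carleman.drift, Finset.mul_sum, Finset.sum_mul, Finset.sum_div]
  rw [Finset.sum_comm]
  refine Finset.sum_congr rfl fun j _ => Finset.sum_congr rfl fun k _ => ?_
  rw [h.symm j k]
  have := h.time_pos.ne'
  field_simp

theorem drift_last : Carleman.drift A (Fin.last n) p = vert p.1 * (2⁻¹ * p.2⁻¹) := by
  simp [Carleman.drift, h.last, vert]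

theorem flux_last : Carleman.flux A w (Fin.last n) p = dX w (Fin.last n) p := by
  simp [Carleman.flux, h.last]

theorem transport_eq : transport A w p
    = dW w (0, 1) p + ∑ k, Carleman.drift A k p * dX w k p := by
  simp [transport, h.eq_fderiv, dX]

/-- The weighted divergence of the field with spatial part `G (B V + q A ∇w)` and time part
`G B`. -/
theorem divergence_eq {a : ℝ} {B q : Space n × ℝ → ℝ} (hB : DifferentiableAt ℝ B p)
    (hq : DifferentiableAt ℝ q p) :
    ∑ k, fderiv ℝ (fun x : Space n × ℝ => gaussian a x.1 x.2
        * (B x * Carleman.drift A k x + q x * Carleman.flux A w k x)) p (dir k, 0)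
      + a / vert p.1 * (gaussian a p.1 p.2 * (B p * Carleman.drift A (Fin.last n) p
        + q p * Carleman.flux A w (Fin.last n) p))
      + fderiv ℝ (fun x : Space n × ℝ => gaussian a x.1 x.2 * B x) p (0, 1)
    = gaussian a p.1 p.2 * (transport A B p + defect A a p * B p
      + ∑ k, fderiv ℝ q p (dir k, 0) * Carleman.flux A w k p
      + q p * (heatOp A w a p - transport A w p)) := by
  have ht := h.time_pos
  have hz := h.vert_pos
  have hG : DifferentiableAt ℝ (fun x : Space n × ℝ => gaussian a x.1 x.2) p :=
    (contDiffAt_gaussian a ht).differentiableAt one_ne_zero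
  have e1 : ∀ k, fderiv ℝ (fun x : Space n × ℝ => gaussian a x.1 x.2
        * (B x * Carleman.drift A k x + q x * Carleman.flux A w k x)) p (dir k, 0)
      = gaussian a p.1 p.2 * (B p * fderiv ℝ (Carleman.drift A k) p (dir k, 0)
          + Carleman.drift A k p * fderiv ℝ B p (dir k, 0)
          + q p * fderiv ℝ (Carleman.flux A w k) p (dir k, 0)
          + fderiv ℝ q p (dir k, 0) * Carleman.flux A w k p
          - B p * (p.1 k * Carleman.drift A k p) / (2 * p.2)
          - q p * (p.1 k * Carleman.flux A w k p) / (2 * p.2)) := by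
    intro k
    rw [fd_mul hG ((hB.fun_mul (h.drift k)).fun_add (hq.fun_mul (h.flux k))),
      fd_add (hB.fun_mul (h.drift k)) (hq.fun_mul (h.flux k)), fd_mul hB (h.drift k),
      fd_mul hq (h.flux k), fderiv_gaussian_space a ht]
    ring
  simp only [e1]
  rw [fd_mul hG hB, fderiv_gaussian_time a ht, ← Finset.mul_sum, h.drift_last, h.flux_last,
    h.transport_eq, heatOp, defect, ← h.sum_coord_flux, transport]
  simp only [Finset.sum_add_distrib, Finset.sum_sub_distrib, ← Finset.mul_sum, ← Finset.sum_div]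
  have := h.time_pos.ne'
  field_simp
  ring

theorem mainDefect_eq : Carleman.mainDefect A p
    = ‖p.1‖ ^ 2 / (4 * p.2 ^ 2) - (∑ k, p.1 k * Carleman.drift A k p) / (2 * p.2) := by
  rw [EuclideanSpace.norm_sq_eq]
  simp only [Carleman.mainDefect, Carleman.drift, mul_sub, Finset.sum_sub_distrib, Real.norm_eq_abs,
    sq_abs, ← mul_assoc, ← Finset.sum_mul]
  have := h.time_pos.ne'
  have e : ∑ k, p.1 k * p.1 k = ∑ k, p.1 k ^ 2 := Finset.sum_congr rfl fun k _ => by ring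
  rw [e]
  field_simp
  ring

end RegularAt
end Carleman

/-! ### The Carleman identity and the Caccioppoli identity. -/

namespace Carleman

variable {n : ℕ} (A : EuclideanSpace ℝ (Fin n) → ℝ → Matrix (Fin (n + 1)) (Fin (n + 1)) ℝ)
  (w : Space n × ℝ → ℝ) (α : ℝ) (ρ η θ : ℝ → ℝ)

/-- The antisymmetric part of the conjugated operator. -/
noncomputable def antiPart (p : Space n × ℝ) : ℝ :=
  dW w (0, 1) p + ∑ k, drift A k p * dX w k p + 2⁻¹ * (mainDefect A p * w p)
    - α * ((η p.2)⁻¹ * w p)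

/-- The quadratic form of the symmetric part of the conjugated operator. -/
noncomputable def symmForm (p : Space n × ℝ) : ℝ :=
  ρ p.2 * (α * w p ^ 2 - 2⁻¹ * (η p.2 * mainDefect A p * w p ^ 2) - η p.2 * energy A w p)

/-- The commutator term. -/
noncomputable def commutator (a : ℝ) (η' : ℝ) (p : Space n × ℝ) : ℝ :=
  α * (defect A a p - mainDefect A p) * w p ^ 2
    - 2⁻¹ * (η' * mainDefect A p + η p.2 * transport A (mainDefect A) p
      + η p.2 * mainDefect A p * (defect A a p - mainDefect A p)) * w p ^ 2
    - η' * energy A w p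
    - η p.2 * ∑ i, ∑ j, transport A (coef A i j) p * dX w i p * dX w j p
    - η p.2 * (defect A a p - mainDefect A p) * energy A w p
    + η p.2 * w p * ∑ k, flux A w k p * fderiv ℝ (mainDefect A) p (dir k, 0)
    + 2 * η p.2 * ∑ k, flux A w k p * ∑ l, fderiv ℝ (drift A l) p (dir k, 0) * dX w l p

variable {A w α ρ η θ} {p : Space n × ℝ} {ρ' η' θ' : ℝ}

namespace RegularAt
variable (h : RegularAt A w p)
include h

theorem antiPart (hη : HasDerivAt η η' p.2) (h0 : η p.2 ≠ 0) :
    DifferentiableAt ℝ (Carleman.antiPart A w α η) p := by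
  refine DifferentiableAt.fun_sub (DifferentiableAt.fun_add (DifferentiableAt.fun_add h.diffT ?_) ?_) ?_
  · exact DifferentiableAt.fun_sum fun k _ => (h.drift k).fun_mul (h.diffX k)
  · exact (h.mainDefect.fun_mul h.diff).const_mul _
  · exact ((diff_time (hη.fun_inv h0)).fun_mul h.diff).const_mul _

/-- Second derivatives of w commute, so ∂_k Zw = Z∂_k w + ∂_k V·∇w, and η does not depend on X. -/
theorem fderiv_antiPart (hη : HasDerivAt η η' p.2) (h0 : η p.2 ≠ 0) (k : Fin (n + 1)) :
    fderiv ℝ (Carleman.antiPart A w α η) p (dir k, 0)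
      = transport A (dX w k) p + ∑ l, fderiv ℝ (Carleman.drift A l) p (dir k, 0) * dX w l p
        + 2⁻¹ * (fderiv ℝ (Carleman.mainDefect A) p (dir k, 0) * w p
          + Carleman.mainDefect A p * dX w k p) - α * ((η p.2)⁻¹ * dX w k p) := by
  have d1 := DifferentiableAt.fun_sum (u := Finset.univ) fun l _ => (h.drift l).fun_mul (h.diffX l)
  have d2 := (h.mainDefect.fun_mul h.diff).const_mul (2⁻¹ : ℝ)
  have d3 := diff_time (p := p) (hη.fun_inv h0)
  unfold Carleman.antiPart
  rw [fd_sub ((h.diffT.fun_add d1).fun_add d2) ((d3.fun_mul h.diff).const_mul _),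
    fd_add (h.diffT.fun_add d1) d2, fd_add h.diffT d1,
    fd_sum fun l => (h.drift l).fun_mul (h.diffX l), fd_const_mul _ (h.mainDefect.fun_mul h.diff),
    fd_mul h.mainDefect h.diff, fd_const_mul _ (d3.fun_mul h.diff), fd_mul d3 h.diff,
    fd_time (hη.fun_inv h0), h.commT, h.eq_fderiv]
  simp only [fd_mul (h.drift _) (h.diffX _), Finset.sum_add_distrib, h.commX _ k, transport]
  have e : ∀ l, dX w l p * fderiv ℝ (Carleman.drift A l) p (dir k, 0)
      = fderiv ℝ (Carleman.drift A l) p (dir k, 0) * dX w l p := fun l => mul_comm _ _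
  simp only [e]
  simp only [dX]
  ring

/-- The left side is the form taken by the weighted divergence in `divergence_eq` for B = `symmForm`
and q = 2ηρY. Since ρ' = -2αρ/η, the terms in α²w² and those in α times the energy cancel, and the
terms αFw² and α·`defect`·w² combine into the small difference α(`defect` - F)w². -/
theorem carleman_identity {a : ℝ} (hρ : HasDerivAt ρ (-2 * α * ρ p.2 / η p.2) p.2)
    (hη : HasDerivAt η η' p.2) (h0 : η p.2 ≠ 0) :
    transport A (symmForm A w α ρ η) p + defect A a p * symmForm A w α ρ η p
      + ∑ k, fderiv ℝ (fun x => 2 * (η x.2 * ρ x.2 * Carleman.antiPart A w α η x)) p (dir k, 0)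
          * Carleman.flux A w k p
      + 2 * (η p.2 * ρ p.2 * Carleman.antiPart A w α η p) * (heatOp A w a p - transport A w p)
    = ρ p.2 * (2 * η p.2 * Carleman.antiPart A w α η p
        * (heatOp A w a p - Carleman.antiPart A w α η p) + commutator A w α η a η' p) := by
  have dρ := diff_time (p := p) hρ
  have dη := diff_time (p := p) hη
  have dY := h.antiPart (α := α) hη h0
  have dw2 : DifferentiableAt ℝ (fun q => w q ^ 2) p := h.diff.fun_pow 2
  have t1 : transport A (symmForm A w α ρ η) p
      = (-2 * α * ρ p.2 / η p.2) * (α * w p ^ 2 - 2⁻¹ * (η p.2 * Carleman.mainDefect A p * w p ^ 2)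
          - η p.2 * Carleman.energy A w p)
        + ρ p.2 * (α * (2 * w p * transport A w p)
          - 2⁻¹ * (η p.2 * Carleman.mainDefect A p * (2 * w p * transport A w p)
            + w p ^ 2 * (η p.2 * transport A (Carleman.mainDefect A) p
              + Carleman.mainDefect A p * η'))
          - (η p.2 * transport A (Carleman.energy A w) p + Carleman.energy A w p * η')) := by
    have f1 := dw2.const_mul α
    have f2 := ((dη.fun_mul h.mainDefect).fun_mul dw2).const_mul (2⁻¹ : ℝ)
    have f3 := dη.fun_mul h.energy
    unfold symmForm
    rw [transport_mul dρ ((f1.fun_sub f2).fun_sub f3), transport_time hρ,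
      transport_sub (f1.fun_sub f2) f3, transport_sub f1 f2, transport_const_mul _ dw2,
      transport_sq h.diff, transport_const_mul _ ((dη.fun_mul h.mainDefect).fun_mul dw2),
      transport_mul (dη.fun_mul h.mainDefect) dw2, transport_sq h.diff,
      transport_mul dη h.mainDefect, transport_time hη, transport_mul dη h.energy,
      transport_time hη]
    ring
  have t2 : ∀ k, fderiv ℝ (fun x : Space n × ℝ => 2 * (η x.2 * ρ x.2 * Carleman.antiPart A w α η x)) p (dir k, 0)
      = 2 * (η p.2 * ρ p.2 * fderiv ℝ (Carleman.antiPart A w α η) p (dir k, 0)) := by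
    intro k
    rw [fd_const_mul _ ((dη.fun_mul dρ).fun_mul dY), fd_mul (dη.fun_mul dρ) dY, fd_mul dη dρ,
      fd_time hη, fd_time hρ]
    simp
  -- The formula for ∂_k Y is solved for Z∂_k w. The part containing ∂_k Y then cancels against
  -- ∇q·A∇w, so no second derivative of w is left over except inside H and Y.
  have t3 : ∑ i, Carleman.flux A w i p * transport A (dX w i) p
      = ∑ k, fderiv ℝ (Carleman.antiPart A w α η) p (dir k, 0) * Carleman.flux A w k p
        - ∑ k, Carleman.flux A w k p * ∑ l, fderiv ℝ (Carleman.drift A l) p (dir k, 0) * dX w l p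
        - 2⁻¹ * w p * ∑ k, Carleman.flux A w k p * fderiv ℝ (Carleman.mainDefect A) p (dir k, 0)
        - 2⁻¹ * Carleman.mainDefect A p * Carleman.energy A w p
        + α * (η p.2)⁻¹ * Carleman.energy A w p := by
    simp only [h.fderiv_antiPart hη h0, Carleman.energy]
    rw [Finset.mul_sum, Finset.mul_sum, Finset.mul_sum, ← Finset.sum_sub_distrib,
      ← Finset.sum_sub_distrib, ← Finset.sum_sub_distrib, ← Finset.sum_add_distrib]
    exact Finset.sum_congr rfl fun k _ => by ring
  have t4 : transport A w p = Carleman.antiPart A w α η p - 2⁻¹ * (Carleman.mainDefect A p * w p)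
      + α * ((η p.2)⁻¹ * w p) := by
    rw [h.transport_eq, Carleman.antiPart]; ring
  simp only [t2]
  have t5 : ∑ k, 2 * (η p.2 * ρ p.2 * fderiv ℝ (Carleman.antiPart A w α η) p (dir k, 0))
        * Carleman.flux A w k p
      = 2 * (η p.2 * ρ p.2) * ∑ k, fderiv ℝ (Carleman.antiPart A w α η) p (dir k, 0)
        * Carleman.flux A w k p := by
    rw [Finset.mul_sum]
    exact Finset.sum_congr rfl fun k _ => by ring
  rw [t5, t1, h.transport_energy, t3, symmForm, commutator, t4]
  field_simp
  ring

/-- This is the equation tested with ρθw, that is `divergence_eq` with B = ρθw²/2 and q = ρθw.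
Differentiating ρ produces the useful term -αθw²/η. -/
theorem caccioppoli_identity {a : ℝ} (hρ : HasDerivAt ρ (-2 * α * ρ p.2 / η p.2) p.2)
    (hθ : HasDerivAt θ θ' p.2) :
    transport A (fun x => 2⁻¹ * (ρ x.2 * θ x.2 * w x ^ 2)) p
      + defect A a p * (2⁻¹ * (ρ p.2 * θ p.2 * w p ^ 2))
      + ∑ k, fderiv ℝ (fun x => ρ x.2 * θ x.2 * w x) p (dir k, 0) * Carleman.flux A w k p
      + ρ p.2 * θ p.2 * w p * (heatOp A w a p - transport A w p)
    = ρ p.2 * (2⁻¹ * θ' * w p ^ 2 - α * θ p.2 / η p.2 * w p ^ 2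
        + 2⁻¹ * defect A a p * θ p.2 * w p ^ 2 + θ p.2 * Carleman.energy A w p
        + θ p.2 * w p * heatOp A w a p) := by
  have dρ := diff_time (p := p) hρ
  have dθ := diff_time (p := p) hθ
  have dw2 : DifferentiableAt ℝ (fun q => w q ^ 2) p := h.diff.fun_pow 2
  have t1 : ∀ k, fderiv ℝ (fun x : Space n × ℝ => ρ x.2 * θ x.2 * w x) p (dir k, 0)
      = ρ p.2 * θ p.2 * dX w k p := by
    intro k
    rw [fd_mul (dρ.fun_mul dθ) h.diff, fd_mul dρ dθ, fd_time hρ, fd_time hθ, h.eq_fderiv]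
    simp
  have t2 : ∑ k, ρ p.2 * θ p.2 * dX w k p * Carleman.flux A w k p
      = ρ p.2 * θ p.2 * Carleman.energy A w p := by
    rw [Carleman.energy, Finset.mul_sum]
    exact Finset.sum_congr rfl fun k _ => by ring
  simp only [t1]
  rw [t2, transport_const_mul _ ((dρ.fun_mul dθ).fun_mul dw2), transport_mul (dρ.fun_mul dθ) dw2,
    transport_mul dρ dθ, transport_time hρ, transport_time hθ, transport_sq h.diff]
  field_simp
  ring

end RegularAt
end Carleman

/-! ### Euler identities, and integration of the transport fields. -/

namespace Carleman

section euler
variable {E : Type*} [NormedAddCommGroup E] [NormedSpace ℝ E] [FiniteDimensional ℝ E]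
  [MeasurableSpace E] [BorelSpace E] {μ : Measure E} [μ.IsAddHaarMeasure]

/-- The field is φX. Its normal component ζφ vanishes to first order at ζ = 0, so the exponent b = 1
+ a is available and φ need not satisfy a Neumann condition. -/
theorem HalfDomain.integral_euler {ζ : E →L[ℝ] ℝ} {Ω K K' : Set E}
    (D : HalfDomain μ ζ Ω K K') {ι : Type*} [Fintype ι] {v : ι → E} {x : ι → E →L[ℝ] ℝ}
    (hv : ∀ i, HalfDomain.Direction ζ Ω K K' (v i)) (hx : ∀ i, x i (v i) = 1)
    (hζ : ∀ p, ∑ i, x i p * ζ (v i) = ζ p) (hζ' : ∀ i, ζ (v i) = 0 ∨ x i = ζ)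
    (hxK : ∀ i, BddLip K (x i)) {a : ℝ} (ha : -1 < a) (ha1 : a < 1) {φ : E → ℝ}
    (hφ : Good μ K K' φ) (h0 : ∀ p ∈ Ω, p ∉ K' → φ p = 0) :
    IntegrableOn (fun p => ζ p ^ a * (∑ i, x i p * fderiv ℝ φ p (v i)
        + ((Fintype.card ι : ℝ) + a) * φ p)) K' μ ∧
      ∫ p in K', ζ p ^ a * (∑ i, x i p * fderiv ℝ φ p (v i)
        + ((Fintype.card ι : ℝ) + a) * φ p) ∂μ = 0 := by
  have hgx : ∀ i, Good μ K K' (x i) := fun i =>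
    ⟨hxK i, Eventually.of_forall fun _ => (x i).differentiableAt⟩
  have h : ∀ i, _ := fun i => D.integral_space (hv i) ha ha1 (b := 1 + a) (by linarith)
    ((hgx i).mul hφ) (fun p hp hp' => by rw [h0 p hp hp', mul_zero]) (by
      rcases hζ' i with h1 | h1
      · exact Or.inl h1
      · right
        obtain ⟨C, hC, hb, -⟩ := hφ.lip
        refine ⟨C, fun p hp => ?_⟩
        have hpK := D.subK' hp
        have hz := D.pos p (D.subK hpK)
        rw [show 1 + a - a = (1 : ℝ) by ring, Real.rpow_one, h1, abs_mul, abs_of_pos hz, mul_comm]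
        exact mul_le_mul_of_nonneg_right (hb p hpK) hz.le)
  have hcongr : ∀ᵐ p ∂μ.restrict K', ζ p ^ a * (∑ i, x i p * fderiv ℝ φ p (v i)
        + ((Fintype.card ι : ℝ) + a) * φ p)
      = ∑ i, ζ p ^ a * (fderiv ℝ (fun q => x i q * φ q) p (v i)
        + a * ζ (v i) / ζ p * (x i p * φ p)) := by
    filter_upwards [hφ.diff, ae_restrict_mem D.measK'] with p hp hpK
    have hz := D.pos p (D.subK (D.subK' hpK))
    have e1 : ∀ i, fderiv ℝ (fun q => x i q * φ q) p (v i)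
        = x i p * fderiv ℝ φ p (v i) + φ p := by
      intro i
      rw [fd_mul (x i).differentiableAt hp, ContinuousLinearMap.fderiv, hx, mul_one]
    have e2 : ∑ i, a * ζ (v i) / ζ p * (x i p * φ p) = a * φ p := by
      calc _ = a / ζ p * φ p * ∑ i, x i p * ζ (v i) := by
            rw [Finset.mul_sum]; exact Finset.sum_congr rfl fun i _ => by ring
        _ = _ := by rw [hζ]; field_simp
    simp only [e1]
    rw [← Finset.mul_sum, Finset.sum_add_distrib, Finset.sum_add_distrib, e2]
    simp
    ring_nf
    simp
  have hI : IntegrableOn (fun p => ∑ i, ζ p ^ a * (fderiv ℝ (fun q => x i q * φ q) p (v i)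
        + a * ζ (v i) / ζ p * (x i p * φ p))) K' μ := integrable_finsetSum _ fun i _ => (h i).1
  refine ⟨hI.congr (hcongr.mono fun p hp => hp.symm), ?_⟩
  rw [integral_congr_ae hcongr, integral_finsetSum _ fun i _ => (h i).1,
    Finset.sum_eq_zero fun i _ => (h i).2]

end euler

variable {n : ℕ} {c T T₂ : ℝ} {w : Space n × ℝ → ℝ} {Λ K : ℝ}
  {A : EuclideanSpace ℝ (Fin n) → ℝ → Matrix (Fin (n + 1)) (Fin (n + 1)) ℝ}

theorem sum_coord_vert (X : Space n) : ∑ i, X i * vert (dir (n := n) i) = vert X := by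
  simp only [vert_dir]
  simp [vert]

theorem bddLip_coord_ball (i : Fin (n + 1)) :
    BddLip (ballPart n 5) (EuclideanSpace.proj i : Space n →L[ℝ] ℝ) :=
  (BddLip.of_contDiffAt (isCompact_closedBall (0 : Space n) 5) (convex_closedBall 0 5)
    fun _ _ => (EuclideanSpace.proj i : Space n →L[ℝ] ℝ).contDiff.contDiffAt).mono
    fun X hX => by simpa using hX.2

/-- The integrand of the Euler identity for `w² G`. -/
noncomputable def eulerDensity (a : ℝ) (w : Space n × ℝ → ℝ) (p : Space n × ℝ) : ℝ :=
  ((n : ℝ) + 1 + a) * w p ^ 2 + 2 * w p * ∑ i, p.1 i * dX w i p - ‖p.1‖ ^ 2 / (2 * p.2) * w p ^ 2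

theorem euler_pointwise {a : ℝ} {p : Space n × ℝ} (ht : 0 < p.2) (hw : DifferentiableAt ℝ w p)
    (hX : ∀ i, fderiv ℝ w p (dir i, 0) = dX w i p) :
    ∑ i, p.1 i * fderiv ℝ (fun q : Space n × ℝ => w q ^ 2 * gaussian a q.1 q.2) p (dir i, 0)
      + ((Fintype.card (Fin (n + 1)) : ℝ) + a) * (w p ^ 2 * gaussian a p.1 p.2)
    = gaussian a p.1 p.2 * eulerDensity a w p := by
  have hG : DifferentiableAt ℝ (fun x : Space n × ℝ => gaussian a x.1 x.2) p :=
    (contDiffAt_gaussian a ht).differentiableAt one_ne_zero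
  have e : ∀ i, p.1 i * fderiv ℝ (fun q : Space n × ℝ => w q ^ 2 * gaussian a q.1 q.2) p (dir i, 0)
      = gaussian a p.1 p.2 * (2 * w p * (p.1 i * dX w i p))
        - gaussian a p.1 p.2 * w p ^ 2 / (2 * p.2) * p.1 i ^ 2 := by
    intro i
    rw [fd_mul (hw.fun_pow 2) hG, fd_sq hw, fderiv_gaussian_space a ht, hX]
    ring
  simp only [e]
  rw [Finset.sum_sub_distrib, ← Finset.mul_sum, ← Finset.mul_sum, ← Finset.mul_sum, eulerDensity,
    EuclideanSpace.norm_sq_eq]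
  simp only [Real.norm_eq_abs, sq_abs, Fintype.card_fin]
  push_cast
  ring

/-- Needed at t = c, to control |X|²w²/t in the boundary form by w² and t|∇w|². -/
theorem IsTestFunction.integral_euler_slice {T₁ : ℝ} (hw : IsTestFunction n T₁ w) {a : ℝ}
    (ha : a ∈ Ioo (-1 : ℝ) 1) {t : ℝ} (ht : 0 < t) :
    IntegrableOn (fun X : Space n => vert X ^ a * (gaussian a X t * eulerDensity a w (X, t)))
      (ballPart n 4) ∧
    ∫ X in ballPart n 4, vert X ^ a * (gaussian a X t * eulerDensity a w (X, t)) = 0 := by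
  have D := halfDomain_space (n := n) (R := 5) (R' := 4) (by norm_num) le_rfl
  have hgood : GoodST n t t t fun q => w q ^ 2 * gaussian a q.1 q.2 :=
    (hw.good ht).pow_two.mul (GoodST.gaussian a le_rfl ht)
  have hdiff : ∀ X : Space n, 0 < vert X →
      DifferentiableAt ℝ (fun q : Space n × ℝ => w q ^ 2 * gaussian a q.1 q.2) (X, t) := fun X hX =>
    (hw.differentiableAt (p := (X, t)) hX ht).fun_pow 2 |>.fun_mul
      ((contDiffAt_gaussian a (p := (X, t)) ht).differentiableAt one_ne_zero)
  have hg : Good volume (ballPart n 5) (ballPart n 4)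
      fun X => w (X, t) ^ 2 * gaussian a X t := by
    refine ⟨hgood.lip.comp (φ := fun X : Space n => (X, t)) (fun X hX => ⟨hX, le_rfl, le_rfl⟩)
      fun p q => by simp [Prod.norm_def], ?_⟩
    rw [ae_restrict_iff' (measurableSet_ballPart 4)]
    refine Eventually.of_forall fun X hX => ?_
    exact DifferentiableAt.fun_comp' (f := fun X : Space n => (X, t)) X (hdiff X hX.1)
      (differentiableAt_fun_id.prodMk (differentiableAt_const t))
  have hz : ∀ X ∈ halfSpace n, X ∉ ballPart n 4 → w (X, t) ^ 2 * gaussian a X t = 0 := by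
    intro X hX hX'
    rw [hw.eq_zero ht (X, t) ⟨hX, mem_Ici.2 le_rfl⟩ fun h => hX' h.1]
    simp
  have key := D.integral_euler (v := dir) (x := fun i => EuclideanSpace.proj i)
    (direction_space (by norm_num)) (fun i => by simp [dir]) (fun X => sum_coord_vert X)
    (fun i => by
      by_cases hi : i = Fin.last n
      · right; subst hi; rfl
      · left; simp [vert_dir, hi]) bddLip_coord_ball ha.1 ha.2 hg hz
  have hpt : ∀ X ∈ ballPart n 4, vert X ^ a * (gaussian a X t * eulerDensity a w (X, t))
      = vertL n X ^ a * (∑ i, (EuclideanSpace.proj i : Space n →L[ℝ] ℝ) X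
        * fderiv ℝ (fun X => w (X, t) ^ 2 * gaussian a X t) X (dir i)
        + ((Fintype.card (Fin (n + 1)) : ℝ) + a) * (w (X, t) ^ 2 * gaussian a X t)) := by
    intro X hX
    have e := euler_pointwise (a := a) (p := (X, t)) ht (hw.differentiableAt hX.1 ht)
      fun i => (dW_eq_fderiv (p := (X, t)) hX.1 ht _).symm
    rw [← e]
    have e2 : ∀ i, fderiv ℝ (fun q : Space n × ℝ => w q ^ 2 * gaussian a q.1 q.2) (X, t) (dir i, 0)
        = fderiv ℝ (fun X => w (X, t) ^ 2 * gaussian a X t) X (dir i) := fun i =>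
      (fderiv_slice_space (hdiff X hX.1) i).symm
    simp only [e2]
    rfl
  refine ⟨?_, ?_⟩
  · exact key.1.congr_fun (fun X hX => (hpt X hX).symm) (measurableSet_ballPart 4)
  · rw [setIntegral_congr_fun (measurableSet_ballPart 4) hpt]
    exact key.2

/-- The Euler field is spatial, so any weight κ(t) can be carried along; the one used later is ρθ/t.
-/
theorem IsTestFunction.integral_euler_box {T₁ : ℝ} (hw : IsTestFunction n T₁ w)
    (hc : 0 < c) (hT : T₁ ≤ T₂) {a : ℝ} (ha : a ∈ Ioo (-1 : ℝ) 1) {κ : ℝ → ℝ}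
    (hκ : GoodST n c T₁ T₂ fun p => κ p.2)
    (hκ' : ∀ t ∈ Icc c T₁, DifferentiableAt ℝ κ t) :
    IntegrableOn (fun p : Space n × ℝ => vert p.1 ^ a * (κ p.2 * (gaussian a p.1 p.2
      * eulerDensity a w p))) (box n 4 c T₁) ∧
    ∫ p in box n 4 c T₁, vert p.1 ^ a * (κ p.2 * (gaussian a p.1 p.2 * eulerDensity a w p)) = 0 := by
  have D := halfDomain_spaceTime (n := n) (R := 5) (R' := 4) (c := c) (by norm_num) le_rfl hT
  have hg : GoodST n c T₁ T₂ fun q => κ q.2 * (w q ^ 2 * gaussian a q.1 q.2) :=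
    hκ.mul ((hw.good hc).pow_two.mul (GoodST.gaussian a hT hc))
  have hz : ∀ p ∈ halfSpace n ×ˢ Ici c, p ∉ box n 4 c T₁ →
      κ p.2 * (w p ^ 2 * gaussian a p.1 p.2) = 0 := by
    intro p hp hp'
    rw [hw.eq_zero hc p hp hp']
    simp
  have key := D.integral_euler (v := fun i => (dir i, (0 : ℝ)))
    (x := fun i => (EuclideanSpace.proj i : Space n →L[ℝ] ℝ).comp
      (ContinuousLinearMap.fst ℝ (Space n) ℝ))
    (direction_spaceTime (by norm_num) hT) (fun i => by simp [dir])
    (fun p => sum_coord_vert p.1)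
    (fun i => by
      by_cases hi : i = Fin.last n
      · right; subst hi; rfl
      · left; simp [vert_dir, hi])
    (fun i => (bddLip_coord_ball i).comp (φ := Prod.fst) (fun p hp => hp.1)
      fun p q => norm_fst_le (p - q)) ha.1 ha.2 hg hz
  have hpt : ∀ p ∈ box n 4 c T₁, vert p.1 ^ a * (κ p.2 * (gaussian a p.1 p.2 * eulerDensity a w p))
      = vertST n p ^ a * (∑ i, (EuclideanSpace.proj i : Space n →L[ℝ] ℝ).comp
      (ContinuousLinearMap.fst ℝ (Space n) ℝ) p
        * fderiv ℝ (fun q : Space n × ℝ => κ q.2 * (w q ^ 2 * gaussian a q.1 q.2)) p (dir i, 0)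
        + ((Fintype.card (Fin (n + 1)) : ℝ) + a) * (κ p.2 * (w p ^ 2 * gaussian a p.1 p.2))) := by
    intro p hp
    have ht : 0 < p.2 := hc.trans_le hp.2.1
    have hwd := hw.differentiableAt hp.1.1 ht
    have e := euler_pointwise (a := a) (p := p) ht hwd fun i => (dW_eq_fderiv hp.1.1 ht _).symm
    rw [← e]
    have e2 : ∀ i, fderiv ℝ (fun q : Space n × ℝ => κ q.2 * (w q ^ 2 * gaussian a q.1 q.2)) p (dir i, 0)
        = κ p.2 * fderiv ℝ (fun q : Space n × ℝ => w q ^ 2 * gaussian a q.1 q.2) p (dir i, 0) := by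
      intro i
      rw [fd_mul (diff_time (hκ' p.2 hp.2).hasDerivAt) (hwd.fun_pow 2 |>.fun_mul
        ((contDiffAt_gaussian a ht).differentiableAt one_ne_zero)),
        fd_time (hκ' p.2 hp.2).hasDerivAt]
      simp
    simp only [e2]
    have e3 : ∀ i, (EuclideanSpace.proj i : Space n →L[ℝ] ℝ).comp
      (ContinuousLinearMap.fst ℝ (Space n) ℝ) p = p.1 i := fun i => rfl
    simp only [e3, vertST_apply, mul_left_comm (p.1 _) (κ p.2), ← Finset.mul_sum]
    ring
  refine ⟨?_, ?_⟩
  · exact key.1.congr_fun (fun X hX => (hpt X hX).symm) measurableSet_box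
  · rw [setIntegral_congr_fun measurableSet_box hpt]
    exact key.2

theorem IsTestFunction.ae_regularAt {T₁ : ℝ} (hw : IsTestFunction n T₁ w)
    (hA : IsAdmissible n Λ K A) (hK : 0 ≤ K) (hc : 0 < c) :
    ∀ᵐ p ∂(volume : Measure (Space n × ℝ)).restrict (box n 4 c T), RegularAt A w p := by
  filter_upwards [ae_restrict_of_ae (hA.ae_differentiableAt hK), ae_restrict_mem measurableSet_box]
    with p hp hpb
  have h1 : 0 < vert p.1 := hpb.1.1
  have h2 : 0 < p.2 := hc.trans_le hpb.2.1
  exact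
    { time_pos := h2
      vert_pos := h1
      coef := hp
      symm := fun i j => hA.coef_symm i j p
      last := fun i => hA.last_row (horiz p.1) p.2 i
      diff := hw.differentiableAt h1 h2
      diffX := fun i => (hw.dW _).differentiableAt h1 h2
      diffT := (hw.dW _).differentiableAt h1 h2
      eq_fderiv := fun v => (dW_eq_fderiv h1 h2 v).symm
      commX := fun i j => hw.fderiv_dW_comm h1 h2 _ _
      commT := fun i => hw.fderiv_dW_comm h1 h2 _ _ }

theorem goodST_flux {T₁ : ℝ} (hw : IsTestFunction n T₁ w) (hA : IsAdmissible n Λ K A) (hK : 0 ≤ K)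
    (hc : 0 < c) (k : Fin (n + 1)) : GoodST n c T T₂ (flux A w k) :=
  Good.sum fun j => (hA.good hK hc k j).mul ((hw.dW _).good hc)

theorem goodST_drift (hA : IsAdmissible n Λ K A) (hK : 0 ≤ K)
    (hc : 0 < c) (hT : T ≤ T₂) (k : Fin (n + 1)) : GoodST n c T T₂ (drift A k) :=
  (Good.sum fun l => (hA.good hK hc k l).mul (GoodST.coord hT l)).mul
    ((GoodST.inv_time hT hc).const_mul _)

theorem goodST_mainDefect (hA : IsAdmissible n Λ K A) (hK : 0 ≤ K)
    (hc : 0 < c) (hT : T ≤ T₂) : GoodST n c T T₂ (mainDefect A) :=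
  (Good.sum fun k => (GoodST.coord hT k).mul ((GoodST.coord hT k).sub
    (Good.sum fun l => (hA.good hK hc k l).mul (GoodST.coord hT l)))).mul
    (((GoodST.inv_time hT hc).mul (GoodST.inv_time hT hc)).const_mul _)

theorem goodST_energy {T₁ : ℝ} (hw : IsTestFunction n T₁ w) (hA : IsAdmissible n Λ K A) (hK : 0 ≤ K)
    (hc : 0 < c) : GoodST n c T T₂ (energy A w) :=
  Good.sum fun k => (goodST_flux hw hA hK hc k).mul ((hw.dW _).good hc)

/-- The last row of A is e_{n+1}, so the vertical component of the field is G(Bx_{n+1}/(2t) +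
q∂_{n+1}w). Both summands decay as required at x_{n+1} = 0, the second by the Neumann condition. -/
theorem integral_transport_field {T₁ : ℝ} (hw : IsTestFunction n T₁ w) (hA : IsAdmissible n Λ K A)
    (hK : 0 ≤ K) (hc : 0 < c) (hcT : c < T₁) (hT : T₁ < T₂) {a : ℝ} (ha : a ∈ Ioo (-1 : ℝ) 1)
    (hN : HasZeroWeightedNeumann a w)
    {B q : Space n × ℝ → ℝ} (hB : GoodST n c T₁ T₂ B) (hq : GoodST n c T₁ T₂ q)
    (hB0 : ∀ p ∈ halfSpace n ×ˢ Ici c, p ∉ box n 4 c T₁ → B p = 0)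
    (hq0 : ∀ p ∈ halfSpace n ×ˢ Ici c, p ∉ box n 4 c T₁ → q p = 0) :
    IntegrableOn (fun p : Space n × ℝ => vert p.1 ^ a * (gaussian a p.1 p.2
      * (transport A B p + defect A a p * B p + ∑ k, fderiv ℝ q p (dir k, 0) * flux A w k p
        + q p * (heatOp A w a p - transport A w p)))) (box n 4 c T₁) ∧
    ∫ p in box n 4 c T₁, vert p.1 ^ a * (gaussian a p.1 p.2
      * (transport A B p + defect A a p * B p + ∑ k, fderiv ℝ q p (dir k, 0) * flux A w k p
        + q p * (heatOp A w a p - transport A w p)))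
      = -∫ X in ballPart n 4, vert X ^ a * (gaussian a X c * B (X, c)) := by
  have hG := GoodST.gaussian (n := n) a hT.le hc
  have key := integral_divergence hcT hT ha
    (ψ := fun k p => gaussian a p.1 p.2 * (B p * drift A k p + q p * flux A w k p))
    (φ := fun p => gaussian a p.1 p.2 * B p)
    (fun k => hG.mul ((hB.mul (goodST_drift hA hK hc hT.le k)).add
      (hq.mul (goodST_flux hw hA hK hc k)))) (hG.mul hB)
    (fun k p hp hp' => by rw [hB0 p hp hp', hq0 p hp hp']; ring)
    (fun p hp hp' => by rw [hB0 p hp hp']; ring) (by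
      obtain ⟨C, hC, hb⟩ := hw.vert_deriv_bound hN
      obtain ⟨C1, hC1, hb1, -⟩ := hq.lip
      obtain ⟨C2, hC2, hb2, -⟩ := hB.lip
      obtain ⟨C3, hC3, hb3, -⟩ := hG.lip
      refine ⟨C3 * (C2 * (5 * c⁻¹) + C1 * C), fun p hp => ?_⟩
      have hz : 0 < vert p.1 := hp.1.1
      have ht : 0 < p.2 := hc.trans_le hp.2.1
      have hpK : p ∈ box n 5 c T₂ := ⟨⟨hz, hp.1.2.trans (by norm_num)⟩, hp.2.1, hp.2.2.trans hT.le⟩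
      have hz4 : vert p.1 ≤ 4 := (le_abs_self _).trans ((abs_vert_le _).trans hp.1.2)
      have hpow : 0 ≤ vert p.1 ^ (vanishExp a - a) := Real.rpow_nonneg hz.le _
      have e1 : drift A (Fin.last n) p = vert p.1 * (2⁻¹ * p.2⁻¹) := by
        have : ∀ i, coef A (Fin.last n) i p = if i = Fin.last n then 1 else 0 :=
          fun i => hA.last_row (horiz p.1) p.2 i
        simp [drift, this, vert]
      have e2 : flux A w (Fin.last n) p = dX w (Fin.last n) p := by
        have : ∀ i, coef A (Fin.last n) i p = if i = Fin.last n then 1 else 0 :=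
          fun i => hA.last_row (horiz p.1) p.2 i
        simp [flux, this]
      -- The exponent is 0 or 1, and x_{n+1} ≤ 4 on the box.
      have hzb : vert p.1 ≤ 5 * vert p.1 ^ (vanishExp a - a) := by
        unfold vanishExp
        split_ifs
        · simp; linarith
        · rw [show 1 + a - a = (1 : ℝ) by ring, Real.rpow_one]; linarith
      have hti : p.2⁻¹ ≤ c⁻¹ := inv_anti₀ hc hp.2.1
      have hti0 : 0 ≤ p.2⁻¹ := inv_nonneg.2 ht.le
      have hd : |drift A (Fin.last n) p| ≤ 5 * c⁻¹ * vert p.1 ^ (vanishExp a - a) := by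
        rw [e1, abs_of_nonneg (by positivity)]
        calc vert p.1 * (2⁻¹ * p.2⁻¹) ≤ (5 * vert p.1 ^ (vanishExp a - a)) * c⁻¹ :=
              mul_le_mul hzb (by linarith) (by positivity) (by positivity)
          _ = _ := by ring
      rw [abs_mul, e2, mul_assoc]
      refine mul_le_mul (hb3 p hpK) ?_ (abs_nonneg _) hC3
      refine (abs_add_le _ _).trans ?_
      rw [abs_mul, abs_mul, add_mul, mul_assoc C2, mul_assoc C1]
      exact add_le_add (mul_le_mul (hb2 p hpK) hd (abs_nonneg _) hC2)
        (mul_le_mul (hb1 p hpK) (hb p hz ht) (abs_nonneg _) hC1))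
  have hpt : ∀ᵐ p ∂(volume : Measure (Space n × ℝ)).restrict (box n 4 c T₁),
      RegularAt A w p ∧ DifferentiableAt ℝ B p ∧ DifferentiableAt ℝ q p := by
    filter_upwards [hw.ae_regularAt (T := T₁) hA hK hc, hB.diff, hq.diff] with p h1 h2 h3
      using ⟨h1, h2, h3⟩
  refine ⟨key.1.congr (hpt.mono fun p hp => congrArg (fun x => vert p.1 ^ a * x)
    (hp.1.divergence_eq (a := a) hp.2.1 hp.2.2)), ?_⟩
  rw [← key.2]
  exact integral_congr_ae (hpt.mono fun p hp => (congrArg (fun x => vert p.1 ^ a * x)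
    (hp.1.divergence_eq (a := a) hp.2.1 hp.2.2)).symm)

end Carleman

/-! ### The integrated identities for the actual weights. -/

namespace Carleman

variable {n : ℕ} {c T T₂ lam α : ℝ} {σ : ℝ → ℝ} {w : Space n × ℝ → ℝ} {Λ K : ℝ}
  {A : EuclideanSpace ℝ (Fin n) → ℝ → Matrix (Fin (n + 1)) (Fin (n + 1)) ℝ}

/-- The weight `σ^{-2α}`. -/
noncomputable def rho (σ : ℝ → ℝ) (α t : ℝ) : ℝ := σ t ^ (-2 * α)

/-- The rescaled function `θ(λ t)`. -/
noncomputable def th (lam t : ℝ) : ℝ := theta (lam * t)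

/-- The derivative of `θ(λ t)`. -/
noncomputable def th' (lam t : ℝ) : ℝ := lam * theta' (lam * t)

/-- The derivative of `eta`. -/
noncomputable def eta' (lam : ℝ) (σ : ℝ → ℝ) (t : ℝ) : ℝ := eta σ t / t * (1 + th lam t)

theorem hasDerivAt_rho (hσ : IsCarlemanWeight lam σ) {t : ℝ} (ht : t ∈ Ioo 0 (1 / lam)) :
    HasDerivAt (rho σ α) (-2 * α * rho σ α t / eta σ t) t := hasDerivAt_sigma_rpow hσ α ht

theorem hasDerivAt_th (hlam : 0 < lam) {t : ℝ} (ht : t ∈ Ioo 0 (1 / lam)) :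
    HasDerivAt (th lam) (th' lam t) t := by
  have h := lam_mul_mem hlam ht
  have h1 : HasDerivAt (fun t => lam * t) lam t := by simpa using (hasDerivAt_id t).const_mul lam
  have := (hasDerivAt_theta h.1 h.2).comp t h1
  rw [th', mul_comm]
  exact this

section good
variable (hlam : 0 < lam) (hσ : IsCarlemanWeight lam σ) (hc : 0 < c) (hT : T ≤ T₂)
  (hT₂ : T₂ < 1 / lam)
include hc hT₂

theorem Icc_subset_Ioo_weight : Icc c T₂ ⊆ Ioo 0 (1 / lam) := fun _ ht =>
  ⟨hc.trans_le ht.1, ht.2.trans_lt hT₂⟩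

include hσ in
theorem continuousOn_eta : ContinuousOn (eta σ) (Icc c T₂) := fun _ ht =>
  (hasDerivAt_eta hσ (Icc_subset_Ioo_weight hc hT₂ ht)).continuousAt.continuousWithinAt

include hσ in
theorem continuousOn_rho : ContinuousOn (rho σ α) (Icc c T₂) := fun _ ht =>
  (hasDerivAt_rho hσ (Icc_subset_Ioo_weight hc hT₂ ht)).continuousAt.continuousWithinAt

include hlam in
theorem continuousOn_th : ContinuousOn (th lam) (Icc c T₂) := fun _ ht =>
  (hasDerivAt_th hlam (Icc_subset_Ioo_weight hc hT₂ ht)).continuousAt.continuousWithinAt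

include hlam hσ in
theorem continuousOn_eta' : ContinuousOn (eta' lam σ) (Icc c T₂) :=
  ((continuousOn_eta hσ hc hT₂).div continuousOn_id fun _ ht => (hc.trans_le ht.1).ne').mul
    (continuousOn_const.add (continuousOn_th hlam hc hT₂))

include hσ hT in
theorem goodST_rho : GoodST n c T T₂ fun p => rho σ α p.2 :=
  GoodST.time hT (fun _ ht => hasDerivAt_rho hσ (Icc_subset_Ioo_weight hc hT₂ ht))
    ((continuousOn_const.mul (continuousOn_rho hσ hc hT₂)).div (continuousOn_eta hσ hc hT₂)
      fun _ ht => (eta_pos (hc.trans_le ht.1)).ne')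

include hlam hσ hT in
theorem goodST_eta : GoodST n c T T₂ fun p => eta σ p.2 :=
  GoodST.time hT (fun _ ht => hasDerivAt_eta hσ (Icc_subset_Ioo_weight hc hT₂ ht))
    (continuousOn_eta' hlam hσ hc hT₂)

include hlam hσ hT in
theorem goodST_eta_inv : GoodST n c T T₂ fun p => (eta σ p.2)⁻¹ :=
  GoodST.time hT (fun _ ht => (hasDerivAt_eta hσ (Icc_subset_Ioo_weight hc hT₂ ht)).fun_inv
    (eta_pos (hc.trans_le ht.1)).ne')
    ((continuousOn_eta' hlam hσ hc hT₂).neg.div ((continuousOn_eta hσ hc hT₂).pow 2)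
      fun _ ht => (pow_pos (eta_pos (hc.trans_le ht.1)) 2).ne')

include hlam hT in
theorem goodST_th : GoodST n c T T₂ fun p => th lam p.2 :=
  GoodST.time hT (fun _ ht => hasDerivAt_th hlam (Icc_subset_Ioo_weight hc hT₂ ht))
    (continuousOn_const.mul (continuousOn_theta'.comp (continuousOn_const.mul continuousOn_id)
      fun _ ht => lam_mul_mem hlam (Icc_subset_Ioo_weight hc hT₂ ht)))

end good

/-- The standing assumptions of the Carleman estimate. -/
structure Setting (n : ℕ) (a Λ K lam c : ℝ) (σ : ℝ → ℝ)
    (A : EuclideanSpace ℝ (Fin n) → ℝ → Matrix (Fin (n + 1)) (Fin (n + 1)) ℝ)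
    (w : Space n × ℝ → ℝ) : Prop where
  ha : a ∈ Ioo (-1 : ℝ) 1
  hK : 0 ≤ K
  one_le : 1 ≤ lam
  hσ : IsCarlemanWeight lam σ
  hA : IsAdmissible n Λ K A
  hw : IsTestFunction n (1 / (3 * lam)) w
  hN : HasZeroWeightedNeumann a w
  hc : 0 < c
  hc' : c ≤ 1 / (5 * lam)

namespace Setting
variable {a : ℝ} (S : Setting n a Λ K lam c σ A w)
include S

theorem lam_pos : 0 < lam := one_pos.trans_le S.one_le

theorem c_lt : c < 1 / (3 * lam) := by
  have := S.lam_pos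
  exact S.hc'.trans_lt (one_div_lt_one_div_of_lt (by positivity) (by linarith))

theorem T_lt : 1 / (3 * lam) < 1 / (2 * lam) := by
  have := S.lam_pos
  exact one_div_lt_one_div_of_lt (by positivity) (by linarith)

theorem T₂_lt : 1 / (2 * lam) < 1 / lam := by
  have := S.lam_pos
  exact one_div_lt_one_div_of_lt (by positivity) (by linarith)

theorem mem_Ioo {t : ℝ} (ht : t ∈ Icc c (1 / (3 * lam))) : t ∈ Ioo 0 (1 / lam) :=
  ⟨S.hc.trans_le ht.1, ht.2.trans_lt (S.T_lt.trans S.T₂_lt)⟩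

theorem carleman_integral :
    IntegrableOn (fun p : Space n × ℝ => vert p.1 ^ a * (gaussian a p.1 p.2 * (rho σ α p.2
      * (2 * eta σ p.2 * antiPart A w α (eta σ) p * (heatOp A w a p - antiPart A w α (eta σ) p)
        + commutator A w α (eta σ) a (eta' lam σ p.2) p)))) (box n 4 c (1 / (3 * lam))) ∧
    ∫ p in box n 4 c (1 / (3 * lam)), vert p.1 ^ a * (gaussian a p.1 p.2 * (rho σ α p.2
      * (2 * eta σ p.2 * antiPart A w α (eta σ) p * (heatOp A w a p - antiPart A w α (eta σ) p)
        + commutator A w α (eta σ) a (eta' lam σ p.2) p)))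
      = -∫ X in ballPart n 4, vert X ^ a * (gaussian a X c
          * symmForm A w α (rho σ α) (eta σ) (X, c)) := by
  have gρ := goodST_rho (n := n) (α := α) S.hσ S.hc S.T_lt.le S.T₂_lt
  have gη := goodST_eta (n := n) S.lam_pos S.hσ S.hc S.T_lt.le S.T₂_lt
  have gi := goodST_eta_inv (n := n) S.lam_pos S.hσ S.hc S.T_lt.le S.T₂_lt
  have gw := S.hw.good (T := 1 / (3 * lam)) (T₂ := 1 / (2 * lam)) S.hc
  have gF := goodST_mainDefect S.hA S.hK S.hc S.T_lt.le
  have gE := goodST_energy (T := 1 / (3 * lam)) (T₂ := 1 / (2 * lam)) S.hw S.hA S.hK S.hc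
  have gX : ∀ v, GoodST n c (1 / (3 * lam)) (1 / (2 * lam)) (dW w v) := fun v =>
    (S.hw.dW v).good S.hc
  have gY : GoodST n c (1 / (3 * lam)) (1 / (2 * lam)) (antiPart A w α (eta σ)) :=
    (((gX _).add (Good.sum fun k => (goodST_drift S.hA S.hK S.hc S.T_lt.le k).mul (gX _))).add
      ((gF.mul gw).const_mul _)).sub ((gi.mul gw).const_mul _)
  have hw0 := S.hw.eq_zero S.hc
  have hX0 : ∀ v, ∀ p ∈ halfSpace n ×ˢ Ici c, p ∉ box n 4 c (1 / (3 * lam)) → dW w v p = 0 :=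
    fun v => (S.hw.dW v).eq_zero S.hc
  have key := integral_transport_field S.hw S.hA S.hK S.hc S.c_lt S.T_lt S.ha S.hN
    (B := symmForm A w α (rho σ α) (eta σ))
    (q := fun x => 2 * (eta σ x.2 * rho σ α x.2 * antiPart A w α (eta σ) x))
    (gρ.mul (((gw.pow_two.const_mul α).sub (((gη.mul gF).mul gw.pow_two).const_mul _)).sub
      (gη.mul gE))) (((gη.mul gρ).mul gY).const_mul 2)
    (fun p hp hp' => by
      simp only [symmForm, energy, dX, hw0 p hp hp', hX0 _ p hp hp']
      simp)
    (fun p hp hp' => by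
      simp only [antiPart, dX, hw0 p hp hp', hX0 _ p hp hp']
      simp)
  have hpt : ∀ᵐ p ∂(volume : Measure (Space n × ℝ)).restrict (box n 4 c (1 / (3 * lam))),
      RegularAt A w p ∧ p.2 ∈ Ioo 0 (1 / lam) := by
    filter_upwards [S.hw.ae_regularAt (T := 1 / (3 * lam)) S.hA S.hK S.hc,
      ae_restrict_mem measurableSet_box] with p h1 h2 using ⟨h1, S.mem_Ioo h2.2⟩
  have e : ∀ p : Space n × ℝ, RegularAt A w p ∧ p.2 ∈ Ioo 0 (1 / lam) → _ := fun p hp =>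
    congrArg (fun x => vert p.1 ^ a * (gaussian a p.1 p.2 * x))
      (hp.1.carleman_identity (a := a) (hasDerivAt_rho (α := α) S.hσ hp.2)
        (hasDerivAt_eta S.hσ hp.2) (eta_pos hp.2.1).ne')
  refine ⟨key.1.congr (hpt.mono e), ?_⟩
  rw [← key.2]
  exact integral_congr_ae (hpt.mono fun p hp => (e p hp).symm)

theorem caccioppoli_integral :
    IntegrableOn (fun p : Space n × ℝ => vert p.1 ^ a * (gaussian a p.1 p.2 * (rho σ α p.2
      * (2⁻¹ * th' lam p.2 * w p ^ 2 - α * th lam p.2 / eta σ p.2 * w p ^ 2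
        + 2⁻¹ * defect A a p * th lam p.2 * w p ^ 2 + th lam p.2 * energy A w p
        + th lam p.2 * w p * heatOp A w a p)))) (box n 4 c (1 / (3 * lam))) ∧
    ∫ p in box n 4 c (1 / (3 * lam)), vert p.1 ^ a * (gaussian a p.1 p.2 * (rho σ α p.2
      * (2⁻¹ * th' lam p.2 * w p ^ 2 - α * th lam p.2 / eta σ p.2 * w p ^ 2
        + 2⁻¹ * defect A a p * th lam p.2 * w p ^ 2 + th lam p.2 * energy A w p
        + th lam p.2 * w p * heatOp A w a p)))
      = -∫ X in ballPart n 4, vert X ^ a * (gaussian a X c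
          * (2⁻¹ * (rho σ α c * th lam c * w (X, c) ^ 2))) := by
  have gρ := goodST_rho (n := n) (α := α) S.hσ S.hc S.T_lt.le S.T₂_lt
  have gθ := goodST_th (n := n) S.lam_pos S.hc S.T_lt.le S.T₂_lt
  have gw := S.hw.good (T := 1 / (3 * lam)) (T₂ := 1 / (2 * lam)) S.hc
  have hw0 := S.hw.eq_zero S.hc
  have key := integral_transport_field S.hw S.hA S.hK S.hc S.c_lt S.T_lt S.ha S.hN
    (B := fun x => 2⁻¹ * (rho σ α x.2 * th lam x.2 * w x ^ 2))
    (q := fun x => rho σ α x.2 * th lam x.2 * w x)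
    (((gρ.mul gθ).mul gw.pow_two).const_mul _) ((gρ.mul gθ).mul gw)
    (fun p hp hp' => by
      simp only [hw0 p hp hp']
      simp)
    (fun p hp hp' => by
      simp only [hw0 p hp hp']
      simp)
  have hpt : ∀ᵐ p ∂(volume : Measure (Space n × ℝ)).restrict (box n 4 c (1 / (3 * lam))),
      RegularAt A w p ∧ p.2 ∈ Ioo 0 (1 / lam) := by
    filter_upwards [S.hw.ae_regularAt (T := 1 / (3 * lam)) S.hA S.hK S.hc,
      ae_restrict_mem measurableSet_box] with p h1 h2 using ⟨h1, S.mem_Ioo h2.2⟩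
  have e : ∀ p : Space n × ℝ, RegularAt A w p ∧ p.2 ∈ Ioo 0 (1 / lam) → _ := fun p hp =>
    congrArg (fun x => vert p.1 ^ a * (gaussian a p.1 p.2 * x))
      (hp.1.caccioppoli_identity (a := a) (hasDerivAt_rho (α := α) S.hσ hp.2)
        (hasDerivAt_th S.lam_pos hp.2))
  refine ⟨key.1.congr (hpt.mono e), ?_⟩
  rw [← key.2]
  exact integral_congr_ae (hpt.mono fun p hp => (e p hp).symm)

end Setting
end Carleman

/-! ### Pointwise size of the drift, the defect and their derivatives. -/

namespace Carleman

theorem abs_sum_le_card {n : ℕ} {f : Fin (n + 1) → ℝ} {C : ℝ} (h : ∀ i, |f i| ≤ C) :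
    |∑ i, f i| ≤ ((n : ℝ) + 1) * C := by
  refine (Finset.abs_sum_le_sum_abs _ _).trans ?_
  refine (Finset.sum_le_sum fun i _ => h i).trans ?_
  simp

theorem abs_mul_le_mul {x y a b : ℝ} (hx : |x| ≤ a) (hy : |y| ≤ b) : |x * y| ≤ a * b := by
  rw [abs_mul]
  exact mul_le_mul hx hy (abs_nonneg _) ((abs_nonneg _).trans hx)

variable {n : ℕ} {Λ K : ℝ} {w : Space n × ℝ → ℝ}
  {A : EuclideanSpace ℝ (Fin n) → ℝ → Matrix (Fin (n + 1)) (Fin (n + 1)) ℝ} {p : Space n × ℝ}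

theorem abs_coord_le (X : Space n) (i : Fin (n + 1)) : |X i| ≤ ‖X‖ := by
  simpa using PiLp.norm_apply_le X i

set_option linter.unusedSectionVars false

theorem abs_residual_le (hA : IsAdmissible n Λ K A) (ht : 0 < p.2) (j : Fin (n + 1)) :
    |p.1 j - ∑ l, coef A j l p * p.1 l| ≤ ((n : ℝ) + 1) * K * ((‖p.1‖ + p.2) * ‖p.1‖) := by
  have e : p.1 j - ∑ l, coef A j l p * p.1 l
      = -∑ l, (coef A j l p - (1 : Matrix (Fin (n + 1)) (Fin (n + 1)) ℝ) j l) * p.1 l := by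
    simp [sub_mul, Finset.sum_sub_distrib, Matrix.one_apply]
  rw [e, abs_neg]
  refine (abs_sum_le_card fun l => abs_mul_le_mul
    (hA.abs_coef_sub_one_le j l ht.le) (abs_coord_le p.1 l)).trans (le_of_eq (by ring))

/-- The scaling behind the following bounds: F has size (|X| + t)|X|²/t², a space derivative costs
one power of |X|, a time derivative or Z costs one power of t, and the small factor |X| + t always
survives. -/
theorem abs_mainDefect_le (hA : IsAdmissible n Λ K A) (ht : 0 < p.2) : |mainDefect A p|
    ≤ ((n : ℝ) + 1) ^ 2 * K * ((‖p.1‖ + p.2) * (‖p.1‖ ^ 2 * p.2⁻¹ ^ 2)) := by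
  have hti : 0 < p.2⁻¹ := inv_pos.2 ht
  have h1 : |∑ k, p.1 k * (p.1 k - ∑ l, coef A k l p * p.1 l)| ≤ _ :=
    abs_sum_le_card fun k => abs_mul_le_mul (abs_coord_le p.1 k) (abs_residual_le hA ht k)
  have h2 : |(4⁻¹ * (p.2⁻¹ * p.2⁻¹) : ℝ)| ≤ p.2⁻¹ * p.2⁻¹ := by
    rw [abs_of_pos (by positivity)]; nlinarith [mul_pos hti hti]
  exact (abs_mul_le_mul h1 h2).trans (le_of_eq (by ring))

section bounds
variable (hA : IsAdmissible n Λ K A) (hK : 0 ≤ K) (h : RegularAt A w p) (hr : ‖p.1‖ ≤ 4)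
  (ht : p.2 ≤ 1)
include hA hK h

theorem abs_fderiv_coef_space (i j k : Fin (n + 1)) :
    |fderiv ℝ (coef A i j) p (dir k, 0)| ≤ 2 * K := by
  have := hA.abs_fderiv_coef_le hK i j p (dir k, 0)
  simpa [Prod.norm_def, norm_dir] using this

theorem abs_fderiv_coef_time (i j : Fin (n + 1)) :
    |fderiv ℝ (coef A i j) p (0, 1)| ≤ 2 * K := by
  have := hA.abs_fderiv_coef_le hK i j p (0, 1)
  simpa [Prod.norm_def] using this

include hr ht in
theorem abs_coef_le (i j : Fin (n + 1)) : |coef A i j p| ≤ 1 + 5 * K := by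
  have h1 := hA.abs_coef_sub_one_le i j (p := p) h.time_pos.le
  have h2 : |(1 : Matrix (Fin (n + 1)) (Fin (n + 1)) ℝ) i j| ≤ 1 := by
    rw [Matrix.one_apply]; split_ifs <;> simp
  have h3 : K * (‖p.1‖ + p.2) ≤ K * 5 := mul_le_mul_of_nonneg_left (by linarith) hK
  have h4 := abs_sub_abs_le_abs_sub (coef A i j p) ((1 : Matrix (Fin (n + 1)) (Fin (n + 1)) ℝ) i j)
  linarith

include hr ht in
theorem abs_drift_le (k : Fin (n + 1)) :
    |drift A k p| ≤ ((n : ℝ) + 1) * (1 + 5 * K) * (‖p.1‖ * p.2⁻¹) := by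
  have hti : 0 < p.2⁻¹ := inv_pos.2 h.time_pos
  have h1 : |∑ l, coef A k l p * p.1 l| ≤ ((n : ℝ) + 1) * ((1 + 5 * K) * ‖p.1‖) :=
    abs_sum_le_card fun l => abs_mul_le_mul (abs_coef_le hA hK h hr ht k l) (abs_coord_le p.1 l)
  have h2 : |(2⁻¹ * p.2⁻¹ : ℝ)| ≤ p.2⁻¹ := by rw [abs_of_pos (by positivity)]; linarith
  exact (abs_mul_le_mul h1 h2).trans (le_of_eq (by ring))

theorem fderiv_drift (l k : Fin (n + 1)) : fderiv ℝ (drift A l) p (dir k, 0)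
    = (∑ m, fderiv ℝ (coef A l m) p (dir k, 0) * p.1 m + coef A l k p) * (2⁻¹ * p.2⁻¹) := by
  have hs : ∀ m, DifferentiableAt ℝ (fun q : Space n × ℝ => coef A l m q * q.1 m) p := fun m =>
    (h.coef l m).fun_mul (differentiableAt_coord m)
  unfold drift
  rw [fd_mul (DifferentiableAt.fun_sum fun m _ => hs m) (h.inv_time.const_mul _),
    fd_const_mul _ h.inv_time, fd_time (hasDerivAt_inv h.time_pos.ne'), fd_sum hs]
  simp only [fd_mul (h.coef l _) (differentiableAt_coord _), fd_coord, Finset.sum_add_distrib]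
  have e : ∑ m, coef A l m p * (dir (n := n) k) m = coef A l k p := by simp [dir]
  rw [e]
  have e2 : ∑ m, p.1 m * fderiv ℝ (coef A l m) p (dir k, 0)
      = ∑ m, fderiv ℝ (coef A l m) p (dir k, 0) * p.1 m :=
    Finset.sum_congr rfl fun m _ => mul_comm _ _
  rw [e2]
  ring

/-- V equals X/(2t) up to (A - I)X/(2t), so its Jacobian is I/(2t) up to O((|X| + t)/t). -/
theorem abs_fderiv_drift_sub_le (l k : Fin (n + 1)) :
    |fderiv ℝ (drift A l) p (dir k, 0)
      - (1 : Matrix (Fin (n + 1)) (Fin (n + 1)) ℝ) l k * (2⁻¹ * p.2⁻¹)|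
      ≤ 2 * ((n : ℝ) + 1) * K * ((‖p.1‖ + p.2) * p.2⁻¹) := by
  have hti : 0 < p.2⁻¹ := inv_pos.2 h.time_pos
  rw [fderiv_drift hA hK h, ← sub_mul, add_sub_assoc]
  have h1 : |∑ m, fderiv ℝ (coef A l m) p (dir k, 0) * p.1 m| ≤ _ :=
    abs_sum_le_card fun m => abs_mul_le_mul (abs_fderiv_coef_space hA hK h l m k)
      (abs_coord_le p.1 m)
  have h2 := hA.abs_coef_sub_one_le l k (p := p) h.time_pos.le
  have h3 : |(2⁻¹ * p.2⁻¹ : ℝ)| ≤ 2⁻¹ * p.2⁻¹ := by rw [abs_of_pos (by positivity)]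
  refine (abs_mul_le_mul ((abs_add_le _ _).trans (add_le_add h1 h2)) h3).trans ?_
  have hn : (0 : ℝ) ≤ n := Nat.cast_nonneg n
  have hT := h.time_pos
  have hR := norm_nonneg p.1
  have : ((n : ℝ) + 1) * (2 * K * ‖p.1‖) + K * (‖p.1‖ + p.2)
      ≤ 4 * ((n : ℝ) + 1) * K * (‖p.1‖ + p.2) := by
    have e1 : 0 ≤ (n : ℝ) * (K * (‖p.1‖ + p.2)) := by positivity
    have e2 : 0 ≤ K * p.2 := by positivity
    have e3 : 0 ≤ (n : ℝ) * (K * p.2) := by positivity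
    have e4 : 0 ≤ K * ‖p.1‖ := by positivity
    nlinarith
  calc _ ≤ (4 * ((n : ℝ) + 1) * K * (‖p.1‖ + p.2)) * (2⁻¹ * p.2⁻¹) :=
        mul_le_mul_of_nonneg_right this (by positivity)
    _ = _ := by ring

/-- What remains of the defect after removing F is the trace of the Jacobian of V - X/(2t). It is
less singular than F by a factor of order t/|X|². -/
theorem abs_defect_sub_le (a : ℝ) : |defect A a p - mainDefect A p|
    ≤ 2 * ((n : ℝ) + 1) ^ 2 * K * ((‖p.1‖ + p.2) * p.2⁻¹) := by
  have e : defect A a p - mainDefect A p = ∑ k, (fderiv ℝ (drift A k) p (dir k, 0)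
      - (1 : Matrix (Fin (n + 1)) (Fin (n + 1)) ℝ) k k * (2⁻¹ * p.2⁻¹)) := by
    rw [h.mainDefect_eq, defect, Finset.sum_sub_distrib]
    have := h.time_pos.ne'
    simp
    field_simp
    ring
  rw [e]
  refine (abs_sum_le_card fun k => abs_fderiv_drift_sub_le hA hK h k k).trans (le_of_eq (by ring))

theorem fderiv_mainDefect (v : Space n × ℝ) : fderiv ℝ (mainDefect A) p v
    = (∑ j, v.1 j * (p.1 j - ∑ l, coef A j l p * p.1 l)
        + ∑ j, p.1 j * (v.1 j - ∑ l, coef A j l p * v.1 l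
          - ∑ l, fderiv ℝ (coef A j l) p v * p.1 l)) * (4⁻¹ * (p.2⁻¹ * p.2⁻¹))
      - (∑ j, p.1 j * (p.1 j - ∑ l, coef A j l p * p.1 l)) * (2⁻¹ * p.2⁻¹ ^ 3) * v.2 := by
  have hs : ∀ j m, DifferentiableAt ℝ (fun q : Space n × ℝ => coef A j m q * q.1 m) p := fun j m =>
    (h.coef j m).fun_mul (differentiableAt_coord m)
  have hss : ∀ j, DifferentiableAt ℝ (fun q : Space n × ℝ => ∑ m, coef A j m q * q.1 m) p :=
    fun j => DifferentiableAt.fun_sum fun m _ => hs j m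
  have hd : ∀ j, DifferentiableAt ℝ
      (fun q : Space n × ℝ => q.1 j - ∑ m, coef A j m q * q.1 m) p := fun j =>
    (differentiableAt_coord j).fun_sub (hss j)
  have hm : ∀ j, DifferentiableAt ℝ
      (fun q : Space n × ℝ => q.1 j * (q.1 j - ∑ m, coef A j m q * q.1 m)) p := fun j =>
    (differentiableAt_coord j).fun_mul (hd j)
  have hinv := hasDerivAt_inv h.time_pos.ne'
  unfold mainDefect
  rw [fd_mul (DifferentiableAt.fun_sum fun j _ => hm j)
      ((h.inv_time.fun_mul h.inv_time).const_mul _),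
    fd_const_mul _ (h.inv_time.fun_mul h.inv_time), fd_mul h.inv_time h.inv_time, fd_time hinv,
    fd_sum hm]
  have e1 : ∀ j, fderiv ℝ (fun q : Space n × ℝ => q.1 j * (q.1 j - ∑ m, coef A j m q * q.1 m)) p v
      = v.1 j * (p.1 j - ∑ l, coef A j l p * p.1 l) + p.1 j * (v.1 j - ∑ l, coef A j l p * v.1 l
          - ∑ l, fderiv ℝ (coef A j l) p v * p.1 l) := by
    intro j
    rw [fd_mul (differentiableAt_coord j) (hd j), fd_sub (differentiableAt_coord j) (hss j),
      fd_sum (hs j), fd_coord]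
    simp only [fd_mul (h.coef j _) (differentiableAt_coord _), fd_coord, Finset.sum_add_distrib]
    have e2 : ∑ m, p.1 m * fderiv ℝ (coef A j m) p v = ∑ m, fderiv ℝ (coef A j m) p v * p.1 m :=
      Finset.sum_congr rfl fun m _ => mul_comm _ _
    rw [e2]
    ring
  simp only [e1, Finset.sum_add_distrib]
  have := h.time_pos.ne'
  field_simp
  ring

theorem abs_fderiv_mainDefect_space_le (k : Fin (n + 1)) :
    |fderiv ℝ (mainDefect A) p (dir k, 0)|
      ≤ ((n : ℝ) + 1) ^ 2 * K * ((‖p.1‖ + p.2) * (‖p.1‖ * p.2⁻¹ ^ 2)) := by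
  have hti : 0 < p.2⁻¹ := inv_pos.2 h.time_pos
  have hT := h.time_pos
  have hR := norm_nonneg p.1
  have hn : (0 : ℝ) ≤ n := Nat.cast_nonneg n
  rw [fderiv_mainDefect hA hK h]
  have e1 : ∑ j, (dir (n := n) k) j * (p.1 j - ∑ l, coef A j l p * p.1 l)
      = p.1 k - ∑ l, coef A k l p * p.1 l := by simp [dir]
  have e2 : ∀ j, ∑ l, coef A j l p * (dir (n := n) k) l = coef A j k p := by
    intro j; simp [dir]
  simp only [mul_zero, sub_zero, e1, e2]
  have b1 := abs_residual_le hA h.time_pos k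
  have b2 : ∀ j, |(dir (n := n) k) j - coef A j k p
      - ∑ l, fderiv ℝ (coef A j l) p (dir k, 0) * p.1 l|
      ≤ 3 * ((n : ℝ) + 1) * K * (‖p.1‖ + p.2) := by
    intro j
    have c1 : |(dir (n := n) k) j - coef A j k p| ≤ K * (‖p.1‖ + p.2) := by
      have := hA.abs_coef_sub_one_le j k (p := p) h.time_pos.le
      rw [abs_sub_comm] at this
      have e : (dir (n := n) k) j = (1 : Matrix (Fin (n + 1)) (Fin (n + 1)) ℝ) j k := by
        simp [dir, Matrix.one_apply]
      rwa [e]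
    have c2 : |∑ l, fderiv ℝ (coef A j l) p (dir k, 0) * p.1 l| ≤ _ :=
      abs_sum_le_card fun m => abs_mul_le_mul (abs_fderiv_coef_space hA hK h j m k)
        (abs_coord_le p.1 m)
    refine (abs_sub _ _).trans ((add_le_add c1 c2).trans ?_)
    have e1 : 0 ≤ (n : ℝ) * (K * (‖p.1‖ + p.2)) := by positivity
    have e2 : 0 ≤ K * p.2 := by positivity
    have e3 : 0 ≤ (n : ℝ) * (K * p.2) := by positivity
    nlinarith
  have b3 : |∑ j, p.1 j * ((dir (n := n) k) j - coef A j k p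
      - ∑ l, fderiv ℝ (coef A j l) p (dir k, 0) * p.1 l)| ≤ _ :=
    abs_sum_le_card fun j => abs_mul_le_mul (abs_coord_le p.1 j) (b2 j)
  have b4 : |(4⁻¹ * (p.2⁻¹ * p.2⁻¹) : ℝ)| ≤ 4⁻¹ * (p.2⁻¹ * p.2⁻¹) := by
    rw [abs_of_pos (by positivity)]
  refine (abs_mul_le_mul ((abs_add_le _ _).trans (add_le_add b1 b3)) b4).trans ?_
  have e : ((n : ℝ) + 1) * K * ((‖p.1‖ + p.2) * ‖p.1‖)
      ≤ ((n : ℝ) + 1) ^ 2 * K * ((‖p.1‖ + p.2) * ‖p.1‖) := by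
    have : ((n : ℝ) + 1) ≤ ((n : ℝ) + 1) ^ 2 := by nlinarith
    gcongr
  calc _ ≤ (((n : ℝ) + 1) ^ 2 * K * ((‖p.1‖ + p.2) * ‖p.1‖) + ((n : ℝ) + 1)
        * (‖p.1‖ * (3 * ((n : ℝ) + 1) * K * (‖p.1‖ + p.2)))) * (4⁻¹ * (p.2⁻¹ * p.2⁻¹)) :=
        mul_le_mul_of_nonneg_right (by linarith) (by positivity)
    _ = _ := by ring

theorem abs_fderiv_mainDefect_time_le : |fderiv ℝ (mainDefect A) p (0, 1)|
    ≤ ((n : ℝ) + 1) ^ 2 * K * ((‖p.1‖ + p.2) * (‖p.1‖ ^ 2 * p.2⁻¹ ^ 3)) := by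
  have hti : 0 < p.2⁻¹ := inv_pos.2 h.time_pos
  have hT := h.time_pos
  have hR := norm_nonneg p.1
  have hn : (0 : ℝ) ≤ n := Nat.cast_nonneg n
  rw [fderiv_mainDefect hA hK h]
  simp only [PiLp.zero_apply, zero_mul, Finset.sum_const_zero, mul_zero, sub_zero, zero_sub,
    zero_add, mul_one]
  have b0 : ∀ j, |-∑ l, fderiv ℝ (coef A j l) p (0, 1) * p.1 l| ≤ ((n : ℝ) + 1) * (2 * K * ‖p.1‖) := by
    intro j
    rw [abs_neg]
    exact abs_sum_le_card fun m => abs_mul_le_mul (abs_fderiv_coef_time hA hK h j m)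
        (abs_coord_le p.1 m)
  have b1 : |∑ j, p.1 j * -∑ l, fderiv ℝ (coef A j l) p (0, 1) * p.1 l| ≤ _ :=
    abs_sum_le_card fun j => abs_mul_le_mul (abs_coord_le p.1 j) (b0 j)
  have b2 : |∑ k, p.1 k * (p.1 k - ∑ l, coef A k l p * p.1 l)| ≤ _ :=
    abs_sum_le_card fun k => abs_mul_le_mul (abs_coord_le p.1 k) (abs_residual_le hA h.time_pos k)
  have b4 : |(4⁻¹ * (p.2⁻¹ * p.2⁻¹) : ℝ)| ≤ 4⁻¹ * (p.2⁻¹ * p.2⁻¹) := by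
    rw [abs_of_pos (by positivity)]
  have b5 : |(2⁻¹ * p.2⁻¹ ^ 3 : ℝ)| ≤ 2⁻¹ * p.2⁻¹ ^ 3 := by
    rw [abs_of_pos (by positivity)]
  refine (abs_sub _ _).trans ((add_le_add (abs_mul_le_mul b1 b4) (abs_mul_le_mul b2 b5)).trans ?_)
  have e : p.2⁻¹ * p.2⁻¹ = p.2 * p.2⁻¹ ^ 3 := by field_simp
  rw [e]
  have : 0 ≤ ((n : ℝ) + 1) ^ 2 * K * (‖p.1‖ * (‖p.1‖ ^ 2 * p.2⁻¹ ^ 3)) := by positivity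
  have : 0 ≤ ((n : ℝ) + 1) ^ 2 * K * (p.2 * (‖p.1‖ ^ 2 * p.2⁻¹ ^ 3)) := by positivity
  nlinarith

include hr ht in
theorem abs_transport_mainDefect_le : |transport A (mainDefect A) p|
    ≤ (((n : ℝ) + 1) ^ 2 * K + ((n : ℝ) + 1) ^ 4 * (1 + 5 * K) * K)
      * ((‖p.1‖ + p.2) * (‖p.1‖ ^ 2 * p.2⁻¹ ^ 3)) := by
  have b1 := abs_fderiv_mainDefect_time_le hA hK h
  have b2 : |∑ k, drift A k p * fderiv ℝ (mainDefect A) p (dir k, 0)| ≤ _ :=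
    abs_sum_le_card fun k => abs_mul_le_mul (abs_drift_le hA hK h hr ht k)
      (abs_fderiv_mainDefect_space_le hA hK h k)
  exact (abs_add_le _ _).trans ((add_le_add b1 b2).trans (le_of_eq (by ring)))

include hr ht in
theorem abs_transport_coef_le (i j : Fin (n + 1)) : |transport A (coef A i j) p|
    ≤ (2 * K + 2 * ((n : ℝ) + 1) ^ 2 * (1 + 5 * K) * K) * ((‖p.1‖ + p.2) * p.2⁻¹) := by
  have hti : 0 < p.2⁻¹ := inv_pos.2 h.time_pos
  have hT := h.time_pos
  have hR := norm_nonneg p.1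
  have hn : (0 : ℝ) ≤ n := Nat.cast_nonneg n
  have b1 := abs_fderiv_coef_time hA hK h i j
  have b2 : |∑ k, drift A k p * fderiv ℝ (coef A i j) p (dir k, 0)| ≤ _ :=
    abs_sum_le_card fun k => abs_mul_le_mul (abs_drift_le hA hK h hr ht k)
      (abs_fderiv_coef_space hA hK h i j k)
  refine (abs_add_le _ _).trans ((add_le_add b1 b2).trans ?_)
  have e : p.2 * p.2⁻¹ = 1 := mul_inv_cancel₀ hT.ne'
  have e1 : 0 ≤ K * (‖p.1‖ * p.2⁻¹) := by positivity
  have e2 : 0 ≤ ((n : ℝ) + 1) ^ 2 * (1 + 5 * K) * K := by positivity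
  rw [add_mul ‖p.1‖, e]
  nlinarith

end bounds
end Carleman

/-! ### The bound for the commutator. -/

namespace Carleman

variable {n : ℕ} {Λ K : ℝ} {w : Space n × ℝ → ℝ}
  {A : EuclideanSpace ℝ (Fin n) → ℝ → Matrix (Fin (n + 1)) (Fin (n + 1)) ℝ} {p : Space n × ℝ}

/-- The squared length of the spatial gradient. -/
noncomputable def gradS (w : Space n × ℝ → ℝ) (p : Space n × ℝ) : ℝ := ∑ i, dX w i p ^ 2

theorem gradS_nonneg : 0 ≤ gradS w p := Finset.sum_nonneg fun _ _ => sq_nonneg _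

/-- The size of the quantities that enter the error terms. -/
noncomputable def errSize (α : ℝ) (w : Space n × ℝ → ℝ) (p : Space n × ℝ) : ℝ :=
  α * (w p ^ 2 * p.2⁻¹) + ‖p.1‖ ^ 2 * p.2⁻¹ ^ 2 * w p ^ 2 + gradS w p

theorem sq_sum_abs_le : (∑ i, |dX w i p|) ^ 2 ≤ ((n : ℝ) + 1) * gradS w p := by
  have := sq_sum_le_card_mul_sum_sq (s := Finset.univ) (f := fun i => |dX w i p|)
  simpa [gradS] using this

theorem abs_sum_mul_le {f g : Fin (n + 1) → ℝ} {C : ℝ} (h : ∀ i, |f i| ≤ C) :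
    |∑ i, f i * g i| ≤ C * ∑ i, |g i| := by
  refine (Finset.abs_sum_le_sum_abs _ _).trans ?_
  rw [Finset.mul_sum]
  refine Finset.sum_le_sum fun i _ => ?_
  rw [abs_mul]
  exact mul_le_mul_of_nonneg_right (h i) (abs_nonneg _)

/-- The constant in the bound for the commutator. -/
noncomputable def commConst (n : ℕ) (K C₀ C₁ : ℝ) : ℝ :=
  (2 * ((n : ℝ) + 1) ^ 2 * K + C₁ * (((n : ℝ) + 1) ^ 2 * K)
        + C₀ * (((n : ℝ) + 1) ^ 2 * K + ((n : ℝ) + 1) ^ 4 * (1 + 5 * K) * K)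
        + C₀ * (10 * ((n : ℝ) + 1) ^ 4 * K ^ 2)
        + C₀ * ((2 * K + 2 * ((n : ℝ) + 1) ^ 2 * (1 + 5 * K) * K) * ((n : ℝ) + 1))
        + C₀ * (2 * ((n : ℝ) + 1) ^ 3 * K * (1 + 5 * K))
        + C₀ * (((n : ℝ) + 1) ^ 3 * K * (1 + 5 * K) * (((n : ℝ) + 1) + 1))
        + C₀ * (4 * ((n : ℝ) + 1) ^ 3 * K * (1 + 5 * K)))

theorem commConst_nonneg {C₀ C₁ : ℝ} (hK : 0 ≤ K) (hC₀ : 0 ≤ C₀) (hC₁ : 0 ≤ C₁) :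
    0 ≤ commConst n K C₀ C₁ := by
  unfold commConst
  positivity

section bounds
variable (hA : IsAdmissible n Λ K A) (hK : 0 ≤ K) (h : RegularAt A w p) (hr : ‖p.1‖ ≤ 4)
  (ht : p.2 ≤ 1)
include hA hK h hr ht

theorem abs_flux_le (k : Fin (n + 1)) : |flux A w k p| ≤ (1 + 5 * K) * ∑ i, |dX w i p| :=
  abs_sum_mul_le fun j => abs_coef_le hA hK h hr ht k j

theorem abs_energy_le : |energy A w p| ≤ (1 + 5 * K) * ((n : ℝ) + 1) * gradS w p := by
  have h1 : |energy A w p| ≤ ((1 + 5 * K) * ∑ i, |dX w i p|) * ∑ i, |dX w i p| :=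
    abs_sum_mul_le fun j => abs_flux_le hA hK h hr ht j
  have h2 := sq_sum_abs_le (w := w) (p := p)
  have h3 : (0 : ℝ) ≤ 1 + 5 * K := by positivity
  calc _ ≤ (1 + 5 * K) * (∑ i, |dX w i p|) ^ 2 := h1.trans (le_of_eq (by ring))
    _ ≤ (1 + 5 * K) * (((n : ℝ) + 1) * gradS w p) := mul_le_mul_of_nonneg_left h2 h3
    _ = _ := by ring

-- Only two terms are not small: -η' times the energy, and the last term, in which the part I/(2t)
-- of the Jacobian of V contributes +(η/t) times the energy. The eight others are each bounded by
-- (|X| + t)M, using η ≤ C₀t to pay for one power of 1/t. The bounds `T1` to `T8` are the summands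
-- of `commConst` in order.
set_option maxHeartbeats 2000000 in
theorem commutator_le {α a C₀ C₁ η' : ℝ} {η : ℝ → ℝ} (hα : 0 ≤ α) (hC₁ : 0 ≤ C₁) (hη0 : 0 ≤ η p.2)
    (hη : η p.2 ≤ C₀ * p.2) (hη' : |η'| ≤ C₁) :
    commutator A w α η a η' p ≤ -(η' - η p.2 * p.2⁻¹) * energy A w p
      + commConst n K C₀ C₁ * ((‖p.1‖ + p.2) * errSize α w p) := by
  unfold commConst
  have hT := h.time_pos
  have hti : 0 < p.2⁻¹ := inv_pos.2 hT
  have hR := norm_nonneg p.1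
  have hn : (0 : ℝ) < (n : ℝ) + 1 := by positivity
  have hS := sq_sum_abs_le (w := w) (p := p)
  have hfl := abs_flux_le hA hK h hr ht
  have hE := abs_energy_le hA hK h hr ht
  have hF1 := abs_mainDefect_le hA h.time_pos
  have hF2 := abs_defect_sub_le hA hK h a
  have hZF := abs_transport_mainDefect_le hA hK h hr ht
  have hg := gradS_nonneg (w := w) (p := p)
  set N : ℝ := (n : ℝ) + 1 with hN
  set r := ‖p.1‖ with hrdef
  set t := p.2 with htdef
  set s := t⁻¹ with hs
  have hts : t * s = 1 := mul_inv_cancel₀ hT.ne'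
  set d := r + t with hd
  have hd0 : 0 < d := by positivity
  have hd5 : d ≤ 5 := by linarith
  set S1 := ∑ i, |dX w i p| with hS1
  have hS10 : 0 ≤ S1 := Finset.sum_nonneg fun _ _ => abs_nonneg _
  set L := 1 + 5 * K with hL
  have hL0 : 0 < L := by positivity
  have hηs : η t * s ≤ C₀ := by
    calc η t * s ≤ C₀ * t * s := mul_le_mul_of_nonneg_right hη hti.le
      _ = C₀ := by rw [mul_assoc, hts, mul_one]
  have hηs0 : 0 ≤ η t * s := by positivity
  have hC₀ : 0 ≤ C₀ := hηs0.trans hηs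
  have hηC : η t ≤ C₀ := by nlinarith
  set M := errSize α w p with hM
  have hMdef : M = α * (w p ^ 2 * s) + r ^ 2 * s ^ 2 * w p ^ 2 + gradS w p := rfl
  have hP1 : 0 ≤ α * (w p ^ 2 * s) := by positivity
  have hP2 : 0 ≤ r ^ 2 * s ^ 2 * w p ^ 2 := by positivity
  have hM1 : α * (w p ^ 2 * s) ≤ M := by rw [hMdef]; linarith
  have hM2 : r ^ 2 * s ^ 2 * w p ^ 2 ≤ M := by rw [hMdef]; linarith
  have hM3 : gradS w p ≤ M := by rw [hMdef]; linarith
  have hM0 : 0 ≤ M := hg.trans hM3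
  have hSM : S1 ^ 2 ≤ N * M := hS.trans (mul_le_mul_of_nonneg_left hM3 hn.le)
  have T1 : |α * (defect A a p - mainDefect A p) * w p ^ 2| ≤ 2 * N ^ 2 * K * (d * M) := by
    rw [abs_mul, abs_mul, abs_of_nonneg hα, abs_of_nonneg (sq_nonneg (w p))]
    calc _ ≤ α * (2 * N ^ 2 * K * (d * s)) * w p ^ 2 := by gcongr
      _ = 2 * N ^ 2 * K * d * (α * (w p ^ 2 * s)) := by ring
      _ ≤ 2 * N ^ 2 * K * d * M := by gcongr
      _ = _ := by ring
  have T2 : |2⁻¹ * (η' * mainDefect A p) * w p ^ 2| ≤ C₁ * (N ^ 2 * K) * (d * M) := by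
    rw [abs_mul, abs_mul, abs_mul, abs_of_nonneg (sq_nonneg (w p)), abs_of_pos (by norm_num : (0 : ℝ) < 2⁻¹)]
    calc _ ≤ 2⁻¹ * (C₁ * (N ^ 2 * K * (d * (r ^ 2 * s ^ 2)))) * w p ^ 2 := by gcongr
      _ = 2⁻¹ * (C₁ * (N ^ 2 * K) * d * (r ^ 2 * s ^ 2 * w p ^ 2)) := by ring
      _ ≤ 1 * (C₁ * (N ^ 2 * K) * d * M) := by gcongr; norm_num
      _ = _ := by ring
  have T3 : |2⁻¹ * (η t * transport A (mainDefect A) p) * w p ^ 2|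
      ≤ C₀ * (N ^ 2 * K + N ^ 4 * L * K) * (d * M) := by
    rw [abs_mul, abs_mul, abs_mul, abs_of_nonneg (sq_nonneg (w p)), abs_of_nonneg hη0,
      abs_of_pos (by norm_num : (0 : ℝ) < 2⁻¹)]
    calc _ ≤ 2⁻¹ * (η t * ((N ^ 2 * K + N ^ 4 * L * K) * (d * (r ^ 2 * s ^ 3)))) * w p ^ 2 := by
          gcongr
      _ = 2⁻¹ * ((η t * s) * (N ^ 2 * K + N ^ 4 * L * K) * d * (r ^ 2 * s ^ 2 * w p ^ 2)) := by ring
      _ ≤ 1 * (C₀ * (N ^ 2 * K + N ^ 4 * L * K) * d * M) := by gcongr; norm_num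
      _ = _ := by ring
  have T4 : |2⁻¹ * (η t * mainDefect A p * (defect A a p - mainDefect A p)) * w p ^ 2|
      ≤ C₀ * (10 * N ^ 4 * K ^ 2) * (d * M) := by
    rw [abs_mul, abs_mul, abs_mul, abs_mul, abs_of_nonneg (sq_nonneg (w p)), abs_of_nonneg hη0,
      abs_of_pos (by norm_num : (0 : ℝ) < 2⁻¹)]
    calc _ ≤ 2⁻¹ * (η t * (N ^ 2 * K * (d * (r ^ 2 * s ^ 2))) * (2 * N ^ 2 * K * (d * s))) * w p ^ 2 := by
          gcongr
      _ = (η t * s) * N ^ 4 * K ^ 2 * d * d * (r ^ 2 * s ^ 2 * w p ^ 2) := by ring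
      _ ≤ C₀ * N ^ 4 * K ^ 2 * 10 * d * M := by gcongr; linarith
      _ = _ := by ring
  have T5 : |η t * ∑ i, ∑ j, transport A (coef A i j) p * dX w i p * dX w j p|
      ≤ C₀ * ((2 * K + 2 * N ^ 2 * L * K) * N) * (d * M) := by
    have hin : ∀ i, |∑ j, transport A (coef A i j) p * dX w j p|
        ≤ (2 * K + 2 * N ^ 2 * L * K) * (d * s) * S1 := fun i =>
      abs_sum_mul_le fun j => abs_transport_coef_le hA hK h hr ht i j
    have hout : |∑ i, (∑ j, transport A (coef A i j) p * dX w j p) * dX w i p|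
        ≤ (2 * K + 2 * N ^ 2 * L * K) * (d * s) * S1 * S1 := abs_sum_mul_le hin
    have e : ∑ i, ∑ j, transport A (coef A i j) p * dX w i p * dX w j p
        = ∑ i, (∑ j, transport A (coef A i j) p * dX w j p) * dX w i p := by
      refine Finset.sum_congr rfl fun i _ => ?_
      rw [Finset.sum_mul]
      exact Finset.sum_congr rfl fun j _ => by ring
    rw [e, abs_mul, abs_of_nonneg hη0]
    calc _ ≤ η t * ((2 * K + 2 * N ^ 2 * L * K) * (d * s) * S1 * S1) := by gcongr
      _ = (η t * s) * (2 * K + 2 * N ^ 2 * L * K) * d * S1 ^ 2 := by ring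
      _ ≤ C₀ * (2 * K + 2 * N ^ 2 * L * K) * d * (N * M) := by gcongr
      _ = _ := by ring
  have T6 : |η t * (defect A a p - mainDefect A p) * energy A w p|
      ≤ C₀ * (2 * N ^ 3 * K * L) * (d * M) := by
    rw [abs_mul, abs_mul, abs_of_nonneg hη0]
    calc _ ≤ η t * (2 * N ^ 2 * K * (d * s)) * (L * N * M) := by
          gcongr
          exact hE.trans (mul_le_mul_of_nonneg_left hM3 (by positivity))
      _ = (η t * s) * (2 * N ^ 3 * K * L) * d * M := by ring
      _ ≤ C₀ * (2 * N ^ 3 * K * L) * d * M := by gcongr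
      _ = _ := by ring
  have T7 : |η t * w p * ∑ k, flux A w k p * fderiv ℝ (mainDefect A) p (dir k, 0)|
      ≤ C₀ * (N ^ 3 * K * L * (N + 1)) * (d * M) := by
    have hsum : |∑ k, flux A w k p * fderiv ℝ (mainDefect A) p (dir k, 0)| ≤ _ :=
      abs_sum_le_card fun k => abs_mul_le_mul (hfl k) (abs_fderiv_mainDefect_space_le hA hK h k)
    rw [abs_mul, abs_mul, abs_of_nonneg hη0]
    -- The cross term between w and ∇w is split by Young's inequality into the second and third
    -- parts of M.
    have hyoung : (r * s * |w p|) * S1 ≤ (N + 1) * M := by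
      have : (r * s * |w p|) ^ 2 = r ^ 2 * s ^ 2 * w p ^ 2 := by rw [mul_pow, mul_pow, sq_abs]
      have h2 := sq_nonneg (r * s * |w p| - S1)
      nlinarith
    calc _ ≤ η t * |w p| * (N * (L * S1 * (N ^ 2 * K * (d * (r * s ^ 2))))) := by gcongr
      _ = (η t * s) * (N ^ 3 * K * L) * d * (r * s * |w p| * S1) := by ring
      _ ≤ C₀ * (N ^ 3 * K * L) * d * ((N + 1) * M) := by gcongr
      _ = _ := by ring
  have T8 : |2 * η t * ∑ k, flux A w k p * ∑ l, (fderiv ℝ (drift A l) p (dir k, 0)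
        - (1 : Matrix (Fin (n + 1)) (Fin (n + 1)) ℝ) l k * (2⁻¹ * s)) * dX w l p|
      ≤ C₀ * (4 * N ^ 3 * K * L) * (d * M) := by
    have hin : ∀ k, |∑ l, (fderiv ℝ (drift A l) p (dir k, 0)
        - (1 : Matrix (Fin (n + 1)) (Fin (n + 1)) ℝ) l k * (2⁻¹ * s)) * dX w l p|
        ≤ 2 * N * K * (d * s) * S1 := fun k =>
      abs_sum_mul_le fun l => abs_fderiv_drift_sub_le hA hK h l k
    have hsum : |∑ k, flux A w k p * ∑ l, (fderiv ℝ (drift A l) p (dir k, 0)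
        - (1 : Matrix (Fin (n + 1)) (Fin (n + 1)) ℝ) l k * (2⁻¹ * s)) * dX w l p| ≤ _ :=
      abs_sum_le_card fun k => abs_mul_le_mul (hfl k) (hin k)
    rw [abs_mul, abs_mul, abs_of_nonneg hη0, abs_two]
    calc _ ≤ 2 * η t * (N * (L * S1 * (2 * N * K * (d * s) * S1))) := by gcongr
      _ = (η t * s) * (4 * N ^ 2 * K * L) * d * S1 ^ 2 := by ring
      _ ≤ C₀ * (4 * N ^ 2 * K * L) * d * (N * M) := by gcongr
      _ = _ := by ring
  have e8 : ∑ k, flux A w k p * ∑ l, fderiv ℝ (drift A l) p (dir k, 0) * dX w l p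
      = ∑ k, flux A w k p * ∑ l, (fderiv ℝ (drift A l) p (dir k, 0)
        - (1 : Matrix (Fin (n + 1)) (Fin (n + 1)) ℝ) l k * (2⁻¹ * s)) * dX w l p
        + 2⁻¹ * s * energy A w p := by
    rw [energy, Finset.mul_sum, ← Finset.sum_add_distrib]
    refine Finset.sum_congr rfl fun k _ => ?_
    have : ∑ l, (1 : Matrix (Fin (n + 1)) (Fin (n + 1)) ℝ) l k * (2⁻¹ * s) * dX w l p
        = 2⁻¹ * s * dX w k p := by
      simp [Matrix.one_apply]
    simp only [sub_mul, Finset.sum_sub_distrib, this]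
    ring
  rw [commutator, e8]
  have := (abs_le.1 T1).2
  have := (abs_le.1 T2).1
  have := (abs_le.1 T3).1
  have := (abs_le.1 T4).1
  have := (abs_le.1 T5).1
  have := (abs_le.1 T6).1
  have := (abs_le.1 T7).2
  have := (abs_le.1 T8).2
  simp only [← htdef]
  linarith

end bounds
end Carleman

/-! ### The interior inequality: combining Carleman, Caccioppoli and Euler. -/

namespace Carleman

/-- An upper bound for `σ / (t σ')`. -/
noncomputable def etaConst : ℝ := Real.exp (4 * 6 ^ (3 / 2 : ℝ))

/-- An upper bound for `θ` on `(0, 1)`. -/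
noncomputable def thConst : ℝ := 6 ^ (3 / 2 : ℝ)

theorem one_le_etaConst : 1 ≤ etaConst := Real.one_le_exp (by positivity)

theorem thConst_pos : 0 < thConst := Real.rpow_pos_of_pos (by norm_num) _

/-- The bounds for the weights at time `t`. -/
structure WeightBounds (lam : ℝ) (σ : ℝ → ℝ) (t : ℝ) : Prop where
  time_pos : 0 < t
  time_le_one : t ≤ 1
  mul_le_th : lam * t ≤ th lam t
  th_le : th lam t ≤ thConst
  th_nonneg : 0 ≤ th lam t
  le_eta : t ≤ eta σ t
  eta_le : eta σ t ≤ etaConst * t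
  th'_le : th' lam t ≤ th lam t * t⁻¹

theorem weightBounds {lam t : ℝ} {σ : ℝ → ℝ} (hlam : 1 ≤ lam) (hσ : IsCarlemanWeight lam σ)
    (ht : 0 < t) (ht' : t ≤ 1 / (3 * lam)) : WeightBounds lam σ t := by
  have hl : 0 < lam := by linarith
  have h3 : lam * t ≤ 1 / 3 := by
    rw [le_div_iff₀ (by positivity)] at ht'
    linarith
  have h0 : 0 < lam * t := by positivity
  have hmem : t ∈ Ioo 0 (1 / lam) := ⟨ht, by rw [lt_div_iff₀ hl]; linarith⟩
  refine ⟨ht, by nlinarith, le_theta h0 h3, ?_, theta_nonneg h0 (by linarith),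
    (eta_bounds hl hσ hmem).1, (eta_bounds hl hσ hmem).2, ?_⟩
  · refine (theta_le h0 (by linarith)).trans ?_
    have : (lam * t) ^ (1 / 4 : ℝ) ≤ 1 := Real.rpow_le_one h0.le (by linarith) (by norm_num)
    calc _ ≤ (6 : ℝ) ^ (3 / 2 : ℝ) * 1 := by gcongr
      _ = _ := mul_one _
  · have h := theta'_le h0 (by linarith)
    calc th' lam t ≤ lam * (theta (lam * t) / (lam * t)) := mul_le_mul_of_nonneg_left h hl.le
      _ = _ := by rw [th]; field_simp

variable {n : ℕ} {a Λ K lam α : ℝ} {σ : ℝ → ℝ} {w : Space n × ℝ → ℝ}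
  {A : EuclideanSpace ℝ (Fin n) → ℝ → Matrix (Fin (n + 1)) (Fin (n + 1)) ℝ} {p : Space n × ℝ}

theorem le_energy (hA : IsAdmissible n Λ K A) : Λ⁻¹ * gradS w p ≤ energy A w p := by
  have := hA.lower (horiz p.1) p.2 fun i => dX w i p
  calc _ = _ := by simp only [gradS, dotProduct, sq]
    _ ≤ _ := this
    _ = _ := by
      simp only [dotProduct, Matrix.mulVec, energy, flux, coef]
      exact Finset.sum_congr rfl fun i _ => mul_comm _ _

/-- Young's inequality gives 2wX·∇w ≤ |X|²w²/(4t) + 4t|∇w|², which uses up half of the good term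
-|X|²w²/(2t). -/
theorem eulerDensity_le (ha : a < 1) (ht : 0 < p.2) : eulerDensity a w p
    ≤ ((n : ℝ) + 2) * w p ^ 2 + 4 * (p.2 * gradS w p) - 4⁻¹ * (‖p.1‖ ^ 2 * p.2⁻¹ * w p ^ 2) := by
  have hg := gradS_nonneg (w := w) (p := p)
  have hti : 0 < p.2⁻¹ := inv_pos.2 ht
  have hcs : (∑ i, p.1 i * dX w i p) ^ 2 ≤ ‖p.1‖ ^ 2 * gradS w p := by
    have := Finset.sum_mul_sq_le_sq_mul_sq Finset.univ (fun i => p.1 i) fun i => dX w i p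
    rw [EuclideanSpace.norm_sq_eq]
    simpa [gradS] using this
  set S := ∑ i, p.1 i * dX w i p with hS
  have hy : 2 * w p * S ≤ 4⁻¹ * (‖p.1‖ ^ 2 * p.2⁻¹ * w p ^ 2) + 4 * (p.2 * gradS w p) := by
    have hb : |S| ≤ ‖p.1‖ * √(gradS w p) := by
      refine abs_le_of_sq_le_sq ?_ (by positivity)
      rwa [mul_pow, Real.sq_sqrt hg]
    have h1 : 2 * w p * S ≤ 2 * |w p| * (‖p.1‖ * √(gradS w p)) := by
      calc 2 * w p * S ≤ |2 * w p * S| := le_abs_self _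
        _ = 2 * |w p| * |S| := by rw [abs_mul, abs_mul, abs_two]
        _ ≤ _ := by gcongr
    have h2 : 0 ≤ p.2 * (2⁻¹ * (p.2⁻¹ * |w p| * ‖p.1‖) - 2 * √(gradS w p)) ^ 2 := by positivity
    have h3 : p.2 * (2⁻¹ * (p.2⁻¹ * |w p| * ‖p.1‖) - 2 * √(gradS w p)) ^ 2
        = 4⁻¹ * (‖p.1‖ ^ 2 * p.2⁻¹ * |w p| ^ 2) + 4 * (p.2 * √(gradS w p) ^ 2)
          - 2 * |w p| * (‖p.1‖ * √(gradS w p)) := by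
      field_simp
      ring
    rw [Real.sq_sqrt hg, sq_abs] at h3
    linarith
  have e : ‖p.1‖ ^ 2 / (2 * p.2) * w p ^ 2 = 2⁻¹ * (‖p.1‖ ^ 2 * p.2⁻¹ * w p ^ 2) := by
    field_simp
  rw [eulerDensity, e]
  have hw := sq_nonneg (w p)
  nlinarith

section pointwise
variable (hA : IsAdmissible n Λ K A) (hK : 0 ≤ K) (h : RegularAt A w p) (hr : ‖p.1‖ ≤ 4)
  (W : WeightBounds lam σ p.2)
include hA hK h hr W

/-- Since η ≤ `etaConst`·t, the good term is at most -θαw²/(`etaConst`·t). A quarter of it pays for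
θ' ≤ θ/t, which needs α ≥ 2`etaConst`, and a quarter for the product wH; half remains. -/
theorem caccioppoli_integrand_le (hα : 2 * etaConst ≤ α) :
    2⁻¹ * th' lam p.2 * w p ^ 2 - α * th lam p.2 / eta σ p.2 * w p ^ 2
        + 2⁻¹ * defect A a p * th lam p.2 * w p ^ 2 + th lam p.2 * energy A w p
        + th lam p.2 * w p * heatOp A w a p
      ≤ -(2 * etaConst)⁻¹ * (th lam p.2 * (α * (w p ^ 2 * p.2⁻¹)))
        + (1 + 5 * K) * ((n : ℝ) + 1) * (th lam p.2 * gradS w p)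
        + etaConst * thConst * (eta σ p.2 * heatOp A w a p ^ 2)
        + 2 * thConst * (((n : ℝ) + 1) ^ 2 * K) * ((‖p.1‖ + p.2) * errSize α w p) := by
  have hT := W.time_pos
  have hti : 0 < p.2⁻¹ := inv_pos.2 hT
  have hC := one_le_etaConst
  have hC0 : 0 < etaConst := by linarith
  have hα0 : 0 < α := by linarith
  have hθ := W.th_nonneg
  have hη : 0 < eta σ p.2 := hT.trans_le W.le_eta
  have hw := sq_nonneg (w p)
  have hg := gradS_nonneg (w := w) (p := p)
  have t1 : 2⁻¹ * th' lam p.2 * w p ^ 2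
      ≤ 4⁻¹ * etaConst⁻¹ * (th lam p.2 * (α * (w p ^ 2 * p.2⁻¹))) := by
    have : 1 ≤ 2⁻¹ * etaConst⁻¹ * α := by
      rw [← mul_inv, ← div_eq_inv_mul, le_div_iff₀ (by positivity)]; linarith
    calc 2⁻¹ * th' lam p.2 * w p ^ 2 ≤ 2⁻¹ * (th lam p.2 * p.2⁻¹) * w p ^ 2 := by
          gcongr; exact W.th'_le
      _ = 2⁻¹ * 1 * (th lam p.2 * (w p ^ 2 * p.2⁻¹)) := by ring
      _ ≤ 2⁻¹ * (2⁻¹ * etaConst⁻¹ * α) * (th lam p.2 * (w p ^ 2 * p.2⁻¹)) := by gcongr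
      _ = _ := by ring
  have t2 : etaConst⁻¹ * (th lam p.2 * (α * (w p ^ 2 * p.2⁻¹)))
      ≤ α * th lam p.2 / eta σ p.2 * w p ^ 2 := by
    have : etaConst⁻¹ * p.2⁻¹ ≤ (eta σ p.2)⁻¹ := by
      rw [← mul_inv]
      exact inv_anti₀ hη W.eta_le
    calc _ = α * th lam p.2 * (etaConst⁻¹ * p.2⁻¹) * w p ^ 2 := by ring
      _ ≤ α * th lam p.2 * (eta σ p.2)⁻¹ * w p ^ 2 := by gcongr
      _ = _ := by rw [div_eq_mul_inv]
  have t3 : 2⁻¹ * defect A a p * th lam p.2 * w p ^ 2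
      ≤ 2 * thConst * (((n : ℝ) + 1) ^ 2 * K) * ((‖p.1‖ + p.2) * errSize α w p) := by
    have b1 := abs_mainDefect_le hA h.time_pos
    have b2 := abs_defect_sub_le hA hK h a
    have hR := norm_nonneg p.1
    have hd : defect A a p ≤ ((n : ℝ) + 1) ^ 2 * K * ((‖p.1‖ + p.2) * (‖p.1‖ ^ 2 * p.2⁻¹ ^ 2))
        + 2 * ((n : ℝ) + 1) ^ 2 * K * ((‖p.1‖ + p.2) * p.2⁻¹) := by
      linarith [le_abs_self (mainDefect A p), le_abs_self (defect A a p - mainDefect A p)]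
    have hM1 : w p ^ 2 * p.2⁻¹ ≤ errSize α w p := by
      have : 1 * (w p ^ 2 * p.2⁻¹) ≤ α * (w p ^ 2 * p.2⁻¹) := by gcongr; linarith
      have : 0 ≤ ‖p.1‖ ^ 2 * p.2⁻¹ ^ 2 * w p ^ 2 := by positivity
      rw [errSize]; linarith
    have hM2 : ‖p.1‖ ^ 2 * p.2⁻¹ ^ 2 * w p ^ 2 ≤ errSize α w p := by
      have : 0 ≤ α * (w p ^ 2 * p.2⁻¹) := by positivity
      rw [errSize]; linarith
    have hM : 0 ≤ errSize α w p := le_trans (by positivity) hM1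
    calc _ ≤ 2⁻¹ * (((n : ℝ) + 1) ^ 2 * K * ((‖p.1‖ + p.2) * (‖p.1‖ ^ 2 * p.2⁻¹ ^ 2))
        + 2 * ((n : ℝ) + 1) ^ 2 * K * ((‖p.1‖ + p.2) * p.2⁻¹)) * th lam p.2 * w p ^ 2 := by
          gcongr
      _ = 2⁻¹ * th lam p.2 * (((n : ℝ) + 1) ^ 2 * K) * ((‖p.1‖ + p.2)
          * (‖p.1‖ ^ 2 * p.2⁻¹ ^ 2 * w p ^ 2 + 2 * (w p ^ 2 * p.2⁻¹))) := by ring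
      _ ≤ 2⁻¹ * thConst * (((n : ℝ) + 1) ^ 2 * K) * ((‖p.1‖ + p.2)
          * (errSize α w p + 2 * errSize α w p)) := by
          have := W.th_le
          have := thConst_pos
          gcongr
      _ = 3 / 2 * (thConst * (((n : ℝ) + 1) ^ 2 * K) * ((‖p.1‖ + p.2) * errSize α w p)) := by ring
      _ ≤ 2 * (thConst * (((n : ℝ) + 1) ^ 2 * K) * ((‖p.1‖ + p.2) * errSize α w p)) := by
          have := thConst_pos
          gcongr
          norm_num
      _ = _ := by ring
  have t4 : th lam p.2 * energy A w p ≤ (1 + 5 * K) * ((n : ℝ) + 1) * (th lam p.2 * gradS w p) := by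
    have := (le_abs_self _).trans (abs_energy_le hA hK h hr W.time_le_one)
    calc _ ≤ th lam p.2 * ((1 + 5 * K) * ((n : ℝ) + 1) * gradS w p) := by gcongr
      _ = _ := by ring
  have t5 : th lam p.2 * w p * heatOp A w a p
      ≤ 4⁻¹ * etaConst⁻¹ * (th lam p.2 * (α * (w p ^ 2 * p.2⁻¹)))
        + etaConst * thConst * (eta σ p.2 * heatOp A w a p ^ 2) := by
    have y : 0 ≤ th lam p.2 * (etaConst * p.2 * α⁻¹)
        * (2⁻¹ * (α * etaConst⁻¹ * p.2⁻¹) * w p - heatOp A w a p) ^ 2 := by positivity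
    have e : th lam p.2 * (etaConst * p.2 * α⁻¹)
        * (2⁻¹ * (α * etaConst⁻¹ * p.2⁻¹) * w p - heatOp A w a p) ^ 2
        = 4⁻¹ * etaConst⁻¹ * (th lam p.2 * (α * (w p ^ 2 * p.2⁻¹)))
          + th lam p.2 * (etaConst * p.2 * α⁻¹) * heatOp A w a p ^ 2
          - th lam p.2 * w p * heatOp A w a p := by
      field_simp
      ring
    have hi : α⁻¹ ≤ 1 := inv_le_one_of_one_le₀ (by linarith)
    have z : th lam p.2 * (etaConst * p.2 * α⁻¹) * heatOp A w a p ^ 2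
        ≤ thConst * (etaConst * eta σ p.2 * 1) * heatOp A w a p ^ 2 := by
      have := W.th_le
      have := W.le_eta
      have := thConst_pos
      gcongr
    linarith
  have e6 : (2 * etaConst)⁻¹ = 2⁻¹ * etaConst⁻¹ := mul_inv _ _
  rw [e6]
  linarith

end pointwise

/-- (H - 2Y)² ≥ 0 gives 2Y(H - Y) ≤ H²/2, and the equation for σ gives η' - η/t = θη/t ≥ θ. -/
theorem carleman_integrand_le (hA : IsAdmissible n Λ K A) (W : WeightBounds lam σ p.2)
    (hΛ : 0 < Λ) {C : ℝ}
    (hC : commutator A w α (eta σ) a (eta' lam σ p.2) p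
      ≤ -(eta' lam σ p.2 - eta σ p.2 * p.2⁻¹) * energy A w p
        + C * ((‖p.1‖ + p.2) * errSize α w p)) :
    2 * eta σ p.2 * antiPart A w α (eta σ) p * (heatOp A w a p - antiPart A w α (eta σ) p)
        + commutator A w α (eta σ) a (eta' lam σ p.2) p
      ≤ -Λ⁻¹ * (th lam p.2 * gradS w p) + 2⁻¹ * (eta σ p.2 * heatOp A w a p ^ 2)
        + C * ((‖p.1‖ + p.2) * errSize α w p) := by
  have hT := W.time_pos
  have hη : 0 < eta σ p.2 := hT.trans_le W.le_eta
  have hE := le_energy (w := w) (p := p) hA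
  have hg := gradS_nonneg (w := w) (p := p)
  have h1 : 0 ≤ eta σ p.2 * (heatOp A w a p - 2 * antiPart A w α (eta σ) p) ^ 2 := by positivity
  have h2 : th lam p.2 ≤ eta' lam σ p.2 - eta σ p.2 * p.2⁻¹ := by
    have : 1 ≤ eta σ p.2 / p.2 := by rw [le_div_iff₀ hT, one_mul]; exact W.le_eta
    rw [eta', ← div_eq_mul_inv]
    nlinarith [W.th_nonneg]
  have h3 : th lam p.2 * (Λ⁻¹ * gradS w p) ≤ (eta' lam σ p.2 - eta σ p.2 * p.2⁻¹) * energy A w p :=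
    mul_le_mul h2 hE (by positivity) (W.th_nonneg.trans h2)
  linarith

/-- Each identity gains one part of M at the expense of the others: Euler costs w²/t and |∇w|²,
Caccioppoli costs |∇w|², and the Carleman identity costs neither. The multipliers are therefore
chosen in the order Euler, Caccioppoli, Carleman. -/
theorem exists_interior_bound (ha : a < 1) (hΛ : 0 < Λ) (hK : 0 ≤ K) (n : ℕ) :
    ∃ k₁ k₂ C : ℝ, 0 < k₁ ∧ 0 < k₂ ∧ 0 < C ∧ ∀ {lam α : ℝ} {σ : ℝ → ℝ} {w : Space n × ℝ → ℝ}
      {A : EuclideanSpace ℝ (Fin n) → ℝ → Matrix (Fin (n + 1)) (Fin (n + 1)) ℝ} {p : Space n × ℝ},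
      IsAdmissible n Λ K A → RegularAt A w p → ‖p.1‖ ≤ 4 → WeightBounds lam σ p.2 →
      2 * etaConst ≤ α →
      k₁ * (2 * eta σ p.2 * antiPart A w α (eta σ) p
            * (heatOp A w a p - antiPart A w α (eta σ) p)
          + commutator A w α (eta σ) a (eta' lam σ p.2) p)
        + k₂ * (2⁻¹ * th' lam p.2 * w p ^ 2 - α * th lam p.2 / eta σ p.2 * w p ^ 2
          + 2⁻¹ * defect A a p * th lam p.2 * w p ^ 2 + th lam p.2 * energy A w p
          + th lam p.2 * w p * heatOp A w a p)
        + 4 * (th lam p.2 * p.2⁻¹ * eulerDensity a w p)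
      ≤ -(th lam p.2 * errSize α w p) + C * (eta σ p.2 * heatOp A w a p ^ 2)
        + C * ((‖p.1‖ + p.2) * errSize α w p) := by
  have hC0 : 0 < etaConst := by linarith [one_le_etaConst]
  have hcomm : ∃ C, 0 ≤ C ∧ ∀ {lam α : ℝ} {σ : ℝ → ℝ} {w : Space n × ℝ → ℝ}
      {A : EuclideanSpace ℝ (Fin n) → ℝ → Matrix (Fin (n + 1)) (Fin (n + 1)) ℝ} {p : Space n × ℝ},
      IsAdmissible n Λ K A → RegularAt A w p → ‖p.1‖ ≤ 4 → WeightBounds lam σ p.2 → 0 ≤ α →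
      commutator A w α (eta σ) a (eta' lam σ p.2) p
        ≤ -(eta' lam σ p.2 - eta σ p.2 * p.2⁻¹) * energy A w p
          + C * ((‖p.1‖ + p.2) * errSize α w p) := by
    refine ⟨commConst n K etaConst (etaConst * (1 + thConst)), ?_,
      fun {lam α σ w A p} hA h hr W hα => ?_⟩
    case refine_2 =>
      have hT := W.time_pos
      have hη : 0 < eta σ p.2 := hT.trans_le W.le_eta
      have hb : eta σ p.2 / p.2 ≤ etaConst := by rw [div_le_iff₀ hT]; exact W.eta_le
      have := W.th_nonneg
      refine commutator_le hA hK h hr W.time_le_one hα (C₁ := etaConst * (1 + thConst)) ?_ hη.le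
        W.eta_le ?_
      · have := thConst_pos; positivity
      · rw [eta', abs_of_nonneg (by positivity)]
        gcongr
        exact W.th_le
    · have := thConst_pos
      exact commConst_nonneg hK hC0.le (by positivity)
  obtain ⟨C₁, hC₁, hcomm⟩ := hcomm
  -- The Euler multiplier 4 turns its gain of 1/4 into 1 and costs 4(n + 2) in αw²/t; Caccioppoli
  -- gains 1/(2`etaConst`) there, and one unit is to be left.
  set k₂ : ℝ := 2 * etaConst * (4 * ((n : ℝ) + 2) + 1) with hk₂
  have hk₂0 : 0 < k₂ := by positivity
  -- The gradient costs 4·4 = 16 from Euler and the multiple of k₂ from Caccioppoli; again one unit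
  -- is left.
  set k₁ : ℝ := Λ * (17 + k₂ * ((1 + 5 * K) * ((n : ℝ) + 1))) with hk₁
  have hk₁0 : 0 < k₁ := by positivity
  have hθC := thConst_pos
  refine ⟨k₁, k₂, k₁ * (C₁ + 1) + k₂ * (etaConst * thConst + 2 * thConst * (((n : ℝ) + 1) ^ 2 * K)),
    hk₁0, hk₂0, by positivity, fun {lam α σ w A p} hA h hr W hα => ?_⟩
  have hα1 : 1 ≤ α := by linarith [one_le_etaConst]
  have i1 := carleman_integrand_le hA W hΛ
    (hcomm hA h hr W (zero_le_one.trans hα1))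
  have i2 := caccioppoli_integrand_le (a := a) hA hK h hr W hα
  have i3 := eulerDensity_le (w := w) ha W.time_pos
  have hT := W.time_pos
  have hti : 0 < p.2⁻¹ := inv_pos.2 hT
  have hθ := W.th_nonneg
  have hη : 0 < eta σ p.2 := hT.trans_le W.le_eta
  have hg := gradS_nonneg (w := w) (p := p)
  have j3 : th lam p.2 * p.2⁻¹ * eulerDensity a w p
      ≤ ((n : ℝ) + 2) * (th lam p.2 * (α * (w p ^ 2 * p.2⁻¹))) + 4 * (th lam p.2 * gradS w p)
        - 4⁻¹ * (th lam p.2 * (‖p.1‖ ^ 2 * p.2⁻¹ ^ 2 * w p ^ 2)) := by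
    refine (mul_le_mul_of_nonneg_left i3 (by positivity)).trans ?_
    have e1 : p.2⁻¹ * p.2 = 1 := inv_mul_cancel₀ hT.ne'
    have e2 : th lam p.2 * p.2⁻¹ * (4 * (p.2 * gradS w p)) = 4 * (th lam p.2 * gradS w p) := by
      linear_combination (4 * th lam p.2 * gradS w p) * e1
    have e3 : th lam p.2 * p.2⁻¹ * (((n : ℝ) + 2) * w p ^ 2)
        ≤ ((n : ℝ) + 2) * (th lam p.2 * (α * (w p ^ 2 * p.2⁻¹))) := by
      calc _ = ((n : ℝ) + 2) * (th lam p.2 * (1 * (w p ^ 2 * p.2⁻¹))) := by ring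
        _ ≤ _ := by gcongr
    rw [mul_sub, mul_add, e2]
    linarith
  have l1 := mul_le_mul_of_nonneg_left i1 hk₁0.le
  have l2 := mul_le_mul_of_nonneg_left i2 hk₂0.le
  set P2 := eta σ p.2 * heatOp A w a p ^ 2 with hP2
  have hP20 : 0 ≤ P2 := by positivity
  set dM := (‖p.1‖ + p.2) * errSize α w p with hdM
  have hM0 : 0 ≤ errSize α w p := by rw [errSize]; positivity
  have hdM0 : 0 ≤ dM := by positivity
  set D := th lam p.2 * gradS w p with hD
  set V := th lam p.2 * (α * (w p ^ 2 * p.2⁻¹)) with hV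
  have eM : th lam p.2 * errSize α w p
      = V + th lam p.2 * (‖p.1‖ ^ 2 * p.2⁻¹ ^ 2 * w p ^ 2) + D := by
    rw [errSize]; ring
  have eΛ : k₁ * (-Λ⁻¹ * D) = -(17 + k₂ * ((1 + 5 * K) * ((n : ℝ) + 1))) * D := by
    rw [hk₁]; field_simp
  have eη : k₂ * (-(2 * etaConst)⁻¹ * V) = -(4 * ((n : ℝ) + 2) + 1) * V := by
    rw [hk₂]; field_simp
  have z1 : 0 ≤ k₁ * P2 := by positivity
  have z2 : 0 ≤ k₁ * C₁ * P2 := by positivity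
  have z3 : 0 ≤ k₂ * (2 * thConst * (((n : ℝ) + 1) ^ 2 * K)) * P2 := by positivity
  have z4 : 0 ≤ k₁ * dM := by positivity
  have z5 : 0 ≤ k₂ * (etaConst * thConst) * dM := by positivity
  rw [eM]
  linarith
end Carleman

/-! ### Absorption of the errors: the Gaussian against the singular weight. -/

namespace Carleman

/-- The exponent constant of the remainder. -/
noncomputable def remExp : ℝ := 8 + 2 * (16 * 6 ^ (3 / 2 : ℝ))

theorem remExp_pos : 0 < remExp := by unfold remExp; positivity

theorem rho_le {lam α t : ℝ} {σ : ℝ → ℝ} (hlam : 0 < lam) (hσ : IsCarlemanWeight lam σ)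
    (ht : t ∈ Ioo 0 (1 / lam)) (hα : 0 ≤ α) :
    rho σ α t ≤ Real.exp (2 * (16 * 6 ^ (3 / 2 : ℝ)) * α + 2 * α * Real.log (1 / t)) := by
  have h := (sigma_bounds hlam hσ ht).1
  have h0 : 0 < Real.exp (-(16 * 6 ^ (3 / 2 : ℝ))) * t := mul_pos (Real.exp_pos _) ht.1
  refine (Real.rpow_le_rpow_of_nonpos h0 h (by linarith)).trans (le_of_eq ?_)
  rw [Real.rpow_def_of_pos h0, Real.log_mul (Real.exp_pos _).ne' ht.1.ne', Real.log_exp, one_div,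
    Real.log_inv]
  ring_nf

theorem gaussian_eq_exp {n : ℕ} (a : ℝ) (X : Space n) {t : ℝ} (ht : 0 < t) :
    gaussian a X t
      = Real.exp (((n : ℝ) + 1 + a) / 2 * Real.log (1 / t) - ‖X‖ ^ 2 / (4 * t)) := by
  rw [gaussian, Real.rpow_def_of_pos ht, one_div, ← Real.exp_neg, ← Real.exp_add, one_div,
    Real.log_inv]
  ring_nf

/-- Far from the origin the Gaussian absorbs the singularity of the weight at `t = 0`. -/
theorem gaussian_mul_rho_mul_le {n : ℕ} {a ε δ α lam t : ℝ} {σ : ℝ → ℝ} (ha : a < 1) (hε : 0 < ε)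
    (hδ : 0 < δ) (hδε : δ ≤ ε / 4) (hα : 160 + n + 1 / δ ^ 2 ≤ α) (hlam : lam = α / δ ^ 2)
    (hl1 : 1 ≤ lam) (hσ : IsCarlemanWeight lam σ) (ht : 0 < t) (ht' : t ≤ 1 / (3 * lam))
    {X : Space n} (hfar : ε * th lam t < ‖X‖) :
    gaussian a X t * rho σ α t * 5 ≤ α ^ (remExp * α) * (t ^ 2 / (32 * α)) := by
  have hn : (0 : ℝ) ≤ n := Nat.cast_nonneg n
  have hδ2 : 0 < 1 / δ ^ 2 := by positivity
  have hα160 : 160 ≤ α := by linarith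
  have hα0 : 0 < α := by linarith
  have hl : 0 < lam := by linarith
  have hs : lam * t ≤ 1 / 3 := by
    rw [le_div_iff₀ (by positivity)] at ht'
    linarith
  have hs0 : 0 < lam * t := by positivity
  have W := weightBounds hl1 hσ ht ht'
  have hmem : t ∈ Ioo 0 (1 / lam) := ⟨ht, by rw [lt_div_iff₀ hl]; linarith⟩
  set L := Real.log (1 / (lam * t)) with hL
  have hL1 : 1 ≤ L := one_le_log_inv hs0 hs
  set ℓ := Real.log (1 / t) with hℓ
  have hℓL : ℓ = Real.log lam + L := by
    rw [hL, hℓ, one_div, one_div, Real.log_inv, Real.log_inv, Real.log_mul hl.ne' ht.ne']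
    ring
  have hlogα : 1 ≤ Real.log α := by
    rw [Real.le_log_iff_exp_le hα0]
    linarith [Real.exp_one_lt_d9]
  -- λ = α/δ² ≤ α², because 1/δ² ≤ α.
  have hloglam : Real.log lam ≤ 2 * Real.log α := by
    rw [← Real.log_rpow hα0]
    refine Real.log_le_log hl ?_
    rw [hlam, Real.rpow_two, div_eq_mul_one_div]
    nlinarith
  have hloglam0 : 0 ≤ Real.log lam := Real.log_nonneg hl1
  -- θ² = λtL³ at λt, so |X| > εθ gives |X|²/(4t) ≥ ε²λL³/4; δ ≤ ε/4 means ε²λ ≥ 16α, and L ≥ 1.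
  have hgauss : 4 * α * L ≤ ‖X‖ ^ 2 / (4 * t) := by
    have h1 : (ε * th lam t) ^ 2 ≤ ‖X‖ ^ 2 :=
      pow_le_pow_left₀ (mul_nonneg hε.le W.th_nonneg) hfar.le 2
    rw [mul_pow, th, theta_sq hs0 (by linarith)] at h1
    have h2 : 16 * α ≤ ε ^ 2 * lam := by
      rw [hlam, mul_div_assoc', le_div_iff₀ (by positivity)]
      have : δ ^ 2 ≤ (ε / 4) ^ 2 := pow_le_pow_left₀ hδ.le hδε 2
      nlinarith
    have h3 : L ≤ L ^ 3 := by nlinarith [mul_nonneg (sub_nonneg.2 hL1) (sub_nonneg.2 hL1)]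
    rw [le_div_iff₀ (by positivity)]
    calc 4 * α * L * (4 * t) = 16 * α * t * L := by ring
      _ ≤ ε ^ 2 * lam * t * L ^ 3 := by gcongr
      _ = ε ^ 2 * (lam * t * L ^ 3) := by ring
      _ ≤ _ := h1
  -- All powers of 1/t together cost at most 3αℓ with ℓ = L + log λ. The part 3αL is beaten by the
  -- Gaussian; 3α log λ ≤ 6α log α and the prefactor α² make up the 8 in `remExp`, and the lower
  -- bound for σ makes up the rest.
  have hexp : 2 * Real.log α + (((n : ℝ) + 1 + a) / 2 * ℓ - ‖X‖ ^ 2 / (4 * t)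
      + (2 * (16 * 6 ^ (3 / 2 : ℝ)) * α + 2 * α * ℓ)) + 2 * ℓ ≤ Real.log α * (remExp * α) := by
    have hc : (0 : ℝ) ≤ 6 ^ (3 / 2 : ℝ) := by positivity
    have e1 : (((n : ℝ) + 1 + a) / 2 + 2 * α + 2) * ℓ ≤ 3 * α * ℓ := by
      have : 0 ≤ ℓ := by rw [hℓL]; linarith
      gcongr
      linarith
    have e2 : 3 * α * ℓ ≤ 3 * α * (2 * Real.log α) + 4 * α * L := by
      rw [hℓL]
      nlinarith [mul_le_mul_of_nonneg_left hloglam hα0.le]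
    have e3 : 2 * Real.log α ≤ 2 * (Real.log α * α) := by nlinarith
    have e4 : 2 * (16 * 6 ^ (3 / 2 : ℝ)) * α ≤ 2 * (16 * 6 ^ (3 / 2 : ℝ)) * (Real.log α * α) := by
      gcongr
      nlinarith
    rw [remExp]
    nlinarith
  have hbound : α ^ 2 * (gaussian a X t * rho σ α t) ≤ α ^ (remExp * α) * t ^ 2 := by
    have e1 : α ^ 2 = Real.exp (2 * Real.log α) := by
      rw [two_mul, Real.exp_add, Real.exp_log hα0, sq]
    have e2 : t ^ 2 = Real.exp (-(2 * ℓ)) := by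
      have : Real.exp (-ℓ) = t := by rw [hℓ, one_div, Real.log_inv, neg_neg, Real.exp_log ht]
      rw [two_mul, neg_add, Real.exp_add, this, sq]
    have e3 : α ^ (remExp * α) = Real.exp (Real.log α * (remExp * α)) := Real.rpow_def_of_pos hα0 _
    calc α ^ 2 * (gaussian a X t * rho σ α t)
        ≤ α ^ 2 * (gaussian a X t
          * Real.exp (2 * (16 * 6 ^ (3 / 2 : ℝ)) * α + 2 * α * Real.log (1 / t))) := by
          have : 0 ≤ gaussian a X t := by rw [gaussian_eq_exp a X ht]; positivity
          gcongr
          exact rho_le hl hσ hmem hα0.le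
      _ ≤ _ := by
          rw [gaussian_eq_exp a X ht, ← hℓ, e1, e2, e3, ← Real.exp_add, ← Real.exp_add,
            ← Real.exp_add, Real.exp_le_exp]
          linarith
  have hGρ : 0 ≤ gaussian a X t * rho σ α t := by
    rw [gaussian_eq_exp a X ht]
    exact mul_nonneg (Real.exp_pos _).le (Real.rpow_nonneg (hσ.pos t hmem).le _)
  -- The requirement α ≥ 160 = 5·32 is used here.
  rw [mul_div_assoc', le_div_iff₀ (by positivity)]
  calc gaussian a X t * rho σ α t * 5 * (32 * α) = 160 * α * (gaussian a X t * rho σ α t) := by ring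
    _ ≤ α * α * (gaussian a X t * rho σ α t) := by gcongr
    _ = α ^ 2 * (gaussian a X t * rho σ α t) := by ring
    _ ≤ _ := hbound

/-- If |X| ≤ εθ, then also t ≤ ελt ≤ εθ since ελ ≥ 1, and the first term suffices. Otherwise |X| + t
≤ 5 and the Gaussian decay gives the second. -/
theorem gaussian_mul_rho_split {n : ℕ} {a ε δ α lam t : ℝ} {σ : ℝ → ℝ} (ha : a < 1) (hε : 0 < ε)
    (hε1 : ε ≤ 1) (hδ : 0 < δ) (hδε : δ ≤ ε / 4) (hα : 160 + n + 1 / δ ^ 2 ≤ α)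
    (hlam : lam = α / δ ^ 2) (hl1 : 1 ≤ lam) (hσ : IsCarlemanWeight lam σ) (ht : 0 < t)
    (ht' : t ≤ 1 / (3 * lam)) {X : Space n} (hX : ‖X‖ ≤ 4) :
    gaussian a X t * rho σ α t * (‖X‖ + t)
      ≤ 2 * ε * th lam t * (gaussian a X t * rho σ α t)
        + α ^ (remExp * α) * (t ^ 2 / (32 * α)) := by
  have hn : (0 : ℝ) ≤ n := Nat.cast_nonneg n
  have hδ2 : 0 < 1 / δ ^ 2 := by positivity
  have hα0 : 0 < α := by linarith
  have hl : 0 < lam := by linarith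
  have W := weightBounds hl1 hσ ht ht'
  have hs : lam * t ≤ 1 / 3 := by
    rw [le_div_iff₀ (by positivity)] at ht'
    linarith
  have hmem : t ∈ Ioo 0 (1 / lam) := ⟨ht, by rw [lt_div_iff₀ hl]; linarith⟩
  have hGρ : 0 ≤ gaussian a X t * rho σ α t := by
    rw [gaussian_eq_exp a X ht]
    exact mul_nonneg (Real.exp_pos _).le (Real.rpow_nonneg (hσ.pos t hmem).le _)
  have hθ := W.th_nonneg
  rcases le_or_gt ‖X‖ (ε * th lam t) with hnear | hfar
  · have h1 : 1 ≤ ε * lam := by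
      have : δ ^ 2 ≤ ε := by nlinarith
      rw [hlam, mul_div_assoc', le_div_iff₀ (by positivity)]
      nlinarith
    have h2 : t ≤ ε * th lam t := by nlinarith [W.mul_le_th]
    have h3 : 0 ≤ α ^ (remExp * α) * (t ^ 2 / (32 * α)) := by positivity
    calc _ ≤ gaussian a X t * rho σ α t * (ε * th lam t + ε * th lam t) := by gcongr
      _ = 2 * ε * th lam t * (gaussian a X t * rho σ α t) := by ring
      _ ≤ _ := by linarith
  · have h1 := gaussian_mul_rho_mul_le ha hε hδ hδε hα hlam hl1 hσ ht ht' hfar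
    have h2 : 0 ≤ 2 * ε * th lam t * (gaussian a X t * rho σ α t) := by positivity
    calc _ ≤ gaussian a X t * rho σ α t * 5 := by
          gcongr
          linarith [W.time_le_one]
      _ ≤ _ := by linarith

/-- The error terms are absorbed up to an unweighted remainder. -/
theorem gaussian_mul_rho_mul_errSize_le {n : ℕ} {a ε δ α lam : ℝ} {σ : ℝ → ℝ}
    {w : Space n × ℝ → ℝ} {p : Space n × ℝ} (ha : a < 1) (hε : 0 < ε)
    (hε1 : ε ≤ 1) (hδ : 0 < δ) (hδε : δ ≤ ε / 4) (hα : 160 + n + 1 / δ ^ 2 ≤ α)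
    (hlam : lam = α / δ ^ 2) (hl1 : 1 ≤ lam) (hσ : IsCarlemanWeight lam σ) (ht : 0 < p.2)
    (ht' : p.2 ≤ 1 / (3 * lam)) (hX : ‖p.1‖ ≤ 4) :
    gaussian a p.1 p.2 * rho σ α p.2 * ((‖p.1‖ + p.2) * errSize α w p)
      ≤ 2 * ε * (gaussian a p.1 p.2 * rho σ α p.2 * (th lam p.2 * errSize α w p))
        + α ^ (remExp * α) * (w p ^ 2 + p.2 * gradS w p) := by
  have hn : (0 : ℝ) ≤ n := Nat.cast_nonneg n
  have hδ2 : 0 < 1 / δ ^ 2 := by positivity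
  have hα160 : 160 ≤ α := by linarith
  have hα0 : 0 < α := by linarith
  have h1 := gaussian_mul_rho_split ha hε hε1 hδ hδε hα hlam hl1 hσ ht ht' hX
  have hg := gradS_nonneg (w := w) (p := p)
  have hti : 0 < p.2⁻¹ := inv_pos.2 ht
  have hM : 0 ≤ errSize α w p := by rw [errSize]; positivity
  have hT1 := (weightBounds hl1 hσ ht ht').time_le_one
  -- The factor t² removes the negative powers of t in M, and 32α covers the coefficients α and |X|²
  -- ≤ 16.
  have h2 : p.2 ^ 2 / (32 * α) * errSize α w p ≤ w p ^ 2 + p.2 * gradS w p := by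
    rw [errSize, div_mul_eq_mul_div, div_le_iff₀ (by positivity)]
    have e : p.2 ^ 2 * (α * (w p ^ 2 * p.2⁻¹) + ‖p.1‖ ^ 2 * p.2⁻¹ ^ 2 * w p ^ 2 + gradS w p)
        = α * (p.2 * w p ^ 2) + ‖p.1‖ ^ 2 * w p ^ 2 + p.2 * (p.2 * gradS w p) := by
      field_simp
    rw [e]
    have e1 : p.2 * w p ^ 2 ≤ 1 * w p ^ 2 := by gcongr
    have e2 : ‖p.1‖ ^ 2 * w p ^ 2 ≤ 4 ^ 2 * w p ^ 2 := by gcongr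
    have e3 : p.2 * (p.2 * gradS w p) ≤ 1 * (p.2 * gradS w p) := by gcongr
    have e4 : 0 ≤ p.2 * gradS w p := by positivity
    have e5 := sq_nonneg (w p)
    nlinarith
  have h3 := mul_le_mul_of_nonneg_right h1 hM
  have h4 : 0 ≤ α ^ (remExp * α) := by positivity
  have h5 := mul_le_mul_of_nonneg_left h2 h4
  calc _ = gaussian a p.1 p.2 * rho σ α p.2 * (‖p.1‖ + p.2) * errSize α w p := by ring
    _ ≤ _ := h3
    _ = 2 * ε * (gaussian a p.1 p.2 * rho σ α p.2 * (th lam p.2 * errSize α w p))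
        + α ^ (remExp * α) * (p.2 ^ 2 / (32 * α) * errSize α w p) := by ring
    _ ≤ _ := by linarith

end Carleman

/-! ### The boundary terms at t = c and the estimate in real-valued integrals. -/

namespace Carleman

variable {n : ℕ} {a Λ K lam α c T T₂ : ℝ} {σ : ℝ → ℝ} {w : Space n × ℝ → ℝ}
  {A : EuclideanSpace ℝ (Fin n) → ℝ → Matrix (Fin (n + 1)) (Fin (n + 1)) ℝ}

theorem GoodST.integrableOn {f : Space n × ℝ → ℝ} (hf : GoodST n c T T₂ f) (hT : T ≤ T₂)
    (ha : -1 < a) : IntegrableOn (fun p : Space n × ℝ => vert p.1 ^ a * f p) (box n 4 c T) :=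
  ((halfDomain_spaceTime (n := n) (R := 5) (R' := 4) (c := c) (by norm_num) le_rfl
    hT).integrableOn_rpow_mul ha hf.lip).mono_set fun _ hp =>
      ⟨⟨hp.1.1, hp.1.2.trans (by norm_num)⟩, hp.2.1, hp.2.2.trans hT⟩

theorem GoodST.integrableOn_slice {f : Space n × ℝ → ℝ} (hf : GoodST n c T T₂ f) (hc : c ≤ T₂)
    (ha : -1 < a) : IntegrableOn (fun X : Space n => vert X ^ a * f (X, c)) (ballPart n 4) := by
  have h : BddLip (ballPart n 5) fun X => f (X, c) :=
    hf.lip.comp (φ := fun X : Space n => (X, c)) (fun X hX => ⟨hX, le_rfl, hc⟩)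
      fun p q => by simp [Prod.norm_def]
  exact ((halfDomain_space (n := n) (R := 5) (R' := 4) (by norm_num)
    le_rfl).integrableOn_rpow_mul ha h).mono_set fun X hX => ⟨hX.1, hX.2.trans (by norm_num)⟩

theorem GoodST.norm_sq (hT : T ≤ T₂) : GoodST n c T T₂ fun p => ‖p.1‖ ^ 2 :=
  GoodST.of_contDiffAt hT fun _ _ _ => (contDiffAt_fst.norm_sq ℝ)

theorem IsTestFunction.goodST_gradS {T₁ : ℝ} (hw : IsTestFunction n T₁ w) (hc : 0 < c) :
    GoodST n c T T₂ (gradS w) :=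
  Good.sum fun _ => ((hw.dW _).good hc).pow_two

theorem IsTestFunction.goodST_errSize {T₁ : ℝ} (hw : IsTestFunction n T₁ w) (hc : 0 < c)
    (hT : T ≤ T₂) (α : ℝ) : GoodST n c T T₂ (errSize α w) :=
  ((((hw.good hc).pow_two.mul (GoodST.inv_time hT hc)).const_mul α).add
    (((GoodST.norm_sq hT).mul (GoodST.inv_time hT hc).pow_two).mul (hw.good hc).pow_two)).add
    (hw.goodST_gradS hc)

theorem symmForm_le (hA : IsAdmissible n Λ K A) (hK : 0 ≤ K) {p : Space n × ℝ}
    (hΛ : 0 < Λ) (W : WeightBounds lam σ p.2) {ρ : ℝ → ℝ}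
    (hρ : 0 ≤ ρ p.2) :
    symmForm A w α ρ (eta σ) p ≤ ρ p.2 * (α * w p ^ 2
      + etaConst * (((n : ℝ) + 1) ^ 2 * K) * ((‖p.1‖ + p.2) * (‖p.1‖ ^ 2 * p.2⁻¹ * w p ^ 2))
      - Λ⁻¹ * (p.2 * gradS w p)) := by
  have hT := W.time_pos
  have hti : 0 < p.2⁻¹ := inv_pos.2 hT
  have hη : 0 < eta σ p.2 := hT.trans_le W.le_eta
  have hg := gradS_nonneg (w := w) (p := p)
  have hC := one_le_etaConst
  have hR := norm_nonneg p.1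
  have h1 : p.2 * (Λ⁻¹ * gradS w p) ≤ eta σ p.2 * energy A w p :=
    mul_le_mul W.le_eta (le_energy hA) (by positivity) hη.le
  have h2 := abs_mainDefect_le hA hT
  have h3 : -(2⁻¹ * (eta σ p.2 * mainDefect A p * w p ^ 2))
      ≤ etaConst * (((n : ℝ) + 1) ^ 2 * K) * ((‖p.1‖ + p.2) * (‖p.1‖ ^ 2 * p.2⁻¹ * w p ^ 2)) := by
    calc _ = 2⁻¹ * (eta σ p.2 * -mainDefect A p * w p ^ 2) := by ring
      _ ≤ 2⁻¹ * (eta σ p.2 * |mainDefect A p| * w p ^ 2) := by gcongr; exact neg_le_abs _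
      _ ≤ 2⁻¹ * (etaConst * p.2 * (((n : ℝ) + 1) ^ 2 * K
          * ((‖p.1‖ + p.2) * (‖p.1‖ ^ 2 * p.2⁻¹ ^ 2))) * w p ^ 2) := by
          have := W.eta_le
          gcongr
      _ = 2⁻¹ * (etaConst * (((n : ℝ) + 1) ^ 2 * K)
          * ((‖p.1‖ + p.2) * (‖p.1‖ ^ 2 * p.2⁻¹ * w p ^ 2))) := by field_simp
      _ ≤ 1 * (etaConst * (((n : ℝ) + 1) ^ 2 * K)
          * ((‖p.1‖ + p.2) * (‖p.1‖ ^ 2 * p.2⁻¹ * w p ^ 2))) := by gcongr; norm_num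
      _ = _ := one_mul _
  rw [symmForm]
  refine mul_le_mul_of_nonneg_left ?_ hρ
  linarith

/-- The pointwise bound for the boundary terms at the initial time. -/
theorem slice_bound {k₁ k₂ ε δ : ℝ} (ha : a < 1) (hΛ : 0 < Λ) (hK : 0 ≤ K) (hk₁ : 0 < k₁)
    (hk₂ : 0 < k₂) (hA : IsAdmissible n Λ K A) {p : Space n × ℝ} (hT : 0 < p.2)
    (hε : 0 < ε) (hε1 : ε ≤ 1)
    (hε2 : 64 * Λ * (etaConst * (((n : ℝ) + 1) ^ 2 * K)) * thConst * ε ≤ 1)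
    (hδ : 0 < δ) (hδε : δ ≤ ε / 4) (hα : 160 + n + 1 / δ ^ 2 ≤ α)
    (hlam : lam = α / δ ^ 2) (hl1 : 1 ≤ lam) (hσ : IsCarlemanWeight lam σ)
    (ht' : p.2 ≤ 1 / (3 * lam)) (hX : ‖p.1‖ ≤ 4) :
    k₁ * (gaussian a p.1 p.2 * symmForm A w α (rho σ α) (eta σ) p)
      + k₂ * (gaussian a p.1 p.2 * (2⁻¹ * (rho σ α p.2 * th lam p.2 * w p ^ 2)))
      + k₁ / (8 * Λ) * (rho σ α p.2 * (gaussian a p.1 p.2 * eulerDensity a w p))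
    ≤ -(k₁ / (2 * Λ)) * (rho σ α p.2 * (gaussian a p.1 p.2 * (p.2 * gradS w p)))
      + (k₁ + k₂ * thConst + k₁ / (8 * Λ) * ((n : ℝ) + 2))
        * (α * (rho σ α p.2 * (gaussian a p.1 p.2 * w p ^ 2)))
      + k₁ * (etaConst * (((n : ℝ) + 1) ^ 2 * K)) * (α ^ (remExp * α) * w p ^ 2) := by
  have hti : 0 < p.2⁻¹ := inv_pos.2 hT
  have hn : (0 : ℝ) ≤ n := Nat.cast_nonneg n
  have hδ2 : 0 < 1 / δ ^ 2 := by positivity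
  have hα160 : 160 ≤ α := by linarith
  have hα0 : 0 < α := by linarith
  have hl : 0 < lam := by linarith
  have W := weightBounds hl1 hσ hT ht'
  have hs : lam * p.2 ≤ 1 / 3 := by
    rw [le_div_iff₀ (by positivity)] at ht'
    linarith
  have hmem : p.2 ∈ Ioo 0 (1 / lam) := ⟨hT, by rw [lt_div_iff₀ hl]; linarith⟩
  have hG : 0 < gaussian a p.1 p.2 := by rw [gaussian_eq_exp a p.1 hT]; exact Real.exp_pos _
  have hρ : 0 < rho σ α p.2 := Real.rpow_pos_of_pos (hσ.pos _ hmem) _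
  have hg := gradS_nonneg (w := w) (p := p)
  have hw := sq_nonneg (w p)
  have hC : 0 < etaConst := by linarith [one_le_etaConst]
  have hθC := thConst_pos
  have hθ := W.th_nonneg
  have s1 := mul_le_mul_of_nonneg_left (mul_le_mul_of_nonneg_left
    (symmForm_le (w := w) (α := α) (ρ := rho σ α) hA hK hΛ W hρ.le) hG.le) hk₁.le
  -- With the multiplier k₁/(8Λ), the Euler identity costs k₁/(2Λ) of t|∇w|², half of what the
  -- quadratic form provides, and gains k₁/(32Λ) of |X|²w²/t.
  have s3 := mul_le_mul_of_nonneg_left (mul_le_mul_of_nonneg_left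
    (mul_le_mul_of_nonneg_left (eulerDensity_le (a := a) (w := w) ha hT) hG.le) hρ.le)
    (show 0 ≤ k₁ / (8 * Λ) by positivity)
  set Q := rho σ α p.2 * (gaussian a p.1 p.2 * w p ^ 2) with hQ
  have hQ0 : 0 ≤ Q := by positivity
  have s2 : k₂ * (gaussian a p.1 p.2 * (2⁻¹ * (rho σ α p.2 * th lam p.2 * w p ^ 2)))
      ≤ k₂ * thConst * (α * Q) := by
    calc _ = k₂ * (2⁻¹ * th lam p.2) * Q := by rw [hQ]; ring
      _ ≤ k₂ * (1 * thConst) * (1 * Q) := by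
        have := W.th_le
        rw [one_mul Q]
        gcongr
        norm_num
      _ ≤ k₂ * (1 * thConst) * (α * Q) := by gcongr; linarith
      _ = _ := by ring
  set B := etaConst * (((n : ℝ) + 1) ^ 2 * K) with hB
  have hB0 : 0 ≤ B := by positivity
  set R := ‖p.1‖ ^ 2 * p.2⁻¹ * w p ^ 2 with hR
  have hR0 : 0 ≤ R := by positivity
  have s4 : gaussian a p.1 p.2 * rho σ α p.2 * ((‖p.1‖ + p.2) * R)
      ≤ 2 * ε * thConst * (rho σ α p.2 * (gaussian a p.1 p.2 * R)) + α ^ (remExp * α) * w p ^ 2 := by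
    have g := mul_le_mul_of_nonneg_right
      (gaussian_mul_rho_split ha hε hε1 hδ hδε hα hlam hl1 hσ hT ht' hX) hR0
    have g1 : p.2 ^ 2 / (32 * α) * R ≤ w p ^ 2 := by
      rw [div_mul_eq_mul_div, div_le_iff₀ (by positivity)]
      have e : p.2 ^ 2 * R = p.2 * (‖p.1‖ ^ 2 * w p ^ 2) := by rw [hR]; field_simp
      rw [e]
      have := W.time_le_one
      calc _ ≤ 1 * (4 ^ 2 * w p ^ 2) := by gcongr
        _ ≤ _ := by nlinarith
    have g2 : 0 ≤ α ^ (remExp * α) := by positivity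
    have g3 := mul_le_mul_of_nonneg_left g1 g2
    have g4 : 2 * ε * th lam p.2 * (gaussian a p.1 p.2 * rho σ α p.2) * R
        ≤ 2 * ε * thConst * (gaussian a p.1 p.2 * rho σ α p.2) * R := by
      have := W.th_le
      gcongr
    linarith
  have s5 := mul_le_mul_of_nonneg_left s4 (mul_nonneg hk₁.le hB0)
  -- The near part of the error fits into the gain k₁/(32Λ) exactly when 64ΛB·`thConst`·ε ≤ 1.
  have s6 : k₁ * B * (2 * ε * thConst * (rho σ α p.2 * (gaussian a p.1 p.2 * R)))
      ≤ k₁ / (8 * Λ) * (4⁻¹ * (rho σ α p.2 * (gaussian a p.1 p.2 * R))) := by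
    have hX0 : 0 ≤ rho σ α p.2 * (gaussian a p.1 p.2 * R) := by positivity
    have e : 64 * Λ * B * thConst * ε * (k₁ / (32 * Λ)) = k₁ * B * (2 * ε * thConst) := by
      field_simp
      ring
    have e2 := mul_le_mul_of_nonneg_right hε2 (show 0 ≤ k₁ / (32 * Λ) by positivity)
    rw [e, one_mul] at e2
    calc _ = k₁ * B * (2 * ε * thConst) * (rho σ α p.2 * (gaussian a p.1 p.2 * R)) := by ring
      _ ≤ k₁ / (32 * Λ) * (rho σ α p.2 * (gaussian a p.1 p.2 * R)) := by gcongr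
      _ = _ := by ring
  have s7 : k₁ / (8 * Λ) * ((n : ℝ) + 2) * Q ≤ k₁ / (8 * Λ) * ((n : ℝ) + 2) * (α * Q) := by
    have : 1 * Q ≤ α * Q := by gcongr; linarith
    rw [one_mul] at this
    gcongr
  have e1 : k₁ * (gaussian a p.1 p.2 * (rho σ α p.2 * (α * w p ^ 2
      + B * ((‖p.1‖ + p.2) * R) - Λ⁻¹ * (p.2 * gradS w p))))
      = k₁ * (α * Q) + k₁ * B * (gaussian a p.1 p.2 * rho σ α p.2 * ((‖p.1‖ + p.2) * R))
        - k₁ / Λ * (rho σ α p.2 * (gaussian a p.1 p.2 * (p.2 * gradS w p))) := by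
    rw [hQ]; ring
  have e2 : k₁ / (8 * Λ) * (rho σ α p.2 * (gaussian a p.1 p.2
      * (((n : ℝ) + 2) * w p ^ 2 + 4 * (p.2 * gradS w p) - 4⁻¹ * R)))
      = k₁ / (8 * Λ) * ((n : ℝ) + 2) * Q
        + k₁ / (2 * Λ) * (rho σ α p.2 * (gaussian a p.1 p.2 * (p.2 * gradS w p)))
        - k₁ / (8 * Λ) * (4⁻¹ * (rho σ α p.2 * (gaussian a p.1 p.2 * R))) := by
    rw [hQ]; ring
  have e3 : k₁ / Λ * (rho σ α p.2 * (gaussian a p.1 p.2 * (p.2 * gradS w p)))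
      = 2 * (k₁ / (2 * Λ) * (rho σ α p.2 * (gaussian a p.1 p.2 * (p.2 * gradS w p)))) := by
    ring
  rw [e1] at s1
  rw [e2] at s3
  rw [mul_add] at s5
  linarith

/-- The pointwise interior bound is integrated over the box, where the three identities evaluate its
left side to terms at t = c; these are bounded by integrating `slice_bound`. Integrability of the
term with H² is a hypothesis, since it is the only integral that may diverge. -/
theorem Setting.exists_estimate (ha : a < 1) (hΛ : 0 < Λ) (hK : 0 ≤ K) (n : ℕ) :
    ∃ C ε : ℝ, 0 < C ∧ 0 < ε ∧ ε ≤ 1 ∧ ∀ {δ α lam c : ℝ} {σ : ℝ → ℝ} {w : Space n × ℝ → ℝ}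
      {A : EuclideanSpace ℝ (Fin n) → ℝ → Matrix (Fin (n + 1)) (Fin (n + 1)) ℝ},
      0 < δ → δ ≤ ε / 4 → 160 + n + 1 / δ ^ 2 ≤ α → 2 * etaConst ≤ α → lam = α / δ ^ 2 →
      Setting n a Λ K lam c σ A w →
      IntegrableOn (fun p : Space n × ℝ => vert p.1 ^ a * (gaussian a p.1 p.2 * (rho σ α p.2
        * (eta σ p.2 * heatOp A w a p ^ 2)))) (box n 4 c (1 / (3 * lam))) →
      (∫ p in box n 4 c (1 / (3 * lam)), vert p.1 ^ a * (gaussian a p.1 p.2 * (rho σ α p.2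
          * (th lam p.2 * errSize α w p))))
        + rho σ α c * c * ∫ X in ballPart n 4, vert X ^ a * (gaussian a X c * gradS w (X, c))
      ≤ C * (∫ p in box n 4 c (1 / (3 * lam)), vert p.1 ^ a * (gaussian a p.1 p.2 * (rho σ α p.2
          * (eta σ p.2 * heatOp A w a p ^ 2))))
        + C * (α * rho σ α c) * (∫ X in ballPart n 4, vert X ^ a * (gaussian a X c * w (X, c) ^ 2))
        + C * α ^ (remExp * α) * ((∫ p in box n 4 c (1 / (3 * lam)),
            vert p.1 ^ a * (w p ^ 2 + p.2 * gradS w p))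
          + ∫ X in ballPart n 4, vert X ^ a * w (X, c) ^ 2) := by
  obtain ⟨k₁, k₂, C, hk₁, hk₂, hC, hint⟩ := exists_interior_bound ha hΛ hK n
  have hη0 : 0 < etaConst := by linarith [one_le_etaConst]
  have hθ0 := thConst_pos
  set B := etaConst * (((n : ℝ) + 1) ^ 2 * K) with hB
  have hB0 : 0 ≤ B := by positivity
  -- ε = 1/Z meets three demands at once: ε ≤ 1, the smallness required by the slice bound, and 2Cε
  -- ≤ 1/2, so that half of θM survives the absorption.
  set Z := 1 + 64 * Λ * B * thConst + 4 * C with hZ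
  have hZ1 : 1 ≤ Z := by
    have : 0 ≤ 64 * Λ * B * thConst := by positivity
    linarith
  have hZ0 : 0 < Z := by linarith
  set D := k₁ + k₂ * thConst + k₁ / (8 * Λ) * ((n : ℝ) + 2) with hD
  have hD0 : 0 < D := by positivity
  set m := min 2⁻¹ (k₁ / (2 * Λ)) with hm
  have hm0 : 0 < m := lt_min (by norm_num) (by positivity)
  set C' := C + D + k₁ * B with hC'
  have hC'0 : 0 < C' := by positivity
  refine ⟨m⁻¹ * C', Z⁻¹, by positivity, by positivity, inv_le_one_of_one_le₀ hZ1,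
    fun {δ α lam c σ w A} hδ hδε hα hα2 hlam S hP => ?_⟩
  have hε1 : Z⁻¹ ≤ 1 := inv_le_one_of_one_le₀ hZ1
  have hε0 : 0 < Z⁻¹ := by positivity
  have hεa : 64 * Λ * B * thConst * Z⁻¹ ≤ 1 := by
    rw [← div_eq_mul_inv, div_le_one hZ0]; linarith
  have hεb : C * (2 * Z⁻¹) ≤ 2⁻¹ := by
    have : 4 * C * Z⁻¹ ≤ 1 := by
      rw [← div_eq_mul_inv, div_le_one hZ0]
      have : 0 ≤ 64 * Λ * B * thConst := by positivity
      linarith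
    linarith
  have hn : (0 : ℝ) ≤ n := Nat.cast_nonneg n
  have hδ2 : 0 < 1 / δ ^ 2 := by positivity
  have hα0 : 0 < α := by linarith
  have hc := S.hc
  have hTT := S.T_lt.le
  have gG := GoodST.gaussian (n := n) (c := c) a hTT hc
  have gρ := goodST_rho (n := n) (α := α) S.hσ S.hc S.T_lt.le S.T₂_lt
  have gη := goodST_eta (n := n) S.lam_pos S.hσ S.hc S.T_lt.le S.T₂_lt
  have gθ := goodST_th (n := n) S.lam_pos S.hc S.T_lt.le S.T₂_lt
  have gw := S.hw.good (T := 1 / (3 * lam)) (T₂ := 1 / (2 * lam)) S.hc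
  have gF := goodST_mainDefect S.hA S.hK S.hc S.T_lt.le
  have gE := goodST_energy (T := 1 / (3 * lam)) (T₂ := 1 / (2 * lam)) S.hw S.hA S.hK S.hc
  have gS := S.hw.goodST_gradS (T := 1 / (3 * lam)) (T₂ := 1 / (2 * lam)) hc
  have gM := S.hw.goodST_errSize hc hTT α
  have gt : GoodST n c (1 / (3 * lam)) (1 / (2 * lam)) fun p => p.2 :=
    GoodST.of_contDiffAt hTT fun _ _ _ => contDiffAt_snd
  have gI := GoodST.inv_time (n := n) hTT hc
  have hcT₂ : c ≤ 1 / (2 * lam) := S.c_lt.le.trans hTT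
  obtain ⟨i1, e1⟩ := S.carleman_integral (α := α)
  obtain ⟨i2, e2⟩ := S.caccioppoli_integral (α := α)
  obtain ⟨i3, e3⟩ := S.hw.integral_euler_box hc hTT S.ha
    (κ := fun t => rho σ α t * (th lam t * t⁻¹)) (gρ.mul (gθ.mul gI)) fun t ht => by
      have hm := S.mem_Ioo ht
      exact (hasDerivAt_rho S.hσ hm).differentiableAt.fun_mul
        ((hasDerivAt_th S.lam_pos hm).differentiableAt.fun_mul
          (hasDerivAt_inv hm.1.ne').differentiableAt)
  have iM : IntegrableOn (fun p : Space n × ℝ => vert p.1 ^ a * (gaussian a p.1 p.2 * (rho σ α p.2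
      * (th lam p.2 * errSize α w p)))) (box n 4 c (1 / (3 * lam))) :=
    GoodST.integrableOn (gG.mul (gρ.mul (gθ.mul gM))) hTT S.ha.1
  have iU : IntegrableOn (fun p : Space n × ℝ => vert p.1 ^ a * (w p ^ 2 + p.2 * gradS w p))
      (box n 4 c (1 / (3 * lam))) :=
    GoodST.integrableOn (gw.pow_two.add (gt.mul gS)) hTT S.ha.1
  have hreg := S.hw.ae_regularAt (T := 1 / (3 * lam)) S.hA S.hK S.hc
  have hl1 := S.one_le
  have main := integral_mono_ae (((i1.const_mul k₁).add (i2.const_mul k₂)).add (i3.const_mul 4))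
    (((iM.const_mul (-2⁻¹)).add (hP.const_mul C)).add (iU.const_mul (C * α ^ (remExp * α)))) (by
      filter_upwards [hreg, ae_restrict_mem measurableSet_box] with p h hp
      have ht := h.time_pos
      have ht' : p.2 ≤ 1 / (3 * lam) := hp.2.2
      have hr : ‖p.1‖ ≤ 4 := hp.1.2
      have W := weightBounds hl1 S.hσ ht ht'
      have hG : 0 < gaussian a p.1 p.2 := by rw [gaussian_eq_exp a p.1 ht]; exact Real.exp_pos _
      have hρ : 0 < rho σ α p.2 := Real.rpow_pos_of_pos (S.hσ.pos _ (S.mem_Ioo hp.2)) _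
      have hz : 0 < vert p.1 ^ a := Real.rpow_pos_of_pos h.vert_pos a
      have hg := gradS_nonneg (w := w) (p := p)
      have hti : 0 < p.2⁻¹ := inv_pos.2 ht
      have hM0 : 0 ≤ errSize α w p := by rw [errSize]; positivity
      have q1 := hint S.hA h hr W hα2
      have q2 := gaussian_mul_rho_mul_errSize_le (w := w) ha hε0 hε1 hδ hδε hα hlam hl1 S.hσ ht
        ht' hr
      have q3 := mul_le_mul_of_nonneg_left q1 (mul_pos hG hρ).le
      have q4 := mul_le_mul_of_nonneg_left q2 hC.le
      have hX0 : 0 ≤ gaussian a p.1 p.2 * rho σ α p.2 * (th lam p.2 * errSize α w p) := by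
        have := W.th_nonneg
        positivity
      have q5 := mul_le_mul_of_nonneg_right hεb hX0
      have q6 : gaussian a p.1 p.2 * rho σ α p.2 * (k₁ * (2 * eta σ p.2 * antiPart A w α (eta σ) p
            * (heatOp A w a p - antiPart A w α (eta σ) p)
          + commutator A w α (eta σ) a (eta' lam σ p.2) p)
        + k₂ * (2⁻¹ * th' lam p.2 * w p ^ 2 - α * th lam p.2 / eta σ p.2 * w p ^ 2
          + 2⁻¹ * defect A a p * th lam p.2 * w p ^ 2 + th lam p.2 * energy A w p
          + th lam p.2 * w p * heatOp A w a p)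
        + 4 * (th lam p.2 * p.2⁻¹ * eulerDensity a w p))
        ≤ -2⁻¹ * (gaussian a p.1 p.2 * (rho σ α p.2 * (th lam p.2 * errSize α w p)))
          + C * (gaussian a p.1 p.2 * (rho σ α p.2 * (eta σ p.2 * heatOp A w a p ^ 2)))
          + C * α ^ (remExp * α) * (w p ^ 2 + p.2 * gradS w p) := by
        linarith
      have q7 := mul_le_mul_of_nonneg_left q6 hz.le
      simp only [Pi.add_apply]
      calc _ = _ := by ring
        _ ≤ _ := q7
        _ = _ := by ring)
  have j1 : IntegrableOn (fun X : Space n => vert X ^ a * (gaussian a X c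
      * symmForm A w α (rho σ α) (eta σ) (X, c))) (ballPart n 4) :=
    GoodST.integrableOn_slice (gG.mul (gρ.mul (((gw.pow_two.const_mul α).sub (((gη.mul gF).mul gw.pow_two).const_mul _)).sub
      (gη.mul gE)))) hcT₂ S.ha.1
  have j2 : IntegrableOn (fun X : Space n => vert X ^ a * (gaussian a X c
      * (2⁻¹ * (rho σ α c * th lam c * w (X, c) ^ 2)))) (ballPart n 4) :=
    GoodST.integrableOn_slice (gG.mul (((gρ.mul gθ).mul gw.pow_two).const_mul _)) hcT₂ S.ha.1
  obtain ⟨j3, f3⟩ := S.hw.integral_euler_slice S.ha hc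
  have j4 : IntegrableOn (fun X : Space n => vert X ^ a * (gaussian a X c * gradS w (X, c)))
      (ballPart n 4) := GoodST.integrableOn_slice (gG.mul gS) hcT₂ S.ha.1
  have j5 : IntegrableOn (fun X : Space n => vert X ^ a * (gaussian a X c * w (X, c) ^ 2))
      (ballPart n 4) := GoodST.integrableOn_slice (gG.mul gw.pow_two) hcT₂ S.ha.1
  have j6 : IntegrableOn (fun X : Space n => vert X ^ a * w (X, c) ^ 2)
      (ballPart n 4) := GoodST.integrableOn_slice gw.pow_two hcT₂ S.ha.1
  have bdry : k₁ * (∫ X in ballPart n 4, vert X ^ a * (gaussian a X c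
        * symmForm A w α (rho σ α) (eta σ) (X, c)))
      + k₂ * (∫ X in ballPart n 4, vert X ^ a * (gaussian a X c
        * (2⁻¹ * (rho σ α c * th lam c * w (X, c) ^ 2))))
      ≤ -(k₁ / (2 * Λ)) * (rho σ α c * c
          * ∫ X in ballPart n 4, vert X ^ a * (gaussian a X c * gradS w (X, c)))
        + D * (α * rho σ α c * ∫ X in ballPart n 4, vert X ^ a * (gaussian a X c * w (X, c) ^ 2))
        + k₁ * B * (α ^ (remExp * α) * ∫ X in ballPart n 4, vert X ^ a * w (X, c) ^ 2) := by
    have hsl := integral_mono_ae (((j1.const_mul k₁).add (j2.const_mul k₂)).add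
        (j3.const_mul (k₁ / (8 * Λ) * rho σ α c)))
      (((j4.const_mul (-(k₁ / (2 * Λ)) * (rho σ α c * c))).add
        (j5.const_mul (D * (α * rho σ α c)))).add (j6.const_mul (k₁ * B * α ^ (remExp * α)))) (by
      filter_upwards [ae_restrict_mem (measurableSet_ballPart 4)] with X hX
      have hz : 0 < vert X ^ a := Real.rpow_pos_of_pos hX.1 a
      have q := mul_le_mul_of_nonneg_left (slice_bound (p := (X, c)) (w := w) ha hΛ hK hk₁ hk₂ S.hA
        hc hε0 hε1 hεa hδ hδε hα hlam hl1 S.hσ S.c_lt.le hX.2) hz.le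
      simp only [Pi.add_apply]
      calc _ = _ := by ring
        _ ≤ _ := q
        _ = _ := by rw [← hD, ← hB]; ring)
    rw [integral_add' ((j1.const_mul k₁).add (j2.const_mul k₂)) (j3.const_mul _),
      integral_add' (j1.const_mul k₁) (j2.const_mul k₂),
      integral_add' ((j4.const_mul _).add (j5.const_mul _)) (j6.const_mul _),
      integral_add' (j4.const_mul _) (j5.const_mul _), integral_const_mul, integral_const_mul,
      integral_const_mul, integral_const_mul, integral_const_mul, integral_const_mul, f3] at hsl
    linarith
  rw [integral_add' ((i1.const_mul k₁).add (i2.const_mul k₂)) (i3.const_mul _),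
    integral_add' (i1.const_mul k₁) (i2.const_mul k₂),
    integral_add' ((iM.const_mul _).add (hP.const_mul _)) (iU.const_mul _),
    integral_add' (iM.const_mul _) (hP.const_mul _), integral_const_mul, integral_const_mul,
    integral_const_mul, integral_const_mul, integral_const_mul, integral_const_mul, e1, e2, e3] at main
  have hzG : ∀ X : Space n, ∀ t, 0 < vert X → 0 < t → 0 ≤ vert X ^ a * gaussian a X t := by
    intro X t hX ht
    rw [gaussian_eq_exp a X ht]
    exact mul_nonneg (Real.rpow_nonneg hX.le a) (Real.exp_pos _).le
  have hρ0 : ∀ t ∈ Icc c (1 / (3 * lam)), 0 ≤ rho σ α t := fun t ht =>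
    Real.rpow_nonneg (S.hσ.pos t (S.mem_Ioo ht)).le _
  have nM : 0 ≤ ∫ p in box n 4 c (1 / (3 * lam)), vert p.1 ^ a * (gaussian a p.1 p.2 * (rho σ α p.2
      * (th lam p.2 * errSize α w p))) := by
    refine setIntegral_nonneg measurableSet_box fun p hp => ?_
    have ht : 0 < p.2 := hc.trans_le hp.2.1
    have hti : 0 < p.2⁻¹ := inv_pos.2 ht
    have hg := gradS_nonneg (w := w) (p := p)
    rw [← mul_assoc]
    refine mul_nonneg (hzG _ _ hp.1.1 ht) (mul_nonneg (hρ0 _ hp.2) (mul_nonneg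
      (weightBounds hl1 S.hσ ht hp.2.2).th_nonneg ?_))
    rw [errSize]
    positivity
  have nQ : 0 ≤ ∫ p in box n 4 c (1 / (3 * lam)), vert p.1 ^ a * (gaussian a p.1 p.2 * (rho σ α p.2
      * (eta σ p.2 * heatOp A w a p ^ 2))) := by
    refine setIntegral_nonneg measurableSet_box fun p hp => ?_
    have ht : 0 < p.2 := hc.trans_le hp.2.1
    rw [← mul_assoc]
    exact mul_nonneg (hzG _ _ hp.1.1 ht) (mul_nonneg (hρ0 _ hp.2)
      (mul_nonneg (eta_pos ht).le (sq_nonneg _)))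
  have nU : 0 ≤ ∫ p in box n 4 c (1 / (3 * lam)), vert p.1 ^ a * (w p ^ 2 + p.2 * gradS w p) := by
    refine setIntegral_nonneg measurableSet_box fun p hp => ?_
    exact mul_nonneg (Real.rpow_nonneg hp.1.1.le a)
      (add_nonneg (sq_nonneg _) (mul_nonneg (hc.trans_le hp.2.1).le gradS_nonneg))
  have ng : 0 ≤ ∫ X in ballPart n 4, vert X ^ a * (gaussian a X c * gradS w (X, c)) := by
    refine setIntegral_nonneg (measurableSet_ballPart 4) fun X hX => ?_
    rw [← mul_assoc]
    exact mul_nonneg (hzG _ _ hX.1 hc) gradS_nonneg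
  have nw : 0 ≤ ∫ X in ballPart n 4, vert X ^ a * (gaussian a X c * w (X, c) ^ 2) := by
    refine setIntegral_nonneg (measurableSet_ballPart 4) fun X hX => ?_
    rw [← mul_assoc]
    exact mul_nonneg (hzG _ _ hX.1 hc) (sq_nonneg _)
  have nv : 0 ≤ ∫ X in ballPart n 4, vert X ^ a * w (X, c) ^ 2 :=
    setIntegral_nonneg (measurableSet_ballPart 4) fun X hX =>
      mul_nonneg (Real.rpow_nonneg hX.1.le a) (sq_nonneg _)
  have hρc := hρ0 c ⟨le_rfl, S.c_lt.le⟩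
  have hαp : 0 ≤ α ^ (remExp * α) := by positivity
  generalize (∫ p in box n 4 c (1 / (3 * lam)), vert p.1 ^ a * (gaussian a p.1 p.2 * (rho σ α p.2
      * (th lam p.2 * errSize α w p)))) = IM at *
  generalize (∫ p in box n 4 c (1 / (3 * lam)), vert p.1 ^ a * (gaussian a p.1 p.2 * (rho σ α p.2
      * (eta σ p.2 * heatOp A w a p ^ 2)))) = IQ at *
  generalize (∫ p in box n 4 c (1 / (3 * lam)), vert p.1 ^ a * (w p ^ 2 + p.2 * gradS w p)) = IU at *
  generalize (∫ X in ballPart n 4, vert X ^ a * (gaussian a X c * gradS w (X, c))) = Ig at *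
  generalize (∫ X in ballPart n 4, vert X ^ a * (gaussian a X c * w (X, c) ^ 2)) = Iw at *
  generalize (∫ X in ballPart n 4, vert X ^ a * w (X, c) ^ 2) = Iv at *
  have b0 : 0 ≤ rho σ α c * c * Ig := by positivity
  have b1 : m * IM ≤ 2⁻¹ * IM := mul_le_mul_of_nonneg_right (min_le_left _ _) nM
  have b2 : m * (rho σ α c * c * Ig) ≤ k₁ / (2 * Λ) * (rho σ α c * c * Ig) :=
    mul_le_mul_of_nonneg_right (min_le_right _ _) b0
  have b3 : 0 ≤ α * rho σ α c * Iw := by positivity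
  have b4 : 0 ≤ α ^ (remExp * α) * IU := by positivity
  have b5 : 0 ≤ α ^ (remExp * α) * Iv := by positivity
  have hkB : 0 ≤ k₁ * B := by positivity
  have c1 : C * IQ ≤ C' * IQ := by gcongr; linarith
  have c2 : D * (α * rho σ α c * Iw) ≤ C' * (α * rho σ α c * Iw) := by gcongr; linarith
  have c3 : C * (α ^ (remExp * α) * IU) ≤ C' * (α ^ (remExp * α) * IU) := by gcongr; linarith
  have c4 : k₁ * B * (α ^ (remExp * α) * Iv) ≤ C' * (α ^ (remExp * α) * Iv) := by gcongr; linarith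
  have fin : m * (IM + rho σ α c * c * Ig) ≤ C' * IQ + C' * (α * rho σ α c * Iw)
      + C' * (α ^ (remExp * α) * (IU + Iv)) := by linarith
  have e : IM + rho σ α c * c * Ig = m⁻¹ * (m * (IM + rho σ α c * c * Ig)) := by field_simp
  rw [e]
  refine (mul_le_mul_of_nonneg_left fin (inv_pos.2 hm0).le).trans (le_of_eq ?_)
  ring

end Carleman

/-! ### Return to the original operator and to integrals with values in [0, ∞]. -/

namespace Carleman

variable {n : ℕ} {a Λ K lam α c T T₁ : ℝ} {σ : ℝ → ℝ} {w : Space n × ℝ → ℝ}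
  {A : EuclideanSpace ℝ (Fin n) → ℝ → Matrix (Fin (n + 1)) (Fin (n + 1)) ℝ}

/-- Identifies the iterated one-slice derivatives of the operator with the joint space-time
derivatives used so far; differentiating the weight yields the term with a/x_{n+1}. -/
theorem RegularAt.backwardOp_eq {p : Space n × ℝ} (h : RegularAt A w p)
    (hw : IsTestFunction n T₁ w) (a : ℝ) :
    backwardOp a A w p.1 p.2 = vert p.1 ^ a * heatOp A w a p := by
  have hz := h.vert_pos
  have ht := h.time_pos
  have e1 : deriv (fun s => w (p.1, s)) p.2 = dW w (0, 1) p := by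
    rw [deriv_slice_time (f := w) (X := p.1) (t := p.2) h.diff, dW_eq_fderiv hz ht]
  have hv : HasFDerivAt (fun q : Space n × ℝ => vert q.1)
      ((vertL n).comp (ContinuousLinearMap.fst ℝ (Space n) ℝ)) p :=
    ((vertL n).comp (ContinuousLinearMap.fst ℝ (Space n) ℝ)).hasFDerivAt
  have hva : HasFDerivAt (fun q : Space n × ℝ => vert q.1 ^ a) _ p :=
    hv.rpow_const (p := a) (Or.inl hz.ne')
  have e2 : ∀ i, pderiv i (fun Y => vert Y ^ a *
        ∑ j : Fin (n + 1), A (horiz Y) p.2 i j * pderiv j (fun Z => w (Z, p.2)) Y) p.1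
      = vert p.1 ^ a * fderiv ℝ (Carleman.flux A w i) p (dir i, 0)
        + Carleman.flux A w i p * (a * vert p.1 ^ (a - 1) * vert (dir (n := n) i)) := by
    intro i
    have hev : (fun Y => vert Y ^ a *
        ∑ j : Fin (n + 1), A (horiz Y) p.2 i j * pderiv j (fun Z => w (Z, p.2)) Y)
        =ᶠ[𝓝 p.1] fun Y => vert Y ^ a * Carleman.flux A w i (Y, p.2) := by
      have ho : IsOpen {Y : Space n | 0 < vert Y} := isOpen_lt continuous_const (vertL n).continuous
      filter_upwards [ho.mem_nhds hz] with Y hY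
      congr 1
      refine Finset.sum_congr rfl fun j _ => ?_
      rw [fderiv_slice_space (hw.differentiableAt hY ht), dX,
        dW_eq_fderiv (p := (Y, p.2)) hY ht]
      rfl
    have e3 : pderiv i (fun Y => vert Y ^ a * Carleman.flux A w i (Y, p.2)) p.1
        = fderiv ℝ (fun q : Space n × ℝ => vert q.1 ^ a * Carleman.flux A w i q) p (dir i, 0) :=
      fderiv_slice_space (f := fun q : Space n × ℝ => vert q.1 ^ a * Carleman.flux A w i q)
        (X := p.1) (t := p.2) (hva.differentiableAt.fun_mul (h.flux i)) i
    rw [pderiv, hev.fderiv_eq]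
    refine e3.trans ?_
    rw [fd_mul hva.differentiableAt (h.flux i), hva.fderiv]
    rfl
  rw [backwardOp, e1]
  simp only [e2, Finset.sum_add_distrib, ← Finset.mul_sum]
  have e4 : ∑ i, Carleman.flux A w i p * (a * vert p.1 ^ (a - 1) * vert (dir (n := n) i))
      = vert p.1 ^ a * (a / vert p.1 * dX w (Fin.last n) p) := by
    simp only [vert_dir, mul_ite, mul_one, mul_zero, Finset.sum_ite_eq', Finset.mem_univ, if_true]
    rw [h.flux_last, Real.rpow_sub_one hz.ne']
    ring
  rw [e4, heatOp]
  ring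

theorem IsTestFunction.gradSq_eq_gradS (hw : IsTestFunction n T₁ w) {p : Space n × ℝ}
    (h1 : 0 < vert p.1) (h2 : 0 < p.2) : gradSq w p.1 p.2 = gradS w p := hw.gradSq_eq h1 h2

theorem IsTestFunction.gradSq_eq_zero (hw : IsTestFunction n T₁ w) (hc : 0 < c)
    {p : Space n × ℝ} (hp : p ∈ halfSpace n ×ˢ Ici c) (hp' : p ∉ box n 4 c T₁) :
    gradSq w p.1 p.2 = 0 := by
  rw [hw.gradSq_eq_gradS hp.1 (hc.trans_le hp.2), gradS]
  exact Finset.sum_eq_zero fun i _ => by rw [dX, (hw.dW _).eq_zero hc p hp hp']; simp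

section integrals
variable {E : Type*} [MeasurableSpace E] {μ : Measure E} {s t : Set E} {f g : E → ℝ} {k : ℝ}

theorem ofReal_mul_setLIntegral_le (hk : 0 ≤ k) (hs : MeasurableSet s) (ht : MeasurableSet t)
    (hf : ∀ x ∈ s, x ∉ t → f x = 0) (hfg : ∀ x ∈ t, k * f x ≤ g x) (hg0 : ∀ x ∈ t, 0 ≤ g x)
    (hg : IntegrableOn g t μ) :
    ENNReal.ofReal k * ∫⁻ x in s, ENNReal.ofReal (f x) ∂μ ≤ ENNReal.ofReal (∫ x in t, g x ∂μ) := by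
  rw [ofReal_integral_eq_lintegral_ofReal hg ((ae_restrict_iff' ht).2 (Eventually.of_forall hg0)),
    ← lintegral_const_mul' _ _ ENNReal.ofReal_ne_top, ← lintegral_indicator hs,
    ← lintegral_indicator ht]
  refine lintegral_mono fun x => ?_
  by_cases hx : x ∈ t
  · rw [indicator_of_mem hx]
    by_cases hx' : x ∈ s
    · rw [indicator_of_mem hx', ← ENNReal.ofReal_mul hk]
      exact ENNReal.ofReal_le_ofReal (hfg x hx)
    · rw [indicator_of_notMem hx']
      exact bot_le
  · by_cases hx' : x ∈ s
    · simp [hx', hx, hf x hx' hx]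
    · simp [hx']

theorem ofReal_setIntegral_le (hts : t ⊆ s) (hk : 0 ≤ k)
    (hfg : ∀ᵐ x ∂μ.restrict t, g x ≤ k * f x) (hg0 : 0 ≤ᵐ[μ.restrict t] g)
    (hg : AEStronglyMeasurable g (μ.restrict t)) :
    ENNReal.ofReal (∫ x in t, g x ∂μ) ≤ ENNReal.ofReal k * ∫⁻ x in s, ENNReal.ofReal (f x) ∂μ := by
  rw [integral_eq_lintegral_of_nonneg_ae hg0 hg]
  refine ENNReal.ofReal_toReal_le.trans ?_
  rw [← lintegral_const_mul' _ _ ENNReal.ofReal_ne_top]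
  refine le_trans ?_ (lintegral_mono_set hts)
  refine lintegral_mono_ae ?_
  filter_upwards [hfg] with x hx
  rw [← ENNReal.ofReal_mul hk]
  exact ENNReal.ofReal_le_ofReal hx

/-- Supplies the integrability of the H² term when the right side of the estimate is finite. -/
theorem integrableOn_of_setLIntegral_ne_top (hts : t ⊆ s) (hk : 0 ≤ k)
    (hfg : ∀ᵐ x ∂μ.restrict t, g x ≤ k * f x) (hg0 : 0 ≤ᵐ[μ.restrict t] g)
    (hg : AEStronglyMeasurable g (μ.restrict t)) (hf : ∫⁻ x in s, ENNReal.ofReal (f x) ∂μ ≠ ⊤) :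
    IntegrableOn g t μ := by
  refine ⟨hg, ?_⟩
  rw [hasFiniteIntegral_iff_ofReal hg0]
  refine lt_of_le_of_lt ?_ (ENNReal.mul_lt_top (ENNReal.ofReal_lt_top (r := k)) hf.lt_top)
  rw [← lintegral_const_mul' _ _ ENNReal.ofReal_ne_top]
  refine le_trans ?_ (lintegral_mono_set hts)
  refine lintegral_mono_ae ?_
  filter_upwards [hfg] with x hx
  rw [← ENNReal.ofReal_mul hk]
  exact ENNReal.ofReal_le_ofReal hx

end integrals

namespace Setting
variable (S : Setting n a Λ K lam c σ A w)
include S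

theorem aestronglyMeasurable_operator : AEStronglyMeasurable (fun p : Space n × ℝ =>
    vert p.1 ^ a * (gaussian a p.1 p.2 * (rho σ α p.2 * (eta σ p.2 * heatOp A w a p ^ 2))))
    (volume.restrict (box n 4 c (1 / (3 * lam)))) := by
  have hsub : box n 4 c (1 / (3 * lam)) ⊆ box n 5 c (1 / (2 * lam)) := fun p hp =>
    ⟨⟨hp.1.1, hp.1.2.trans (by norm_num)⟩, hp.2.1, hp.2.2.trans S.T_lt.le⟩
  have hgood : ∀ {f : Space n × ℝ → ℝ}, GoodST n c (1 / (3 * lam)) (1 / (2 * lam)) f →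
      AEStronglyMeasurable f (volume.restrict (box n 4 c (1 / (3 * lam)))) := fun hf =>
    (hf.lip.continuousOn.mono hsub).aestronglyMeasurable measurableSet_box
  have hv : Measurable fun p : Space n × ℝ => vert p.1 :=
    ((vertL n).continuous.comp continuous_fst).measurable
  have gG := GoodST.gaussian (n := n) (c := c) a S.T_lt.le S.hc
  have gρ := goodST_rho (n := n) (α := α) S.hσ S.hc S.T_lt.le S.T₂_lt
  have gη := goodST_eta (n := n) S.lam_pos S.hσ S.hc S.T_lt.le S.T₂_lt
  have hheat : AEStronglyMeasurable (heatOp A w a)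
      (volume.restrict (box n 4 c (1 / (3 * lam)))) := by
    unfold heatOp
    refine ((hgood ((S.hw.dW _).good S.hc)).add ?_).add ?_
    · exact (Finset.measurable_fun_sum _ fun k _ =>
        measurable_fderiv_apply_const ℝ _ _).aestronglyMeasurable
    · exact (measurable_const.div hv).aestronglyMeasurable.mul (hgood ((S.hw.dW _).good S.hc))
  exact (hv.pow_const a).aestronglyMeasurable.mul ((hgood gG).mul ((hgood gρ).mul
    ((hgood gη).mul (hheat.pow 2))))

/-- η is comparable to t and hence to σ, so ηρ is at most a constant times σ^{1-2α}; and x^{-a}(x^a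
H)² = x^a H² with x = x_{n+1}. -/
theorem ae_operator_le :
    ∀ᵐ p ∂volume.restrict (box n 4 c (1 / (3 * lam))),
      vert p.1 ^ a * (gaussian a p.1 p.2 * (rho σ α p.2 * (eta σ p.2 * heatOp A w a p ^ 2)))
        ≤ etaConst * Real.exp (16 * 6 ^ (3 / 2 : ℝ)) * (σ p.2 ^ (1 - 2 * α) * vert p.1 ^ (-a)
          * backwardOp a A w p.1 p.2 ^ 2 * gaussian a p.1 p.2) := by
  filter_upwards [S.hw.ae_regularAt (T := 1 / (3 * lam)) S.hA S.hK S.hc,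
    ae_restrict_mem measurableSet_box] with p h hp
  have ht := h.time_pos
  have hmem := S.mem_Ioo hp.2
  have W := weightBounds S.one_le S.hσ ht hp.2.2
  have hσ0 := S.hσ.pos _ hmem
  have hz : 0 < vert p.1 ^ a := Real.rpow_pos_of_pos h.vert_pos a
  have hG : 0 < gaussian a p.1 p.2 := by rw [gaussian_eq_exp a p.1 ht]; exact Real.exp_pos _
  have hρ : 0 < rho σ α p.2 := Real.rpow_pos_of_pos hσ0 _
  have hη : eta σ p.2 ≤ etaConst * Real.exp (16 * 6 ^ (3 / 2 : ℝ)) * σ p.2 := by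
    have h1 := (sigma_bounds S.lam_pos S.hσ hmem).1
    have h2 : p.2 ≤ Real.exp (16 * 6 ^ (3 / 2 : ℝ)) * σ p.2 := by
      calc p.2 = Real.exp (16 * 6 ^ (3 / 2 : ℝ)) * (Real.exp (-(16 * 6 ^ (3 / 2 : ℝ))) * p.2) := by
            rw [← mul_assoc, ← Real.exp_add]; simp
        _ ≤ _ := by gcongr
    have hC : 0 < etaConst := by linarith [one_le_etaConst]
    calc eta σ p.2 ≤ etaConst * p.2 := W.eta_le
      _ ≤ etaConst * (Real.exp (16 * 6 ^ (3 / 2 : ℝ)) * σ p.2) := by gcongr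
      _ = _ := by ring
  have e1 : σ p.2 ^ (1 - 2 * α) = σ p.2 * rho σ α p.2 := by
    rw [rho, sub_eq_add_neg, Real.rpow_add hσ0, Real.rpow_one, neg_mul]
  have e2 : vert p.1 ^ (-a) * (vert p.1 ^ a) ^ 2 = vert p.1 ^ a := by
    rw [sq, ← mul_assoc, ← Real.rpow_add h.vert_pos]
    simp
  rw [h.backwardOp_eq S.hw, e1]
  calc _ ≤ vert p.1 ^ a * (gaussian a p.1 p.2 * (rho σ α p.2
        * (etaConst * Real.exp (16 * 6 ^ (3 / 2 : ℝ)) * σ p.2 * heatOp A w a p ^ 2))) := by gcongr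
    _ = etaConst * Real.exp (16 * 6 ^ (3 / 2 : ℝ)) * (σ p.2 * rho σ α p.2
        * (vert p.1 ^ (-a) * (vert p.1 ^ a) ^ 2) * heatOp A w a p ^ 2 * gaussian a p.1 p.2) := by
        rw [e2]; ring
    _ = _ := by ring

end Setting
end Carleman

/-! ### Comparison of each term with its counterpart in the final estimate. -/

namespace Carleman

variable {n : ℕ} {a Λ K lam α c : ℝ} {σ : ℝ → ℝ} {w : Space n × ℝ → ℝ}
  {A : EuclideanSpace ℝ (Fin n) → ℝ → Matrix (Fin (n + 1)) (Fin (n + 1)) ℝ}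

/-- The supremum of the unweighted energies. -/
noncomputable def supEnergy (a c : ℝ) (w : Space n × ℝ → ℝ) : ℝ≥0∞ :=
  ⨆ t ∈ Ici c, spaceInt n fun X => vert X ^ a * (w (X, t) ^ 2 + t * gradSq w X t)

theorem spaceInt_le_supEnergy {t : ℝ} (ht : c ≤ t) :
    spaceInt n (fun X => vert X ^ a * (w (X, t) ^ 2 + t * gradSq w X t)) ≤ supEnergy a c w :=
  le_iSup₂ (f := fun t (_ : t ∈ Ici c) =>
    spaceInt n fun X => vert X ^ a * (w (X, t) ^ 2 + t * gradSq w X t)) t ht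

theorem gaussian_pos (a : ℝ) (X : Space n) {t : ℝ} (ht : 0 < t) : 0 < gaussian a X t := by
  rw [gaussian_eq_exp a X ht]
  exact Real.exp_pos _

theorem ballPart_subset_halfSpace : ballPart n 4 ⊆ halfSpace n := fun _ hX => hX.1

theorem gradSq_nonneg {X : Space n} {t : ℝ} : 0 ≤ gradSq w X t :=
  Finset.sum_nonneg fun _ _ => sq_nonneg _

namespace Setting
variable (S : Setting n a Λ K lam c σ A w)
include S

theorem rho_pos {t : ℝ} (ht : t ∈ Icc c (1 / (3 * lam))) : 0 < rho σ α t :=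
  Real.rpow_pos_of_pos (S.hσ.pos t (S.mem_Ioo ht)) _

/-- Fubini in time: the time interval has length at most 1, so the space-time integral is bounded by
the supremum over slices. -/
theorem integral_energy_le_supEnergy :
    ENNReal.ofReal (∫ p in box n 4 c (1 / (3 * lam)), vert p.1 ^ a * (w p ^ 2 + p.2 * gradS w p))
      ≤ supEnergy a c w := by
  have gt : GoodST n c (1 / (3 * lam)) (1 / (2 * lam)) fun p => p.2 :=
    GoodST.of_contDiffAt S.T_lt.le fun _ _ _ => contDiffAt_snd
  have iU : IntegrableOn (fun p : Space n × ℝ => vert p.1 ^ a * (w p ^ 2 + p.2 * gradS w p))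
      (box n 4 c (1 / (3 * lam))) :=
    GoodST.integrableOn ((S.hw.good S.hc).pow_two.add (gt.mul (S.hw.goodST_gradS S.hc)))
      S.T_lt.le S.ha.1
  have hnn : 0 ≤ᵐ[volume.restrict (box n 4 c (1 / (3 * lam)))]
      fun p : Space n × ℝ => vert p.1 ^ a * (w p ^ 2 + p.2 * gradS w p) := by
    filter_upwards [ae_restrict_mem measurableSet_box] with p hp
    exact mul_nonneg (Real.rpow_nonneg hp.1.1.le a)
      (add_nonneg (sq_nonneg _) (mul_nonneg (S.hc.trans_le hp.2.1).le gradS_nonneg))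
  rw [ofReal_integral_eq_lintegral_ofReal iU hnn]
  have hm := iU.aestronglyMeasurable.aemeasurable.ennreal_ofReal
  have er : (volume : Measure (Space n × ℝ)).restrict (box n 4 c (1 / (3 * lam)))
      = (volume.restrict (ballPart n 4)).prod (volume.restrict (Icc c (1 / (3 * lam)))) := by
    rw [Measure.prod_restrict, ← Measure.volume_eq_prod]
  rw [er] at hm ⊢
  rw [lintegral_prod_symm _ hm]
  calc _ ≤ ∫⁻ _ in Icc c (1 / (3 * lam)), supEnergy a c w := by
        refine setLIntegral_mono measurable_const fun t ht => ?_
        refine le_trans ?_ (spaceInt_le_supEnergy ht.1)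
        refine le_trans ?_ (lintegral_mono_set ballPart_subset_halfSpace)
        refine le_of_eq (setLIntegral_congr_fun (measurableSet_ballPart 4) fun X hX => ?_)
        have := S.hw.gradSq_eq_gradS (p := (X, t)) hX.1 (S.hc.trans_le ht.1)
        simp only at this ⊢
        rw [this]
    _ = supEnergy a c w * ENNReal.ofReal (1 / (3 * lam) - c) := by simp
    _ ≤ supEnergy a c w * 1 := by
        gcongr
        rw [ENNReal.ofReal_le_one]
        have h3 : 1 / (3 * lam) ≤ 1 := by
          rw [div_le_one (by linarith [S.one_le])]; linarith [S.one_le]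
        linarith [S.hc]
    _ = _ := mul_one _

theorem integral_slice_le_supEnergy :
    ENNReal.ofReal (∫ X in ballPart n 4, vert X ^ a * w (X, c) ^ 2) ≤ supEnergy a c w := by
  have gw := S.hw.good (T := 1 / (3 * lam)) (T₂ := 1 / (2 * lam)) S.hc
  have j : IntegrableOn (fun X : Space n => vert X ^ a * w (X, c) ^ 2) (ballPart n 4) :=
    GoodST.integrableOn_slice gw.pow_two (S.c_lt.le.trans S.T_lt.le) S.ha.1
  refine le_trans ?_ (spaceInt_le_supEnergy le_rfl)
  have := ofReal_setIntegral_le (k := 1) (f := fun X : Space n =>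
      vert X ^ a * (w (X, c) ^ 2 + c * gradSq w X c)) ballPart_subset_halfSpace zero_le_one
    ((ae_restrict_iff' (measurableSet_ballPart 4)).2 (Eventually.of_forall fun X hX => ?_))
    ((ae_restrict_iff' (measurableSet_ballPart 4)).2 (Eventually.of_forall fun X hX => ?_))
    j.aestronglyMeasurable
  · simpa [spaceInt] using this
  · have hz := Real.rpow_nonneg (le_of_lt hX.1 : 0 ≤ vert X) a
    rw [one_mul]
    exact mul_le_mul_of_nonneg_left
      (le_add_of_nonneg_right (mul_nonneg S.hc.le gradSq_nonneg)) hz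
  · exact mul_nonneg (Real.rpow_nonneg (le_of_lt hX.1 : 0 ≤ vert X) a) (sq_nonneg _)

theorem integral_slice_gaussian_le :
    ENNReal.ofReal (∫ X in ballPart n 4, vert X ^ a * (gaussian a X c * w (X, c) ^ 2))
      ≤ spaceInt n fun X => vert X ^ a * w (X, c) ^ 2 * gaussian a X c := by
  have gw := S.hw.good (T := 1 / (3 * lam)) (T₂ := 1 / (2 * lam)) S.hc
  have j : IntegrableOn (fun X : Space n => vert X ^ a * (gaussian a X c * w (X, c) ^ 2))
      (ballPart n 4) :=
    GoodST.integrableOn_slice ((GoodST.gaussian a S.T_lt.le S.hc).mul gw.pow_two)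
      (S.c_lt.le.trans S.T_lt.le) S.ha.1
  have := ofReal_setIntegral_le (k := 1) (f := fun X : Space n =>
      vert X ^ a * w (X, c) ^ 2 * gaussian a X c) ballPart_subset_halfSpace zero_le_one
    (Eventually.of_forall fun X => le_of_eq (by ring))
    ((ae_restrict_iff' (measurableSet_ballPart 4)).2 (Eventually.of_forall fun X hX =>
      mul_nonneg (Real.rpow_nonneg (le_of_lt hX.1 : 0 ≤ vert X) a)
        (mul_nonneg (gaussian_pos a X S.hc).le (sq_nonneg _))))
    j.aestronglyMeasurable
  simpa [spaceInt] using this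

theorem slice_gradient_le {N : ℝ} (hN : 1 ≤ N) :
    ENNReal.ofReal (σ c ^ (-2 * α) * (c / N)) * spaceInt n (fun X =>
        vert X ^ a * gradSq w X c * gaussian a X c)
      ≤ ENNReal.ofReal (rho σ α c * c
        * ∫ X in ballPart n 4, vert X ^ a * (gaussian a X c * gradS w (X, c))) := by
  have j : IntegrableOn (fun X : Space n => vert X ^ a * (gaussian a X c * gradS w (X, c)))
      (ballPart n 4) :=
    GoodST.integrableOn_slice ((GoodST.gaussian a S.T_lt.le S.hc).mul
      (S.hw.goodST_gradS (T := 1 / (3 * lam)) S.hc)) (S.c_lt.le.trans S.T_lt.le) S.ha.1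
  have hρ : 0 < rho σ α c := S.rho_pos ⟨le_rfl, S.c_lt.le⟩
  have hk : σ c ^ (-2 * α) * (c / N) ≤ rho σ α c * c :=
    mul_le_mul_of_nonneg_left (div_le_self S.hc.le hN) hρ.le
  have hnn : ∀ X ∈ ballPart n 4, 0 ≤ vert X ^ a * (gaussian a X c * gradS w (X, c)) :=
    fun X hX => mul_nonneg (Real.rpow_nonneg (le_of_lt hX.1 : 0 ≤ vert X) a)
      (mul_nonneg (gaussian_pos a X S.hc).le gradS_nonneg)
  rw [← integral_const_mul]
  refine (mul_le_mul_left (ENNReal.ofReal_le_ofReal hk) _).trans ?_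
  refine ofReal_mul_setLIntegral_le (mul_pos hρ S.hc).le measurableSet_halfSpace
    (measurableSet_ballPart 4) (fun X hX hX' => ?_) (fun X hX => ?_)
    (fun X hX => mul_nonneg (mul_pos hρ S.hc).le (hnn X hX)) (j.const_mul _)
  · rw [S.hw.gradSq_eq_zero (p := (X, c)) S.hc ⟨hX, mem_Ici.2 le_rfl⟩ fun h => hX' h.1]
    simp
  · rw [S.hw.gradSq_eq_gradS (p := (X, c)) hX.1 S.hc]
    exact le_of_eq (by ring)

/-- θ(λt) ≥ λt ≥ αt turns θ·αw²/t into at least α²w², and with σ ≤ t it turns θ|∇w|² into at least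
ασ|∇w|². Each of the two uses one copy of the integral of θM. -/
theorem spaceTime_le (hα : 1 ≤ α) (hαl : α ≤ lam) :
    ENNReal.ofReal (α ^ 2) * spaceTimeInt n c (fun X t =>
        vert X ^ a * σ t ^ (-2 * α) * w (X, t) ^ 2 * gaussian a X t)
      + ENNReal.ofReal α * spaceTimeInt n c (fun X t =>
        vert X ^ a * σ t ^ (1 - 2 * α) * gradSq w X t * gaussian a X t)
      ≤ ENNReal.ofReal (2 * ∫ p in box n 4 c (1 / (3 * lam)), vert p.1 ^ a * (gaussian a p.1 p.2
        * (rho σ α p.2 * (th lam p.2 * errSize α w p)))) := by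
  have hTT := S.T_lt.le
  have gG := GoodST.gaussian (n := n) (c := c) a hTT S.hc
  have gρ := goodST_rho (n := n) (α := α) S.hσ S.hc S.T_lt.le S.T₂_lt
  have gθ := goodST_th (n := n) S.lam_pos S.hc S.T_lt.le S.T₂_lt
  have iM : IntegrableOn (fun p : Space n × ℝ => vert p.1 ^ a * (gaussian a p.1 p.2 * (rho σ α p.2
      * (th lam p.2 * errSize α w p)))) (box n 4 c (1 / (3 * lam))) :=
    GoodST.integrableOn (gG.mul (gρ.mul (gθ.mul (S.hw.goodST_errSize S.hc hTT α)))) hTT S.ha.1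
  have hα0 : 0 < α := by linarith
  have hpos : ∀ p ∈ box n 4 c (1 / (3 * lam)),
      0 ≤ vert p.1 ^ a * (gaussian a p.1 p.2 * rho σ α p.2) := fun p hp =>
    mul_nonneg (Real.rpow_nonneg (le_of_lt hp.1.1 : 0 ≤ vert p.1) a)
      (mul_pos (gaussian_pos a p.1 (S.hc.trans_le hp.2.1)) (S.rho_pos hp.2)).le
  have hM0 : ∀ p ∈ box n 4 c (1 / (3 * lam)), 0 ≤ th lam p.2 * errSize α w p := by
    intro p hp
    have ht := S.hc.trans_le hp.2.1
    have hti : 0 < p.2⁻¹ := inv_pos.2 ht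
    have hg := gradS_nonneg (w := w) (p := p)
    refine mul_nonneg (weightBounds S.one_le S.hσ ht hp.2.2).th_nonneg ?_
    rw [errSize]
    positivity
  have hnn : ∀ p ∈ box n 4 c (1 / (3 * lam)), 0 ≤ vert p.1 ^ a * (gaussian a p.1 p.2 * (rho σ α p.2
      * (th lam p.2 * errSize α w p))) := by
    intro p hp
    have := mul_nonneg (hpos p hp) (hM0 p hp)
    calc (0 : ℝ) ≤ _ := this
      _ = _ := by ring
  rw [two_mul (∫ p in box n 4 c (1 / (3 * lam)), vert p.1 ^ a * (gaussian a p.1 p.2 * (rho σ α p.2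
    * (th lam p.2 * errSize α w p)))), ENNReal.ofReal_add (setIntegral_nonneg measurableSet_box hnn)
    (setIntegral_nonneg measurableSet_box hnn)]
  refine add_le_add ?_ ?_
  · refine ofReal_mul_setLIntegral_le (sq_nonneg α) (measurableSet_halfSpace.prod measurableSet_Ici)
      measurableSet_box (fun p hp hp' => ?_) (fun p hp => ?_) hnn iM
    · beta_reduce
      rw [Prod.mk.eta, S.hw.eq_zero S.hc p hp hp']
      simp
    · have ht := S.hc.trans_le hp.2.1
      have hti : 0 < p.2⁻¹ := inv_pos.2 ht
      have hg := gradS_nonneg (w := w) (p := p)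
      have W := weightBounds S.one_le S.hσ ht hp.2.2
      have key : α ^ 2 * w p ^ 2 ≤ th lam p.2 * errSize α w p := by
        have h1 : α * p.2 ≤ th lam p.2 :=
          (mul_le_mul_of_nonneg_right hαl ht.le).trans W.mul_le_th
        have h2 : α * (w p ^ 2 * p.2⁻¹) ≤ errSize α w p := by
          have : 0 ≤ ‖p.1‖ ^ 2 * p.2⁻¹ ^ 2 * w p ^ 2 := by positivity
          rw [errSize]
          linarith
        calc α ^ 2 * w p ^ 2 = α * p.2 * (α * (w p ^ 2 * p.2⁻¹)) := by field_simp
          _ ≤ _ := mul_le_mul h1 h2 (by positivity) W.th_nonneg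
      calc _ = vert p.1 ^ a * (gaussian a p.1 p.2 * rho σ α p.2) * (α ^ 2 * w p ^ 2) := by
            simp only [rho]; ring
        _ ≤ _ := mul_le_mul_of_nonneg_left key (hpos p hp)
        _ = _ := by ring
  · refine ofReal_mul_setLIntegral_le hα0.le (measurableSet_halfSpace.prod measurableSet_Ici)
      measurableSet_box (fun p hp hp' => ?_) (fun p hp => ?_) hnn iM
    · beta_reduce
      rw [S.hw.gradSq_eq_zero S.hc hp hp']
      simp
    · have ht := S.hc.trans_le hp.2.1
      have hti : 0 < p.2⁻¹ := inv_pos.2 ht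
      have hg := gradS_nonneg (w := w) (p := p)
      have W := weightBounds S.one_le S.hσ ht hp.2.2
      have hmem := S.mem_Ioo hp.2
      have hσ0 := S.hσ.pos _ hmem
      have key : α * σ p.2 * gradS w p ≤ th lam p.2 * errSize α w p := by
        have h1 : α * σ p.2 ≤ th lam p.2 :=
          (mul_le_mul hαl (sigma_bounds S.lam_pos S.hσ hmem).2 hσ0.le S.lam_pos.le).trans
            W.mul_le_th
        have h2 : gradS w p ≤ errSize α w p := by
          have : 0 ≤ α * (w p ^ 2 * p.2⁻¹) + ‖p.1‖ ^ 2 * p.2⁻¹ ^ 2 * w p ^ 2 := by positivity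
          rw [errSize]
          linarith
        exact mul_le_mul h1 h2 hg W.th_nonneg
      have e1 : σ p.2 ^ (1 - 2 * α) = σ p.2 * rho σ α p.2 := by
        rw [rho, sub_eq_add_neg, Real.rpow_add hσ0, Real.rpow_one, neg_mul]
      beta_reduce
      rw [S.hw.gradSq_eq_gradS hp.1.1 ht, e1]
      calc _ = vert p.1 ^ a * (gaussian a p.1 p.2 * rho σ α p.2) * (α * σ p.2 * gradS w p) := by
            ring
        _ ≤ _ := mul_le_mul_of_nonneg_left key (hpos p hp)
        _ = _ := by ring

end Setting
end Carleman

/-! ### Conclusion. -/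

namespace Carleman

theorem Setting.carleman_estimate {n : ℕ} {a Λ K : ℝ} (ha : a < 1) (hΛ : 0 < Λ) (hK : 0 ≤ K) :
    ∃ N ε : ℝ, 1 ≤ N ∧ 0 < ε ∧ ε ≤ 1 ∧ ∀ {δ α lam c : ℝ} {σ : ℝ → ℝ} {w : Space n × ℝ → ℝ}
      {A : EuclideanSpace ℝ (Fin n) → ℝ → Matrix (Fin (n + 1)) (Fin (n + 1)) ℝ},
      0 < δ → δ ≤ ε / 4 → 160 + n + 1 / δ ^ 2 ≤ α → 2 * etaConst ≤ α → lam = α / δ ^ 2 →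
      Setting n a Λ K lam c σ A w →
      ENNReal.ofReal (α ^ 2) * spaceTimeInt n c (fun X t =>
          vert X ^ a * σ t ^ (-2 * α) * w (X, t) ^ 2 * gaussian a X t)
        + ENNReal.ofReal α * spaceTimeInt n c (fun X t =>
          vert X ^ a * σ t ^ (1 - 2 * α) * gradSq w X t * gaussian a X t)
        + ENNReal.ofReal (σ c ^ (-2 * α) * (c / N)) * spaceInt n (fun X =>
          vert X ^ a * gradSq w X c * gaussian a X c)
      ≤ ENNReal.ofReal N * spaceTimeInt n c (fun X t =>
          σ t ^ (1 - 2 * α) * vert X ^ (-a) * backwardOp a A w X t ^ 2 * gaussian a X t)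
        + ENNReal.ofReal (N * α ^ (remExp * α)) * supEnergy a c w
        + ENNReal.ofReal (σ c ^ (-2 * α) * (N * α)) * spaceInt n (fun X =>
          vert X ^ a * w (X, c) ^ 2 * gaussian a X c) := by
  obtain ⟨C, ε, hC, hε, hε1, hest⟩ := Setting.exists_estimate ha hΛ hK n
  have hη := one_le_etaConst
  set E := etaConst * Real.exp (16 * 6 ^ (3 / 2 : ℝ)) with hE
  have hE0 : 0 < E := mul_pos (by linarith) (Real.exp_pos _)
  have hCE : 0 < C * E := by positivity
  -- The real estimate is doubled. Then 2CE accounts for passing from η to σ in the operator term,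
  -- and 4C for the two unweighted integrals, each bounded by the supremum.
  set N := 1 + 2 * (C * E) + 4 * C with hN
  have hN1 : 1 ≤ N := by linarith
  refine ⟨N, ε, hN1, hε, hε1, fun {δ α lam c σ w A} hδ hδε hα hα2 hlam S => ?_⟩
  have hn : (0 : ℝ) ≤ n := Nat.cast_nonneg n
  have hδ2 : 0 < 1 / δ ^ 2 := by positivity
  have hα0 : 0 < α := by linarith
  have hαl : α ≤ lam := by
    rw [hlam, le_div_iff₀ (by positivity)]
    have : δ ^ 2 ≤ 1 := by nlinarith
    nlinarith
  by_cases hfin : spaceTimeInt n c (fun X t =>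
      σ t ^ (1 - 2 * α) * vert X ^ (-a) * backwardOp a A w X t ^ 2 * gaussian a X t) = ⊤
  · rw [hfin, ENNReal.mul_top (by simpa using by linarith), top_add, top_add]
    exact le_top
  have hsub : box n 4 c (1 / (3 * lam)) ⊆ halfSpace n ×ˢ Ici c := fun p hp => ⟨hp.1.1, hp.2.1⟩
  have hQ0 : ∀ p ∈ box n 4 c (1 / (3 * lam)), 0 ≤ vert p.1 ^ a * (gaussian a p.1 p.2 * (rho σ α p.2
      * (eta σ p.2 * heatOp A w a p ^ 2))) := fun p hp => by
    have ht := S.hc.trans_le hp.2.1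
    exact mul_nonneg (Real.rpow_nonneg (le_of_lt hp.1.1 : 0 ≤ vert p.1) a)
      (mul_nonneg (gaussian_pos a p.1 ht).le (mul_nonneg (S.rho_pos hp.2).le
        (mul_nonneg (eta_pos ht).le (sq_nonneg _))))
  have hQ0' := (ae_restrict_iff' (μ := volume) measurableSet_box).2 (Eventually.of_forall hQ0)
  have iQ := integrableOn_of_setLIntegral_ne_top hsub hE0.le (S.ae_operator_le (α := α)) hQ0'
    S.aestronglyMeasurable_operator hfin
  have lQ := ofReal_setIntegral_le hsub hE0.le (S.ae_operator_le (α := α)) hQ0'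
    S.aestronglyMeasurable_operator
  have hmain := hest hδ hδε hα hα2 hlam S iQ
  have l1 := S.spaceTime_le (α := α) (by linarith) hαl
  have l2 := S.slice_gradient_le (α := α) hN1
  have lU := S.integral_energy_le_supEnergy
  have lV := S.integral_slice_le_supEnergy
  have lW := S.integral_slice_gaussian_le
  have hρ : 0 < rho σ α c := S.rho_pos ⟨le_rfl, S.c_lt.le⟩
  have nJ : 0 ≤ ∫ p in box n 4 c (1 / (3 * lam)), vert p.1 ^ a * (gaussian a p.1 p.2 * (rho σ α p.2
      * (th lam p.2 * errSize α w p))) := by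
    refine setIntegral_nonneg measurableSet_box fun p hp => ?_
    have ht := S.hc.trans_le hp.2.1
    have hti : 0 < p.2⁻¹ := inv_pos.2 ht
    have hg := gradS_nonneg (w := w) (p := p)
    refine mul_nonneg (Real.rpow_nonneg (le_of_lt hp.1.1 : 0 ≤ vert p.1) a)
      (mul_nonneg (gaussian_pos a p.1 ht).le (mul_nonneg (S.rho_pos hp.2).le
        (mul_nonneg (weightBounds S.one_le S.hσ ht hp.2.2).th_nonneg ?_)))
    rw [errSize]
    positivity
  have nQ := setIntegral_nonneg (μ := volume) measurableSet_box hQ0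
  have nU : 0 ≤ ∫ p in box n 4 c (1 / (3 * lam)), vert p.1 ^ a * (w p ^ 2 + p.2 * gradS w p) :=
    setIntegral_nonneg measurableSet_box fun p hp =>
      mul_nonneg (Real.rpow_nonneg (le_of_lt hp.1.1 : 0 ≤ vert p.1) a)
        (add_nonneg (sq_nonneg _) (mul_nonneg (S.hc.trans_le hp.2.1).le gradS_nonneg))
  have ng : 0 ≤ ∫ X in ballPart n 4, vert X ^ a * (gaussian a X c * gradS w (X, c)) :=
    setIntegral_nonneg (measurableSet_ballPart 4) fun X hX =>
      mul_nonneg (Real.rpow_nonneg (le_of_lt hX.1 : 0 ≤ vert X) a)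
        (mul_nonneg (gaussian_pos a X S.hc).le gradS_nonneg)
  have nw : 0 ≤ ∫ X in ballPart n 4, vert X ^ a * (gaussian a X c * w (X, c) ^ 2) :=
    setIntegral_nonneg (measurableSet_ballPart 4) fun X hX =>
      mul_nonneg (Real.rpow_nonneg (le_of_lt hX.1 : 0 ≤ vert X) a)
        (mul_nonneg (gaussian_pos a X S.hc).le (sq_nonneg _))
  have nv : 0 ≤ ∫ X in ballPart n 4, vert X ^ a * w (X, c) ^ 2 :=
    setIntegral_nonneg (measurableSet_ballPart 4) fun X hX =>
      mul_nonneg (Real.rpow_nonneg (le_of_lt hX.1 : 0 ≤ vert X) a) (sq_nonneg _)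
  have hαp : 0 ≤ α ^ (remExp * α) := by positivity
  rw [show ∫⁻ p in halfSpace n ×ˢ Ici c, ENNReal.ofReal (σ p.2 ^ (1 - 2 * α) * vert p.1 ^ (-a)
    * backwardOp a A w p.1 p.2 ^ 2 * gaussian a p.1 p.2) = spaceTimeInt n c (fun X t =>
      σ t ^ (1 - 2 * α) * vert X ^ (-a) * backwardOp a A w X t ^ 2 * gaussian a X t) from rfl] at lQ
  generalize spaceTimeInt n c (fun X t =>
      σ t ^ (1 - 2 * α) * vert X ^ (-a) * backwardOp a A w X t ^ 2 * gaussian a X t) = P at *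
  generalize (∫ p in box n 4 c (1 / (3 * lam)), vert p.1 ^ a * (gaussian a p.1 p.2 * (rho σ α p.2
      * (th lam p.2 * errSize α w p)))) = IM at *
  generalize (∫ p in box n 4 c (1 / (3 * lam)), vert p.1 ^ a * (gaussian a p.1 p.2 * (rho σ α p.2
      * (eta σ p.2 * heatOp A w a p ^ 2)))) = IQ at *
  generalize (∫ p in box n 4 c (1 / (3 * lam)), vert p.1 ^ a * (w p ^ 2 + p.2 * gradS w p)) = IU at *
  generalize (∫ X in ballPart n 4, vert X ^ a * (gaussian a X c * gradS w (X, c))) = Ig at *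
  generalize (∫ X in ballPart n 4, vert X ^ a * (gaussian a X c * w (X, c) ^ 2)) = Iw at *
  generalize (∫ X in ballPart n 4, vert X ^ a * w (X, c) ^ 2) = Iv at *
  have hc := S.hc
  have b0 : 0 ≤ rho σ α c * c * Ig := by positivity
  have hreal : 2 * IM + rho σ α c * c * Ig ≤ 2 * C * IQ
      + 2 * C * α ^ (remExp * α) * (IU + Iv) + 2 * C * (α * rho σ α c) * Iw := by linarith
  refine (add_le_add l1 l2).trans ?_
  rw [← ENNReal.ofReal_add (by positivity) b0]
  refine (ENNReal.ofReal_le_ofReal hreal).trans ?_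
  rw [ENNReal.ofReal_add (by positivity) (by positivity),
    ENNReal.ofReal_add (by positivity) (by positivity)]
  refine add_le_add (add_le_add ?_ ?_) ?_
  · rw [ENNReal.ofReal_mul (by positivity)]
    calc _ ≤ ENNReal.ofReal (2 * C) * (ENNReal.ofReal E * P) := by gcongr
      _ = ENNReal.ofReal (2 * C * E) * P := by rw [← mul_assoc, ← ENNReal.ofReal_mul (by positivity)]
      _ ≤ _ := by
        gcongr
        linarith
  · rw [ENNReal.ofReal_mul (by positivity), ENNReal.ofReal_add nU nv]
    calc _ ≤ ENNReal.ofReal (2 * C * α ^ (remExp * α)) * (supEnergy a c w + supEnergy a c w) := by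
          gcongr
      _ = ENNReal.ofReal (2 * C * α ^ (remExp * α) * 2) * supEnergy a c w := by
          rw [← two_mul, ← mul_assoc, ENNReal.ofReal_mul (by positivity) (q := 2)]
          simp
      _ ≤ _ := by
        refine mul_le_mul_left (ENNReal.ofReal_le_ofReal ?_) _
        have := mul_le_mul_of_nonneg_right (show 4 * C ≤ N by linarith) hαp
        linarith
  · rw [ENNReal.ofReal_mul (by positivity)]
    calc _ ≤ ENNReal.ofReal (2 * C * (α * rho σ α c)) * _ := mul_le_mul_right lW _
      _ ≤ _ := by
        refine mul_le_mul_left (ENNReal.ofReal_le_ofReal ?_) _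
        have := mul_le_mul_of_nonneg_right (show 2 * C ≤ N by linarith)
          (show 0 ≤ α * rho σ α c by positivity)
        rw [show σ c ^ (-2 * α) = rho σ α c from rfl]
        linarith

end Carleman

/-- Carleman estimate for `x_{n+1}^a ∂_t + div (x_{n+1}^a A ∇)`. All integrands are nonnegative and
all integrals take values in `[0, ∞]`; the term at `t = c` that carries a minus sign, which is
always finite, stands on the left-hand side. -/
theorem mainTheorem5 (n : ℕ) (hn : 1 ≤ n) (a : ℝ) (ha : a ∈ Set.Ioo (-1 : ℝ) 1)
    (Λ K : ℝ) (hΛ : 1 < Λ) (hK : 0 < K) :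
    ∃ N c' δ₀ : ℝ, 0 < N ∧ 0 < c' ∧ δ₀ ∈ Set.Ioo (0 : ℝ) 1 ∧
      ∀ δ ∈ Set.Ioc (0 : ℝ) δ₀, ∃ α₀ : ℝ, 0 < α₀ ∧ ∀ α lam : ℝ, α₀ ≤ α → lam = α / δ ^ 2 →
      ∀ σ : ℝ → ℝ, Carleman.IsCarlemanWeight lam σ →
      ∀ A : EuclideanSpace ℝ (Fin n) → ℝ → Matrix (Fin (n + 1)) (Fin (n + 1)) ℝ,
        Carleman.IsAdmissible n Λ K A →
      ∀ w : Carleman.Space n × ℝ → ℝ, Carleman.IsTestFunction n (1 / (3 * lam)) w →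
        Carleman.HasZeroWeightedNeumann a w →
      ∀ c : ℝ, 0 < c → c ≤ 1 / (5 * lam) →
        ENNReal.ofReal (α ^ 2) * Carleman.spaceTimeInt n c (fun X t =>
            Carleman.vert X ^ a * σ t ^ (-2 * α) * w (X, t) ^ 2 * Carleman.gaussian a X t)
        + ENNReal.ofReal α * Carleman.spaceTimeInt n c (fun X t =>
            Carleman.vert X ^ a * σ t ^ (1 - 2 * α) * Carleman.gradSq w X t *
              Carleman.gaussian a X t)
        + ENNReal.ofReal (σ c ^ (-2 * α) * (c / N)) * Carleman.spaceInt n (fun X =>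
            Carleman.vert X ^ a * Carleman.gradSq w X c * Carleman.gaussian a X c)
        ≤ ENNReal.ofReal N * Carleman.spaceTimeInt n c (fun X t =>
            σ t ^ (1 - 2 * α) * Carleman.vert X ^ (-a) * Carleman.backwardOp a A w X t ^ 2 *
              Carleman.gaussian a X t)
        + ENNReal.ofReal (N * α ^ (c' * α)) * (⨆ t ∈ Set.Ici c, Carleman.spaceInt n (fun X =>
            Carleman.vert X ^ a * (w (X, t) ^ 2 + t * Carleman.gradSq w X t)))
        + ENNReal.ofReal (σ c ^ (-2 * α) * (N * α)) * Carleman.spaceInt n (fun X =>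
            Carleman.vert X ^ a * w (X, c) ^ 2 * Carleman.gaussian a X c) := by
  obtain ⟨N, ε, hN, hε, hε1, hest⟩ :=
    Carleman.Setting.carleman_estimate (n := n) (Λ := Λ) ha.2 (by linarith) hK.le
  -- In the threshold for α, 160 and n serve the Gaussian decay, 1/δ² gives λ ≤ α², and 2`etaConst`
  -- serves the Caccioppoli bound.
  refine ⟨N, Carleman.remExp, ε / 4, by linarith, Carleman.remExp_pos, ⟨by linarith, by linarith⟩,
    fun δ hδ => ⟨160 + n + 1 / δ ^ 2 + 2 * Carleman.etaConst, ?_, ?_⟩⟩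
  · have := Carleman.one_le_etaConst
    positivity
  · intro α lam hα hlam σ hσ A hA w hw hNeu c hc hc'
    have hη := Carleman.one_le_etaConst
    have hδ0 := hδ.1
    have hδ2 : 0 < 1 / δ ^ 2 := by positivity
    have hn0 : (0 : ℝ) ≤ n := Nat.cast_nonneg n
    have hδ1 : δ ^ 2 ≤ 1 := by nlinarith [hδ.2]
    have hl : 1 ≤ lam := by
      rw [hlam, le_div_iff₀ (by positivity)]
      linarith
    exact hest hδ0 hδ.2 (by linarith) (by linarith) hlam
      ⟨ha, hK.le, hl, hσ, hA, hw, hNeu, hc, hc'⟩
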